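/- **Notation.** Let $m>0$ and let $p\cdot x=p^0x^0-\sum_{j=1}^3p_jx^j$, $g=\mathrm{diag}(1,-1,-1,-1)$. Let $\mathcal S^0(\mathbb R^n;\mathbb C^4)$ be the closed subspace of $\mathcal S(\mathbb R^n;\mathbb C^4)$ of the functions all of whose derivatives vanish at $0$, and let $\mathcal S^{00}(\mathbb R^n;\mathbb C^4)$ be its inverse image under the Fourier transform. The *free electromagnetic potential* $A$ has the kernels $$\kappa_{0,1}(\nu,\boldsymbol p;\mu,x)=\frac{g_{\nu\mu}}{(2\pi)^{3/2}\sqrt{2|\boldsymbol p|}}e^{-ip\cdot x},\qquad \kappa_{1,0}(\nu,\boldsymbol p;\mu,x)=\frac{g_{\nu\mu}}{(2\pi)^{3/2}\sqrt{2|\boldsymbol p|}}e^{ip\cdot x},\qquad p=(|\boldsymbol p|,\boldsymbol p).$$ The *free Dirac field* $\psi$ of mass $m$ has, with $p=(E(\boldsymbol p),\boldsymbol p)$ and $E(\boldsymbol p)=\sqrt{|\boldsymbol p|^2+m^2}$, the kernels $\kappa_{0,1}(s,\boldsymbol p;a,x)=(2\pi)^{-3/2}u_s^a(\boldsymbol p)e^{-ip\cdot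 x}$ for $s=1,2$ and $0$ for $s=3,4$, and $\kappa_{1,0}(s,\boldsymbol p;a,x)=(2\pi)^{-3/2}v_{s-2}^a(\boldsymbol p)e^{ip\cdot x}$ for $s=3,4$ and $0$ for $s=1,2$, where, with the standard basis $\chi_1,\chi_2$ of $\mathbb C^2$, the Pauli matrices $\boldsymbol\sigma$ and $w_s=\frac{\boldsymbol p\cdot\boldsymbol\sigma}{E(\boldsymbol p)+m}\chi_s$, $$u_s=\tfrac1{\sqrt2}\sqrt{\tfrac{E+m}{2E}}\begin{pmatrix}\chi_s+w_s\\ \chi_s-w_s\end{pmatrix},\qquad v_s=\tfrac1{\sqrt2}\sqrt{\tfrac{E+m}{2E}}\begin{pmatrix}\chi_s+w_s\\ -(\chi_s-w_s)\end{pmatrix}.$$ For a space-time test function $\phi$ and a momentum test function $\xi$ put $\kappa(\phi)(s,\boldsymbol p)=\sum_a\int\kappa(s,\boldsymbol p;a,x)\phi^a(x)\,d^4x$ and $\kappa(\xi)(a,x)=\sum_s\int\kappa(s,\boldsymbol p;a,x)\xi^s(\boldsymbol p)\,d^3\boldsymbol p$. Let $L(X,Y)$ be the space of continuous linear maps with the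 topology of uniform convergence on bounded sets, and $X^*=L(X,\mathbb C)$. For a momentum test space $E$ let $(E)$ be the Hida test space over the Fock space (symmetric for $A$, antisymmetric for $\psi$): the sequences $\Phi=(\Phi_n)$ of (anti)symmetric $\Phi_n\in E^{\hat\otimes n}$ for which all norms $\big(\sum_n n!\,|(H^{\otimes n})^k\Phi_n|_{L^2}^2\big)^{1/2}$, $k=0,1,2,\dots$, are finite, topologized by these norms, where $H=-\Delta+|\boldsymbol p|^2+1$. The field with kernels $\kappa_{0,1},\kappa_{1,0}$ is $\phi\mapsto\Xi(\kappa_{0,1}(\phi))+\Xi(\kappa_{1,0}(\phi))$, where for a function $w(s,\boldsymbol p)$ the operator $\Xi(\kappa_{0,1}(\phi))$ with $w=\kappa_{0,1}(\phi)$ is $\sum_s\int w(s,\boldsymbol p)\,\partial_{s,\boldsymbol p}\,d^3\boldsymbol p$ (annihilation) and $\Xi(\kappa_{1,0}(\phi))$ with $w=\kappa_{1,0}(\phi)$ is $\sum_s\int w(s,\boldsymbol p)\,\partial^*_{s,\boldsymbol p}\,d^3\boldsymbol p$ (creation). **Lemma.** Let $(E,\mathcal E)$ be one of the two matching pairs of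 test spaces $\big(\mathcal S(\mathbb R^3;\mathbb C^4),\mathcal S(\mathbb R^4;\mathbb C^4)\big)$ and $\big(\mathcal S^0(\mathbb R^3;\mathbb C^4),\mathcal S^{00}(\mathbb R^4;\mathbb C^4)\big)$. For each of the fields $A$ and $\psi$ the following are equivalent: 1. the field is an operator-valued distribution, that is, it belongs to $L\big(\mathcal E,L((E),(E))\big)$; 2. $\kappa_{0,1},\kappa_{1,0}\in L(\mathcal E,E)$; 3. $\kappa_{0,1},\kappa_{1,0}\in L(E^*,\mathcal E^*)$, that is, the map $\xi\mapsto\big(\phi\mapsto\sum_s\int\xi^s(\boldsymbol p)\,\kappa(\phi)(s,\boldsymbol p)\,d^3\boldsymbol p\big)$ extends from $E\subset E^*$ to a continuous linear map $E^*\to\mathcal E^*$; 4. $E=\mathcal S^0(\mathbb R^3;\mathbb C^4)$ and $\mathcal E=\mathcal S^{00}(\mathbb R^4;\mathbb C^4)$ in the case of $A$; $E=\mathcal S(\mathbb R^3;\mathbb C^4)$ and $\mathcal E=\mathcal S(\mathbb R^4;\mathbb C^4)$ in the case of $\psi$. For the two mixed pairs, conditions 1, 2 and 3 hold, for both fields,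 if $(E,\mathcal E)=\big(\mathcal S(\mathbb R^3;\mathbb C^4),\mathcal S^{00}(\mathbb R^4;\mathbb C^4)\big)$, and none of them holds, for either field, if $(E,\mathcal E)=\big(\mathcal S^0(\mathbb R^3;\mathbb C^4),\mathcal S(\mathbb R^4;\mathbb C^4)\big)$. Moreover, with $E=\mathcal S^0(\mathbb R^3;\mathbb C^4)$ for $A$ and $E=\mathcal S(\mathbb R^3;\mathbb C^4)$ for $\psi$, the maps $\xi\mapsto\kappa_{0,1}(\xi)$ and $\xi\mapsto\kappa_{1,0}(\xi)$ belong to $L(E,\mathcal O_M)$, where $\mathcal O_M=\mathcal O_M(\mathbb R^4;\mathbb C^4)$ is the space of smooth functions with polynomially bounded derivatives with the seminorms $f\mapsto\sup_x|\varphi(x)|\,|D^nf(x)|$ ($\varphi\in\mathcal S(\mathbb R^4)$, $n\ge0$); and for each $\xi\in E$ the functions $\kappa_{0,1}(\xi)$ and $\kappa_{1,0}(\xi)$ are smooth with all derivatives bounded. -/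

import Mathlib

open MeasureTheory
open scoped SchwartzMap FourierTransform LineDeriv ContDiff ENNReal

noncomputable section

namespace FreeField

/-- Momentum space `ℝ³`. -/
abbrev R3 : Type := EuclideanSpace ℝ (Fin 3)

/-- Space-time `ℝ⁴`; the coordinate `0` is time. -/
abbrev R4 : Type := EuclideanSpace ℝ (Fin 4)

/-- The component space `ℂ⁴`. -/
abbrev C4 : Type := EuclideanSpace ℂ (Fin 4)

/-! ### Test spaces -/

/-- `S⁰(ℝᵈ;ℂ⁴)`: the Schwartz functions all of whose derivatives vanish at zero. -/
def S0 (d : ℕ) : Submodule ℂ 𝓢(EuclideanSpace ℝ (Fin d), C4) where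
  carrier := {f | ∀ n : ℕ, iteratedFDeriv ℝ n f 0 = 0}
  zero_mem' n := by
    have : ((0 : 𝓢(EuclideanSpace ℝ (Fin d), C4)) : EuclideanSpace ℝ (Fin d) → C4)
        = fun _ => 0 := rfl
    rw [this, iteratedFDeriv_fun_zero]; rfl
  add_mem' {f g} hf hg n := by
    have h := iteratedFDeriv_add_apply (𝕜 := ℝ) (i := n) (x := (0 : EuclideanSpace ℝ (Fin d)))
      ((f.smooth n).contDiffAt) ((g.smooth n).contDiffAt)
    have e : (⇑(f + g)) = (⇑f + ⇑g) := rfl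
    rw [e, h, hf n, hg n, add_zero]
  smul_mem' c f hf n := by
    have h := iteratedFDeriv_const_smul_apply (𝕜 := ℝ) (i := n) (a := c)
      (x := (0 : EuclideanSpace ℝ (Fin d))) ((f.smooth n).contDiffAt)
    have e : (⇑(c • f)) = (c • ⇑f) := rfl
    rw [e, h, hf n, smul_zero]

/-- `S⁰⁰(ℝᵈ;ℂ⁴)`: the inverse image of `S⁰(ℝᵈ;ℂ⁴)` under the Fourier transform. -/
def S00 (d : ℕ) : Submodule ℂ 𝓢(EuclideanSpace ℝ (Fin d), C4) :=
  (S0 d).comap (SchwartzMap.fourierTransformCLM ℂ).toLinearMap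

/-! ### The plane-wave kernels -/

/-- Kernels `κ(s, p; a, x)`: functions of the discrete index `s` and the momentum `p`, and of the
field component `a` and the space-time point `x`. -/
abbrev PlaneKernel : Type := Fin 4 → R3 → Fin 4 → R4 → ℂ

/-- The energy `p⁰(p) = (|p|² + m²)^{1/2}` on the mass-`m` orbit. -/
def energy (m : ℝ) (p : R3) : ℝ := √(‖p‖ ^ 2 + m ^ 2)

/-- The Minkowski product `p · x = p⁰(p) x⁰ - ∑ⱼ pⱼ xʲ` for `p` on the mass-`m` orbit. -/
def minkowskiProd (m : ℝ) (p : R3) (x : R4) : ℝ :=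
  energy m p * x 0 - ∑ j : Fin 3, p j * x j.succ

/-- The Minkowski metric tensor `g = diag(1,-1,-1,-1)`. -/
def metric : Matrix (Fin 4) (Fin 4) ℝ := Matrix.diagonal ![1, -1, -1, -1]

/-- `(2π)^{3/2}`. -/
def normConst : ℝ := (2 * Real.pi) ^ (3 / 2 : ℝ)

/-- The kernel `κ_{0,1}` of the free electromagnetic potential. -/
def potential01 : PlaneKernel := fun ν p μ x =>
  ((metric ν μ / (normConst * √(2 * energy 0 p)) : ℝ) : ℂ) *
    Complex.exp (-(Complex.I * (minkowskiProd 0 p x : ℂ)))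

/-- The kernel `κ_{1,0}` of the free electromagnetic potential. -/
def potential10 : PlaneKernel := fun ν p μ x =>
  ((metric ν μ / (normConst * √(2 * energy 0 p)) : ℝ) : ℂ) *
    Complex.exp (Complex.I * (minkowskiProd 0 p x : ℂ))

/-- The Pauli matrices. -/
def pauli : Fin 3 → Matrix (Fin 2) (Fin 2) ℂ :=
  ![!![0, 1; 1, 0], !![0, -Complex.I; Complex.I, 0], !![1, 0; 0, -1]]

/-- `((p · σ) / (E(p) + m)) χ_s`, where `χ_s` is the `s`-th standard basis vector of `ℂ²`. -/
def boostSpinor (m : ℝ) (s : Fin 2) (p : R3) : Fin 2 → ℂ :=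
  (((energy m p + m)⁻¹ : ℝ) : ℂ) • ((∑ j : Fin 3, (p j : ℂ) • pauli j).mulVec (Pi.single s 1))

/-- `(1/√2) ((E(p) + m) / (2 E(p)))^{1/2}`. -/
def spinorNorm (m : ℝ) (p : R3) : ℝ :=
  1 / √2 * √((energy m p + m) / (2 * energy m p))

/-- The positive-frequency spinors `u_s(p)` in the chiral representation. -/
def uSpinor (m : ℝ) (s : Fin 2) (p : R3) : Fin 4 → ℂ :=
  let χ : Fin 2 → ℂ := Pi.single s 1
  let w := boostSpinor m s p
  (spinorNorm m p : ℂ) • ![χ 0 + w 0, χ 1 + w 1, χ 0 - w 0, χ 1 - w 1]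

/-- The negative-frequency spinors `v_s(p)` in the chiral representation. -/
def vSpinor (m : ℝ) (s : Fin 2) (p : R3) : Fin 4 → ℂ :=
  let χ : Fin 2 → ℂ := Pi.single s 1
  let w := boostSpinor m s p
  (spinorNorm m p : ℂ) • ![χ 0 + w 0, χ 1 + w 1, -(χ 0 - w 0), -(χ 1 - w 1)]

/-- The kernel `κ_{0,1}` of the free Dirac field of mass `m`; the spin index `s = 1, 2, 3, 4` is
numbered here from `0` to `3`. -/
def dirac01 (m : ℝ) : PlaneKernel := fun s p a x =>
  (![uSpinor m 0 p a, uSpinor m 1 p a, 0, 0] s) / (normConst : ℂ) *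
    Complex.exp (-(Complex.I * (minkowskiProd m p x : ℂ)))

/-- The kernel `κ_{1,0}` of the free Dirac field of mass `m`. -/
def dirac10 (m : ℝ) : PlaneKernel := fun s p a x =>
  (![0, 0, vSpinor m 0 p a, vSpinor m 1 p a] s) / (normConst : ℂ) *
    Complex.exp (Complex.I * (minkowskiProd m p x : ℂ))

/-- `κ(φ)(s,p) = ∑ₐ ∫ κ(s,p;a,x) φᵃ(x) d⁴x`. -/
def smear (κ : PlaneKernel) (φ : R4 → C4) (s : Fin 4) (p : R3) : ℂ :=
  ∑ a : Fin 4, ∫ x : R4, κ s p a x * φ x a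

/-- `κ(ξ)(a,x) = ∑ₛ ∫ κ(s,p;a,x) ξˢ(p) d³p`. -/
def smearMomentum (κ : PlaneKernel) (ξ : R3 → C4) (x : R4) : C4 :=
  WithLp.toLp 2 fun a : Fin 4 => ∑ s : Fin 4, ∫ p : R3, κ s p a x * ξ p s

/-! ### Kernels as continuous operators `𝓔 → E` and `E* → 𝓔*` -/

/-- `κ ∈ L(𝓔, E)`. -/
def KernelInL (κ : PlaneKernel) (E : Submodule ℂ 𝓢(R3, C4)) (𝓔 : Submodule ℂ 𝓢(R4, C4)) : Prop :=
  ∃ K : 𝓔 →L[ℂ] E, ∀ (φ : 𝓔) (s : Fin 4),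
    ∀ᵐ p : R3, (K φ : 𝓢(R3, C4)) p s = smear κ (φ : 𝓢(R4, C4)) s p

/-- The functional `η ↦ ∑ₛ ∫ ξˢ(p) ηˢ(p) d³p` on `E` given by `ξ ∈ E`; this is the inclusion
`E ⊂ E*`. -/
def toDual (E : Submodule ℂ 𝓢(R3, C4)) (ξ : E) : E →L[ℂ] ℂ :=
  (∑ s : Fin 4, (SchwartzMap.integralCLM ℂ (volume : Measure R3)) ∘L
    (SchwartzMap.pairing (ContinuousLinearMap.mul ℂ ℂ)
      (SchwartzMap.postcompCLM (EuclideanSpace.proj s : C4 →L[ℂ] ℂ) (ξ : 𝓢(R3, C4)))) ∘L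
    (SchwartzMap.postcompCLM (EuclideanSpace.proj s : C4 →L[ℂ] ℂ))) ∘L E.subtypeL

theorem toDual_apply (E : Submodule ℂ 𝓢(R3, C4)) (ξ η : E) :
    toDual E ξ η = ∑ s : Fin 4, ∫ p : R3, (ξ : 𝓢(R3, C4)) p s * (η : 𝓢(R3, C4)) p s := by
  simp [toDual, SchwartzMap.integralCLM_apply]

/-- `κ ∈ L(E*, 𝓔*)`, the duals being strong duals: the map `ξ ↦ (φ ↦ ∑ₛ ∫ ξˢ(p) κ(φ)(s,p) d³p)`
from `E` to `𝓔*` extends to a continuous linear map `E* → 𝓔*`. -/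
def KernelInDualL (κ : PlaneKernel) (E : Submodule ℂ 𝓢(R3, C4)) (𝓔 : Submodule ℂ 𝓢(R4, C4)) :
    Prop :=
  ∃ K : (E →L[ℂ] ℂ) →L[ℂ] (𝓔 →L[ℂ] ℂ), ∀ (ξ : E) (φ : 𝓔),
    K (toDual E ξ) φ =
      ∑ s : Fin 4, ∫ p : R3, (ξ : 𝓢(R3, C4)) p s * smear κ (φ : 𝓢(R4, C4)) s p

/-! ### The Hida test space `(E)` over the Fock space -/

/-- Scalar Schwartz functions of `n` momenta. -/
abbrev SchwartzN (n : ℕ) : Type := 𝓢(Fin n → R3, ℂ)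

/-- `n`-particle functions with `n` discrete indices `s₁, …, sₙ` and `n` momenta `p₁, …, pₙ`. -/
abbrev NParticle (n : ℕ) : Type := (Fin n → Fin 4) → SchwartzN n

/-- The completed tensor power `E^{⊗n}`: the closure of the linear span of the functions
`ξ₁ ⊗ ⋯ ⊗ ξₙ`, `ξᵢ ∈ E`, in the Schwartz space of functions of `n` momenta. -/
def tensorPower (E : Submodule ℂ 𝓢(R3, C4)) (n : ℕ) : Submodule ℂ (NParticle n) :=
  (Submodule.span ℂ {f : NParticle n | ∃ ξ : Fin n → E,
    ∀ s p, f s p = ∏ i : Fin n, (ξ i : 𝓢(R3, C4)) (p i) (s i)}).topologicalClosure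

theorem hasTemperateGrowth_weight {n : ℕ} (i : Fin n) :
    (fun p : Fin n → R3 => ((‖p i‖ ^ 2 + 1 : ℝ) : ℂ)).HasTemperateGrowth := by
  have h1 : (fun x : R3 => ‖x‖ ^ 2 + 1).HasTemperateGrowth :=
    (Function.hasTemperateGrowth_norm_sq (H := R3)).add (.const 1)
  have h2 : (fun p : Fin n → R3 => p i).HasTemperateGrowth :=
    (ContinuousLinearMap.proj (R := ℝ) (φ := fun _ : Fin n => R3) i).hasTemperateGrowth
  exact (Complex.ofRealCLM.hasTemperateGrowth.comp h1).comp h2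

/-- The operator `H = -Δ + |p|² + 1` acting on the `i`-th momentum. -/
def oscillator {n : ℕ} (i : Fin n) : SchwartzN n →L[ℂ] SchwartzN n :=
  SchwartzMap.smulLeftCLM ℂ (fun p : Fin n → R3 => ((‖p i‖ ^ 2 + 1 : ℝ) : ℂ)) -
    ∑ j : Fin 3,
      (LineDeriv.lineDerivOpCLM ℂ (SchwartzN n)
        (Pi.single i (EuclideanSpace.single j (1 : ℝ)) : Fin n → R3)) ^ 2

theorem oscillator_apply {n : ℕ} (i : Fin n) (f : SchwartzN n) (p : Fin n → R3) :
    oscillator i f p = ((‖p i‖ ^ 2 + 1 : ℝ) : ℂ) * f p -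
      ∑ j : Fin 3, (∂_{(Pi.single i (EuclideanSpace.single j (1 : ℝ)) : Fin n → R3)}
        (∂_{(Pi.single i (EuclideanSpace.single j (1 : ℝ)) : Fin n → R3)} f)) p := by
  simp only [oscillator, sub_apply, sum_apply]
  rw [SchwartzMap.smulLeftCLM_apply_apply (hasTemperateGrowth_weight i)]
  simp only [pow_two (LineDeriv.lineDerivOpCLM ℂ (SchwartzN n) _)]
  rfl

/-- `(H ⊗ ⋯ ⊗ H)^k`. -/
def oscillatorPow (n k : ℕ) : SchwartzN n →L[ℂ] SchwartzN n :=
  ((List.ofFn fun i : Fin n => oscillator i).prod) ^ k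

/-- The statistics of a field. -/
inductive Statistics : Type
  | bose
  | fermi

/-- The factor by which an `n`-particle function changes under a permutation. -/
def Statistics.permSign : Statistics → {n : ℕ} → Equiv.Perm (Fin n) → ℂ
  | .bose, _, _ => 1
  | .fermi, _, σ => ((Equiv.Perm.sign σ : ℤ) : ℂ)

/-- The factor picked up when the particle number `i` (counted from `0`) is moved to the front. -/
def Statistics.moveSign : Statistics → ℕ → ℂ
  | .bose, _ => 1
  | .fermi, i => (-1) ^ i

/-- Sequences `(Φ₀, Φ₁, Φ₂, …)` of `n`-particle functions. -/
abbrev FockSeq : Type := ∀ n : ℕ, NParticle n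

/-- The index `(n; s₁, …, sₙ)`. -/
abbrev FockIndex : Type := Σ n : ℕ, (Fin n → Fin 4)

instance (n : ℕ) : (volume : Measure (Fin n → R3)).IsAddHaarMeasure :=
  inferInstanceAs (Measure.pi fun _ : Fin n => (volume : Measure R3)).IsAddHaarMeasure

/-- The family `√(n!) (H ⊗ ⋯ ⊗ H)^k Φₙ(s₁,…,sₙ; ·)`, as elements of `L²(ℝ³ⁿ)`; the square of its
`ℓ²`-norm is `∑ₙ n! |(H^{⊗n})^k Φₙ|²`, the square of the norm of `Γ(H)^k Φ` in Fock space. -/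
def fockWeight (k : ℕ) : FockSeq →ₗ[ℂ]
    (∀ i : FockIndex, Lp ℂ 2 (volume : Measure (Fin i.1 → R3))) where
  toFun Φ i := ((√(i.1.factorial : ℝ) : ℝ) : ℂ) •
    SchwartzMap.toLpCLM ℂ ℂ 2 (volume : Measure (Fin i.1 → R3)) (oscillatorPow i.1 k (Φ i.1 i.2))
  map_add' Φ Ψ := by
    funext i
    simp only [Pi.add_apply, map_add, smul_add]
  map_smul' c Φ := by
    funext i
    simp only [Pi.smul_apply, map_smul, RingHom.id_apply]
    rw [smul_comm]

/-- The sequences with `Φₙ ∈ E^{⊗n}` symmetric (antisymmetric) and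
`∑ₙ n! |(H^{⊗n})^k Φₙ|² < ∞` for all `k`. -/
def hidaSubmodule (ε : Statistics) (E : Submodule ℂ 𝓢(R3, C4)) : Submodule ℂ FockSeq where
  carrier := {Φ | (∀ n, Φ n ∈ tensorPower E n) ∧
    (∀ (n : ℕ) (σ : Equiv.Perm (Fin n)) (s : Fin n → Fin 4) (p : Fin n → R3),
      Φ n (s ∘ σ) (p ∘ σ) = ε.permSign σ * Φ n s p) ∧
    ∀ k, Memℓp (fockWeight k Φ) 2}
  zero_mem' := by
    refine ⟨fun n => zero_mem _, fun n σ s p => ?_, fun k => ?_⟩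
    · simp
    · rw [map_zero]; exact zero_memℓp
  add_mem' {Φ Ψ} hΦ hΨ := by
    refine ⟨fun n => add_mem (hΦ.1 n) (hΨ.1 n), fun n σ s p => ?_, fun k => ?_⟩
    · simp only [Pi.add_apply, add_apply]
      rw [hΦ.2.1, hΨ.2.1, mul_add]
    · rw [map_add]; exact (hΦ.2.2 k).add (hΨ.2.2 k)
  smul_mem' c Φ hΦ := by
    refine ⟨fun n => Submodule.smul_mem _ c (hΦ.1 n), fun n σ s p => ?_, fun k => ?_⟩
    · simp only [Pi.smul_apply, smul_apply, smul_eq_mul]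
      rw [hΦ.2.1]; ring
    · rw [map_smul]; exact (hΦ.2.2 k).const_smul c

/-- The Hida test space `(E)`. On the closed subspace `E` of the Schwartz space the norms
`|H^k ·|_{L²}` define the topology, and the topology of `(E)` is given by the norms
`|Γ(H)^k ·|`, `k = 0, 1, 2, …`. -/
def HidaSpace (ε : Statistics) (E : Submodule ℂ 𝓢(R3, C4)) : Type := hidaSubmodule ε E

instance (ε : Statistics) (E : Submodule ℂ 𝓢(R3, C4)) : AddCommGroup (HidaSpace ε E) :=
  inferInstanceAs (AddCommGroup (hidaSubmodule ε E))

instance (ε : Statistics) (E : Submodule ℂ 𝓢(R3, C4)) : Module ℂ (HidaSpace ε E) :=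
  inferInstanceAs (Module ℂ (hidaSubmodule ε E))

/-- The sequence `(Φ₀, Φ₁, …)` of an element of `(E)`. -/
def HidaSpace.seq {ε : Statistics} {E : Submodule ℂ 𝓢(R3, C4)} : HidaSpace ε E →ₗ[ℂ] FockSeq :=
  (hidaSubmodule ε E).subtype

/-- `Γ(H)^k` as a linear map from `(E)` into the square-summable sequences. -/
def fockEmbed (ε : Statistics) (E : Submodule ℂ 𝓢(R3, C4)) (k : ℕ) :
    HidaSpace ε E →ₗ[ℂ] lp (fun i : FockIndex => Lp ℂ 2 (volume : Measure (Fin i.1 → R3))) 2 where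
  toFun Φ := ⟨fockWeight k Φ.seq, Φ.2.2.2 k⟩
  map_add' Φ Ψ := by
    apply Subtype.ext
    simp only [map_add]
    rfl
  map_smul' c Φ := by
    apply Subtype.ext
    simp only [map_smul]
    rfl

/-- The norms `|Γ(H)^k ·|` of `(E)`. -/
def hidaSeminorm (ε : Statistics) (E : Submodule ℂ 𝓢(R3, C4)) :
    SeminormFamily ℂ (HidaSpace ε E) ℕ :=
  fun k => (normSeminorm ℂ _).comp (fockEmbed ε E k)

instance (ε : Statistics) (E : Submodule ℂ 𝓢(R3, C4)) : TopologicalSpace (HidaSpace ε E) :=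
  (hidaSeminorm ε E).moduleFilterBasis.topology

theorem hida_withSeminorms (ε : Statistics) (E : Submodule ℂ 𝓢(R3, C4)) :
    WithSeminorms (hidaSeminorm ε E) := ⟨rfl⟩

instance (ε : Statistics) (E : Submodule ℂ 𝓢(R3, C4)) : IsTopologicalAddGroup (HidaSpace ε E) :=
  (hida_withSeminorms ε E).topologicalAddGroup

instance (ε : Statistics) (E : Submodule ℂ 𝓢(R3, C4)) : ContinuousSMul ℂ (HidaSpace ε E) :=
  (hida_withSeminorms ε E).continuousSMul

/-! ### Integral kernel operators and the free fields -/

/-- The `n`-particle component of `Ξ_{0,1}(w)Φ = ∑ₛ ∫ w(s,p) ∂_{s,p} Φ d³p`, where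
`(∂_{s,p}Φ)ₙ = (n+1) Φₙ₊₁(s, p, ·)`. -/
def annihilation (w : Fin 4 → R3 → ℂ) (Φ : FockSeq) (n : ℕ) (s : Fin n → Fin 4)
    (p : Fin n → R3) : ℂ :=
  (n + 1) * ∑ r : Fin 4, ∫ q : R3,
    w r q * Φ (n + 1) (Fin.cons (α := fun _ => Fin 4) r s) (Fin.cons (α := fun _ => R3) q p)

/-- The `n`-particle component of `Ξ_{1,0}(w)Φ = ∑ₛ ∫ w(s,p) ∂*_{s,p} Φ d³p`: the
(anti)symmetrized tensor product of `w` with `Φₙ₋₁`. -/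
def creation (ε : Statistics) (w : Fin 4 → R3 → ℂ) (Φ : FockSeq) :
    (n : ℕ) → (Fin n → Fin 4) → (Fin n → R3) → ℂ
  | 0, _, _ => 0
  | n + 1, s, p => (1 / ((n : ℂ) + 1)) * ∑ i : Fin (n + 1),
      ε.moveSign i * w (s i) (p i) * Φ n (i.removeNth s) (i.removeNth p)

/-- The field with kernels `κ_{0,1}`, `κ_{1,0}`, that is `φ ↦ Ξ(κ_{0,1}(φ)) + Ξ(κ_{1,0}(φ))`, is an
operator-valued distribution: it belongs to `L(𝓔, L((E),(E)))`. -/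
def IsOperatorValuedDistribution (ε : Statistics) (κ01 κ10 : PlaneKernel)
    (E : Submodule ℂ 𝓢(R3, C4)) (𝓔 : Submodule ℂ 𝓢(R4, C4)) : Prop :=
  ∃ T : 𝓔 →L[ℂ] (HidaSpace ε E →L[ℂ] HidaSpace ε E),
    ∀ (φ : 𝓔) (Φ : HidaSpace ε E) (n : ℕ) (s : Fin n → Fin 4), ∀ᵐ p : Fin n → R3,
      (T φ Φ).seq n s p = annihilation (smear κ01 (φ : 𝓢(R4, C4))) Φ.seq n s p +
        creation ε (smear κ10 (φ : 𝓢(R4, C4))) Φ.seq n s p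

/-! ### The space `O_M` -/

/-- `O_M(ℝ⁴;ℂ⁴)` as a linear space: the smooth functions each of whose derivatives is polynomially
bounded. -/
def omSubmodule : Submodule ℂ (R4 → C4) where
  carrier := {f | f.HasTemperateGrowth}
  zero_mem' := Function.HasTemperateGrowth.zero
  add_mem' hf hg := hf.add hg
  smul_mem' c _ hf := (Function.HasTemperateGrowth.const (E := R4) c).smul hf

/-- The space `O_M(ℝ⁴;ℂ⁴)` of multipliers of the Schwartz space. -/
def OM : Type := omSubmodule

instance : AddCommGroup OM := inferInstanceAs (AddCommGroup omSubmodule)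

instance : Module ℂ OM := inferInstanceAs (Module ℂ omSubmodule)

/-- The function `ℝ⁴ → ℂ⁴` underlying an element of `O_M`. -/
def OM.toFun : OM →ₗ[ℂ] (R4 → C4) := omSubmodule.subtype

theorem OM.bddAbove (φ : 𝓢(R4, ℂ)) (n : ℕ) (f : OM) :
    BddAbove (Set.range fun x : R4 => ‖φ x‖ * ‖iteratedFDeriv ℝ n f.toFun x‖) := by
  obtain ⟨k, C, hC⟩ := (show Function.HasTemperateGrowth (OM.toFun f) from f.2).2 n
  refine ⟨2 ^ k * (Finset.Iic (k, 0)).sup (fun m => SchwartzMap.seminorm ℂ m.1 m.2) φ * |C|, ?_⟩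
  rintro _ ⟨x, rfl⟩
  have h1 := SchwartzMap.one_add_le_sup_seminorm_apply (𝕜 := ℂ) (m := (k, 0)) le_rfl le_rfl φ x
  rw [norm_iteratedFDeriv_zero] at h1
  have h2 : ‖iteratedFDeriv ℝ n f.toFun x‖ ≤ |C| * (1 + ‖x‖) ^ k :=
    (hC x).trans (mul_le_mul_of_nonneg_right (le_abs_self C) (by positivity))
  calc ‖φ x‖ * ‖iteratedFDeriv ℝ n f.toFun x‖
      ≤ ‖φ x‖ * (|C| * (1 + ‖x‖) ^ k) := mul_le_mul_of_nonneg_left h2 (norm_nonneg _)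
    _ = ((1 + ‖x‖) ^ k * ‖φ x‖) * |C| := by ring
    _ ≤ _ := mul_le_mul_of_nonneg_right h1 (abs_nonneg C)

theorem OM.contDiffAt (f : OM) (n : ℕ) (x : R4) : ContDiffAt ℝ n f.toFun x :=
  ((show Function.HasTemperateGrowth (OM.toFun f) from f.2).1.of_le
    (by exact_mod_cast le_top)).contDiffAt

/-- The seminorms `f ↦ sup_x |φ(x)| |Dⁿf(x)|` of `O_M`, indexed by `φ ∈ S(ℝ⁴;ℂ)` and `n`. -/
def omSeminorm : SeminormFamily ℂ OM (𝓢(R4, ℂ) × ℕ) := fun i =>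
  Seminorm.of (fun f => ⨆ x : R4, ‖i.1 x‖ * ‖iteratedFDeriv ℝ i.2 f.toFun x‖)
    (fun f g => by
      refine ciSup_le fun x => ?_
      rw [map_add, iteratedFDeriv_add_apply (f.contDiffAt i.2 x) (g.contDiffAt i.2 x)]
      calc ‖i.1 x‖ * ‖iteratedFDeriv ℝ i.2 f.toFun x + iteratedFDeriv ℝ i.2 g.toFun x‖
          ≤ ‖i.1 x‖ * ‖iteratedFDeriv ℝ i.2 f.toFun x‖ +
            ‖i.1 x‖ * ‖iteratedFDeriv ℝ i.2 g.toFun x‖ := by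
              rw [← mul_add]
              exact mul_le_mul_of_nonneg_left (norm_add_le _ _) (norm_nonneg _)
        _ ≤ _ := add_le_add (le_ciSup (OM.bddAbove i.1 i.2 f) x)
              (le_ciSup (OM.bddAbove i.1 i.2 g) x))
    (fun c f => by
      rw [Real.mul_iSup_of_nonneg (norm_nonneg c)]
      congr 1
      funext x
      rw [map_smul, iteratedFDeriv_const_smul_apply (f.contDiffAt i.2 x), norm_smul]
      ring)

instance : TopologicalSpace OM := omSeminorm.moduleFilterBasis.topology

theorem om_withSeminorms : WithSeminorms omSeminorm := ⟨rfl⟩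

instance : IsTopologicalAddGroup OM := om_withSeminorms.topologicalAddGroup

instance : ContinuousSMul ℂ OM := om_withSeminorms.continuousSMul

/-- `κ ∈ L(E, O_M)`. -/
def KernelInLOM (κ : PlaneKernel) (E : Submodule ℂ 𝓢(R3, C4)) : Prop :=
  ∃ K : E →L[ℂ] OM, ∀ ξ : E, (K ξ).toFun = smearMomentum κ (ξ : 𝓢(R3, C4))

/-- A smooth function all of whose derivatives are bounded. -/
def IsSmoothWithBoundedDerivs (f : R4 → C4) : Prop :=
  ContDiff ℝ ∞ f ∧ ∀ n : ℕ, ∃ C : ℝ, ∀ x, ‖iteratedFDeriv ℝ n f x‖ ≤ C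

end FreeField
end

open FreeField

noncomputable section

namespace FreeField

/-! ### Continuity criteria in terms of seminorms -/

/-! Smearing a plane wave with `φ` evaluates the Fourier transform of `φ` on a mass shell: `κ(φ)(p)`
is the coefficient matrix at `p` applied to `𝓕 φ` at a multiple `± 1/(2π)` of `(E(p), -p)`
(`smear_planeKernel`). For `m > 0` the shell map and the spinors are smooth of temperate growth, so
`φ ↦ κ(φ)` is continuous from Schwartz space to Schwartz space (`kernelEverywhere_massive`). For `m
= 0` the cone has a tip and the coefficients behave like `|p|^(-1/2)`. If all derivatives of `𝓕 φ`
vanish at the origin, both defects are harmless: such a flat function beats every power of `|p|`,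
and the functions `|p|^a f(c(|p|, -p))` with `f` flat form a class closed under differentiation, so
they are again flat Schwartz functions (`exists_coneFun_iteratedFDeriv_bound`).

Once `κ` is continuous from `𝓔` to `E`, condition 3 is transposition. Condition 1 follows from
bilinear bounds for annihilation and creation in the norms of `(E)`. These rest on `H ≥ 4`: raising
the level `k` by two gains `16^n` on `n` particles, which pays for the particle-number factor `n +
1` and for the `4^n` discrete index tuples (`oscNorm_annihSeq_le`, `oscNorm_createSeq_le`).

Conversely, each condition forces `|κ_{1,0}(φ)(p)| ≤ C |p|^N` for `p ≠ 0`, with `N = 0` for every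
`E` and also with `N = 1` for `E = S⁰`. Under condition 2 this is immediate; under condition 3 it
comes from testing with bump functions; under condition 1 from applying the field to the vacuum. For
the potential on `𝓔 = S` the bound with `N = 0` fails when `𝓕 φ` is constant near the origin. For
the Dirac field on `E = S⁰` the bound with `N = 1` fails when `𝓕 φ` is a bump at the shell point
over `p = 0`; that point is not the origin, so `φ` even lies in `S⁰⁰`. Hence for each pair of test
spaces the listed conditions are all true or all false.

The statements on `O_M` hold because `κ(ξ)` is the Fourier integral of a rapidly decreasing
amplitude against a measure on the shell (`RapidCoeff.smearMomentum_eq`). -/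

theorem continuous_of_seminorm_le {Y Z ι : Type*} [AddCommGroup Y] [Module ℂ Y]
    [TopologicalSpace Y] [IsTopologicalAddGroup Y] [AddCommGroup Z] [Module ℂ Z]
    [TopologicalSpace Z] {p : SeminormFamily ℂ Z ι} (hp : WithSeminorms p) (L : Y →ₗ[ℂ] Z)
    (h : ∀ k, ∃ r : Seminorm ℂ Y, Continuous r ∧ ∀ y, p k (L y) ≤ r y) : Continuous L := by
  refine hp.continuous_of_continuous_comp L fun k => ?_
  obtain ⟨r, hr, hle⟩ := h k
  exact Seminorm.continuous_of_le hr hle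

/-- The unit ball of a continuous seminorm is a neighbourhood of zero, so it absorbs `S`; the
absorbing scalar gives the bound. -/
theorem exists_bound_of_isVonNBounded {Y : Type*} [AddCommGroup Y] [Module ℂ Y]
    [TopologicalSpace Y] {r : Seminorm ℂ Y} (hr : Continuous r) {S : Set Y}
    (hS : Bornology.IsVonNBounded ℂ S) : ∃ M : ℝ, 0 ≤ M ∧ ∀ y ∈ S, r y ≤ M := by
  have hV : {y | r y < 1} ∈ nhds (0 : Y) :=
    (isOpen_lt hr continuous_const).mem_nhds (by simp)
  obtain ⟨c, hc⟩ := (hS hV).exists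
  refine ⟨‖c‖, norm_nonneg _, fun y hy => ?_⟩
  obtain ⟨z, hz, rfl⟩ := hc hy
  simp only [map_smul_eq_mul]
  exact mul_le_of_le_one_right (norm_nonneg _) (le_of_lt hz)

/-- A bilinear map that is bounded by products of continuous seminorms is a continuous map into
the space of continuous linear maps with the topology of bounded convergence. -/
theorem exists_clm_of_bilinear_bound {X Y Z ι : Type*} [AddCommGroup X] [Module ℂ X]
    [TopologicalSpace X] [IsTopologicalAddGroup X] [ContinuousSMul ℂ X]
    [AddCommGroup Y] [Module ℂ Y] [TopologicalSpace Y]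
    [IsTopologicalAddGroup Y] [ContinuousSMul ℂ Y] [AddCommGroup Z] [Module ℂ Z]
    [TopologicalSpace Z] [IsTopologicalAddGroup Z] [ContinuousSMul ℂ Z]
    {p : SeminormFamily ℂ Z ι} (hp : WithSeminorms p) (B : X →ₗ[ℂ] Y →ₗ[ℂ] Z)
    (h : ∀ k, ∃ (q : Seminorm ℂ X) (r : Seminorm ℂ Y), Continuous q ∧ Continuous r ∧
      ∀ x y, p k (B x y) ≤ q x * r y) :
    ∃ T : X →L[ℂ] (Y →L[ℂ] Z), ∀ x y, T x y = B x y := by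
  have hc : ∀ x, Continuous (B x) := fun x => by
    refine continuous_of_seminorm_le hp (B x) fun k => ?_
    obtain ⟨q, r, -, hr, hle⟩ := h k
    refine ⟨(q x).toNNReal • r, ?_, fun y => ?_⟩
    · exact hr.const_smul (q x).toNNReal
    · rw [smul_apply, NNReal.smul_def, Real.coe_toNNReal _ (apply_nonneg q x)]
      exact hle x y
  let T : X →ₗ[ℂ] (Y →L[ℂ] Z) :=
    { toFun x := ⟨B x, hc x⟩
      map_add' x y := by ext z; simp
      map_smul' c x := by ext z; simp }
  refine ⟨⟨T, ?_⟩, fun x y => rfl⟩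
  refine continuous_of_continuousAt_zero T ?_
  rw [ContinuousAt, map_zero]
  -- A basic neighbourhood of zero consists of the maps sending a bounded set `S` into a ball of
  -- finitely many seminorms. The seminorm `r` is bounded by some `M` on `S`, so smallness of `q x`
  -- alone suffices, uniformly over `S`.
  refine (ContinuousLinearMap.hasBasis_nhds_zero_of_basis hp.hasBasis_zero_ball).tendsto_right_iff.2
    fun ⟨S, s, ε⟩ ⟨hS, hε⟩ => ?_
  have key : ∀ k ∈ s, ∀ᶠ x in nhds (0 : X), ∀ y ∈ S, p k (B x y) < ε := fun k _ => by
    obtain ⟨q, r, hq, hr, hle⟩ := h k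
    obtain ⟨M, hM, hb⟩ := exists_bound_of_isVonNBounded hr hS
    have : ∀ᶠ x in nhds (0 : X), q x * M < ε :=
      (isOpen_lt (hq.mul continuous_const) continuous_const).mem_nhds (by simpa using hε)
    filter_upwards [this] with x hx y hy
    exact ((hle x y).trans (mul_le_mul_of_nonneg_left (hb y hy) (apply_nonneg q x))).trans_lt hx
  filter_upwards [(Filter.eventually_all_finset s).2 key] with x hx y hy
  rw [Seminorm.mem_ball_zero]
  exact Seminorm.finset_sup_apply_lt hε fun k hk => hx k hk y hy

section Schwartz

variable {D V : Type*} [NormedAddCommGroup D] [NormedSpace ℝ D] [NormedAddCommGroup V]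
  [NormedSpace ℝ V] [NormedSpace ℂ V]

/-- A linear map into a Schwartz space, from its values. -/
def schwartzLM {X : Type*} [AddCommGroup X] [Module ℂ X] (A : X →ₗ[ℂ] (D → V))
    (hs : ∀ x, ContDiff ℝ ∞ (A x))
    (hb : ∀ x (k n : ℕ), ∃ C, ∀ y, ‖y‖ ^ k * ‖iteratedFDeriv ℝ n (A x) y‖ ≤ C) :
    X →ₗ[ℂ] 𝓢(D, V) where
  toFun x := ⟨A x, hs x, hb x⟩
  map_add' x y := by ext z; exact congrFun (A.map_add x y) z
  map_smul' c x := by ext z; exact congrFun (A.map_smul c x) z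

/-- A continuous linear map into a Schwartz space, from its values. -/
def schwartzCLM {X : Type*} [AddCommGroup X] [Module ℂ X] [TopologicalSpace X]
    [IsTopologicalAddGroup X] [SMulCommClass ℝ ℂ V] (A : X →ₗ[ℂ] (D → V))
    (hs : ∀ x, ContDiff ℝ ∞ (A x))
    (hb : ∀ k n : ℕ, ∃ q : Seminorm ℂ X, Continuous q ∧
      ∀ x y, ‖y‖ ^ k * ‖iteratedFDeriv ℝ n (A x) y‖ ≤ q x) : X →L[ℂ] 𝓢(D, V) where
  toLinearMap := schwartzLM A hs fun x k n => by
    obtain ⟨q, -, h⟩ := hb k n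
    exact ⟨q x, h x⟩
  cont := by
    refine continuous_of_seminorm_le (schwartz_withSeminorms ℂ D V) _ fun ⟨k, n⟩ => ?_
    obtain ⟨q, hq, h⟩ := hb k n
    exact ⟨q, hq, fun x => SchwartzMap.seminorm_le_bound ℂ k n _ (apply_nonneg q x) (h x)⟩

theorem continuous_seminorm_comp {X Y : Type*} [AddCommGroup X] [Module ℂ X] [TopologicalSpace X]
    [AddCommGroup Y] [Module ℂ Y] [TopologicalSpace Y] {q : Seminorm ℂ Y} (hq : Continuous q)
    (L : X →L[ℂ] Y) : Continuous (q.comp (L : X →ₗ[ℂ] Y)) := hq.comp L.continuous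

/-- Weighted sup-norms of the derivatives up to a given order are continuous seminorms of the
Schwartz space. -/
theorem exists_seminorm_one_add_pow [SMulCommClass ℝ ℂ V] (k m : ℕ) :
    ∃ q : Seminorm ℂ 𝓢(D, V), Continuous q ∧
      ∀ (f : 𝓢(D, V)) (n : ℕ), n ≤ m → ∀ x : D,
        (1 + ‖x‖) ^ k * ‖iteratedFDeriv ℝ n f x‖ ≤ q f := by
  refine ⟨((2 : NNReal) ^ k) • (Finset.Iic (k, m)).sup (schwartzSeminormFamily ℂ D V), ?_,
    fun f n hn x => ?_⟩
  · exact ((schwartz_withSeminorms ℂ D V).finset_sups.continuous_seminorm _).const_smul _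
  · have := SchwartzMap.one_add_le_sup_seminorm_apply (𝕜 := ℂ) (m := (k, m)) le_rfl hn f x
    refine this.trans (le_of_eq ?_)
    rw [smul_apply, NNReal.smul_def]
    simp only [smul_eq_mul, NNReal.coe_pow, NNReal.coe_ofNat]
    rfl

end Schwartz

/-- Composition on the right with a fixed real-linear map, as a complex-linear map. -/
def compRightCLM {X Y : Type*} (V : Type*) [NormedAddCommGroup X] [NormedSpace ℝ X]
    [NormedAddCommGroup Y] [NormedSpace ℝ Y] [NormedAddCommGroup V] [NormedSpace ℝ V]
    [NormedSpace ℂ V] [SMulCommClass ℝ ℂ V] (L : Y →L[ℝ] X) :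
    (X →L[ℝ] V) →L[ℂ] (Y →L[ℝ] V) :=
  LinearMap.mkContinuous
    { toFun f := f.comp L
      map_add' f g := by ext; simp
      map_smul' c f := by ext; simp } ‖L‖ fun f => by
    rw [mul_comm]
    exact f.opNorm_comp_le L

/-! ### Integration over one momentum -/

/-- The momentum tuple `(q, p₁, …, pₙ)`. -/
abbrev consMom {n : ℕ} (q : R3) (p : Fin n → R3) : Fin (n + 1) → R3 :=
  Fin.cons (α := fun _ => R3) q p

/-- The inclusion `p ↦ (0, p)`. -/
def consInr (n : ℕ) : (Fin n → R3) →L[ℝ] (Fin (n + 1) → R3) :=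
  ContinuousLinearMap.pi (Fin.cons 0 fun i => ContinuousLinearMap.proj i)

theorem consInr_apply {n : ℕ} (p : Fin n → R3) : consInr n p = consMom 0 p := by
  funext i
  refine Fin.cases ?_ (fun j => ?_) i <;> simp [consInr]

theorem consMom_eq {n : ℕ} (q : R3) (p : Fin n → R3) :
    consMom q p = consMom q 0 + consInr n p := by
  rw [consInr_apply]
  funext i
  refine Fin.cases ?_ (fun j => ?_) i <;> simp

theorem norm_le_norm_consMom {n : ℕ} (q : R3) (p : Fin n → R3) : ‖p‖ ≤ ‖consMom q p‖ := by
  refine (pi_norm_le_iff_of_nonneg (norm_nonneg _)).2 fun i => ?_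
  simpa using norm_le_pi_norm (consMom q p) i.succ

theorem norm_head_le_norm_consMom {n : ℕ} (q : R3) (p : Fin n → R3) : ‖q‖ ≤ ‖consMom q p‖ := by
  simpa using norm_le_pi_norm (consMom q p) 0

@[fun_prop]
theorem continuous_consMom {n : ℕ} :
    Continuous fun z : R3 × (Fin n → R3) => consMom z.1 z.2 := by
  refine continuous_pi fun i => ?_
  refine Fin.cases ?_ (fun j => ?_) i <;> simp <;> fun_prop

theorem continuous_consMom_left {n : ℕ} (p : Fin n → R3) : Continuous fun q : R3 => consMom q p :=
  continuous_consMom.comp (by fun_prop : Continuous fun q : R3 => (q, p))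

theorem hasFDerivAt_consMom {n : ℕ} (q : R3) (p : Fin n → R3) :
    HasFDerivAt (fun p : Fin n → R3 => consMom q p) (consInr n) p := by
  rw [show (fun p : Fin n → R3 => consMom q p) = fun p => consMom q 0 + consInr n p from
    funext (consMom_eq q)]
  exact (consInr n).hasFDerivAt.const_add _

/-- The exponent 4 is the first integer above the dimension 3. This weight is the majorant of the
momentum integrals below. -/
theorem integrable_inv_one_add_norm_pow :
    Integrable (fun q : R3 => ((1 + ‖q‖) ^ 4)⁻¹) := by
  have := integrable_one_add_norm (E := R3) (μ := volume) (r := 4) (by simp; norm_num)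
  refine this.congr (.of_forall fun q => ?_)
  simp only
  rw [Real.rpow_neg (by positivity)]
  norm_cast

section

variable {n : ℕ} {V : Type} [NormedAddCommGroup V] [NormedSpace ℝ V] [NormedSpace ℂ V]
  [SMulCommClass ℝ ℂ V]

/-- The decay in `(q, p)` is split: `k` powers control `p` and four more make the bound integrable
in `q`. The majorant is independent of `p`, as differentiation under the integral requires. -/
theorem exists_seminorm_consMom (k : ℕ) : ∃ Q : Seminorm ℂ 𝓢(Fin (n + 1) → R3, V),
    Continuous Q ∧ ∀ g p q, ‖p‖ ^ k * ‖g (consMom q p)‖ ≤ Q g * ((1 + ‖q‖) ^ 4)⁻¹ := by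
  obtain ⟨Q, hQ, h⟩ := exists_seminorm_one_add_pow (D := Fin (n + 1) → R3) (V := V) (k + 4) 0
  refine ⟨Q, hQ, fun g p q => ?_⟩
  have h1 := h g 0 le_rfl (consMom q p)
  rw [norm_iteratedFDeriv_zero] at h1
  rw [← div_eq_mul_inv, le_div_iff₀ (by positivity)]
  refine le_trans ?_ h1
  have h2 := norm_le_norm_consMom q p
  have h3 := norm_head_le_norm_consMom q p
  calc ‖p‖ ^ k * ‖g (consMom q p)‖ * (1 + ‖q‖) ^ 4
      ≤ (1 + ‖consMom q p‖) ^ k * ‖g (consMom q p)‖ * (1 + ‖consMom q p‖) ^ 4 := by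
        gcongr
        linarith
    _ = _ := by ring

/-- The function `p ↦ ∫ g(q, p) d³q`. -/
def partialIntegralFun (g : 𝓢(Fin (n + 1) → R3, V)) (p : Fin n → R3) : V :=
  ∫ q : R3, g (consMom q p)

theorem integrable_consMom (g : 𝓢(Fin (n + 1) → R3, V)) (p : Fin n → R3) :
    Integrable fun q : R3 => g (consMom q p) := by
  obtain ⟨Q, -, h⟩ := exists_seminorm_consMom (n := n) (V := V) 0
  refine (integrable_inv_one_add_norm_pow.const_mul (Q g)).mono'
    ((g.continuous.comp (continuous_consMom_left p)).aestronglyMeasurable) (.of_forall fun q => ?_)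
  simpa using h g p q

/-- The derivative of a Schwartz function in the directions `(0, p)`. -/
def tailDeriv : 𝓢(Fin (n + 1) → R3, V) →L[ℂ] 𝓢(Fin (n + 1) → R3, (Fin n → R3) →L[ℝ] V) :=
  (SchwartzMap.postcompCLM (compRightCLM V (consInr n))) ∘L
    (SchwartzMap.fderivCLM ℂ (Fin (n + 1) → R3) V)

theorem tailDeriv_apply (g : 𝓢(Fin (n + 1) → R3, V)) (x : Fin (n + 1) → R3) :
    tailDeriv g x = (fderiv ℝ g x).comp (consInr n) := rfl

/-- The derivative is again a partial integral of a Schwartz function, now valued in linear maps, so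
all orders can be treated by recursion. -/
theorem hasFDerivAt_partialIntegralFun (g : 𝓢(Fin (n + 1) → R3, V)) (p : Fin n → R3) :
    HasFDerivAt (partialIntegralFun g) (partialIntegralFun (tailDeriv g) p) p := by
  obtain ⟨Q, -, h⟩ := exists_seminorm_consMom (n := n) (V := (Fin n → R3) →L[ℝ] V) 0
  refine hasFDerivAt_integral_of_dominated_of_fderiv_le (s := Set.univ)
    (F' := fun p q => tailDeriv g (consMom q p)) Filter.univ_mem
    (.of_forall fun p => (integrable_consMom g p).aestronglyMeasurable) (integrable_consMom g p)
    (integrable_consMom (tailDeriv g) p).aestronglyMeasurable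
    (.of_forall fun q p _ => ?_) (integrable_inv_one_add_norm_pow.const_mul (Q (tailDeriv g)))
    (.of_forall fun q p _ => ?_)
  · simpa using h (tailDeriv g) p q
  · exact (g.hasFDerivAt (consMom q p)).comp p (hasFDerivAt_consMom q p)

end

/-- Each differentiation replaces `V` by a space of linear maps into `V`; hence the induction on the
order is uniform in `V`. -/
theorem partialIntegral_bound {n : ℕ} (m : ℕ) : ∀ (V : Type) [NormedAddCommGroup V]
    [NormedSpace ℝ V] [NormedSpace ℂ V] [SMulCommClass ℝ ℂ V] (k : ℕ),
    ∃ Q : Seminorm ℂ 𝓢(Fin (n + 1) → R3, V), Continuous Q ∧ ∀ g,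
      ContDiff ℝ m (partialIntegralFun g) ∧
      ∀ p, ‖p‖ ^ k * ‖iteratedFDeriv ℝ m (partialIntegralFun g) p‖ ≤ Q g := by
  induction m with
  | zero =>
    intro V _ _ _ _ k
    obtain ⟨Q, hQ, h⟩ := exists_seminorm_consMom (n := n) (V := V) k
    set c : ℝ := ∫ q : R3, ((1 + ‖q‖) ^ 4)⁻¹ with hc
    have hc0 : 0 ≤ c := integral_nonneg fun q => by positivity
    refine ⟨c.toNNReal • Q, hQ.const_smul _, fun g => ⟨?_, fun p => ?_⟩⟩
    · simp only [Nat.cast_zero, contDiff_zero]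
      exact continuous_iff_continuousAt.2 fun p =>
        (hasFDerivAt_partialIntegralFun g p).continuousAt
    · rw [norm_iteratedFDeriv_zero, smul_apply, NNReal.smul_def,
        Real.coe_toNNReal _ hc0, smul_eq_mul]
      calc ‖p‖ ^ k * ‖partialIntegralFun g p‖
          ≤ ‖p‖ ^ k * ∫ q : R3, ‖g (consMom q p)‖ := by
            gcongr
            exact norm_integral_le_integral_norm _
        _ = ∫ q : R3, ‖p‖ ^ k * ‖g (consMom q p)‖ := (integral_const_mul _ _).symm
        _ ≤ ∫ q : R3, Q g * ((1 + ‖q‖) ^ 4)⁻¹ := by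
            refine integral_mono ((integrable_consMom g p).norm.const_mul _)
              (integrable_inv_one_add_norm_pow.const_mul _) fun q => h g p q
        _ = c * Q g := by rw [integral_const_mul, mul_comm]
  | succ m ih =>
    intro V _ _ _ _ k
    obtain ⟨Q, hQ, h⟩ := ih ((Fin n → R3) →L[ℝ] V) k
    refine ⟨_, continuous_seminorm_comp hQ tailDeriv, fun g => ?_⟩
    have hd : fderiv ℝ (partialIntegralFun g) = partialIntegralFun (tailDeriv g) :=
      funext fun p => (hasFDerivAt_partialIntegralFun g p).fderiv
    refine ⟨?_, fun p => ?_⟩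
    · rw [Nat.cast_add, Nat.cast_one, contDiff_succ_iff_fderiv, hd]
      exact ⟨fun p => (hasFDerivAt_partialIntegralFun g p).differentiableAt, by simp, (h _).1⟩
    · rw [← norm_iteratedFDeriv_fderiv, hd]
      exact (h (tailDeriv g)).2 p

/-- Integration over the first momentum, `g ↦ ∫ g(q, ·) d³q`. -/
def partialIntegral (n : ℕ) : SchwartzN (n + 1) →L[ℂ] SchwartzN n :=
  schwartzCLM
    { toFun g := partialIntegralFun g
      map_add' f g := by
        funext p
        exact integral_add (integrable_consMom f p) (integrable_consMom g p)
      map_smul' c g := by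
        funext p
        exact integral_smul c _ }
    (fun g => contDiff_infty.2 fun m => by
      obtain ⟨Q, -, h⟩ := partialIntegral_bound (n := n) m ℂ 0
      exact (h g).1)
    fun k m => by
      obtain ⟨Q, hQ, h⟩ := partialIntegral_bound (n := n) m ℂ k
      exact ⟨Q, hQ, fun g p => (h g).2 p⟩

theorem partialIntegral_apply {n : ℕ} (g : SchwartzN (n + 1)) (p : Fin n → R3) :
    partialIntegral n g p = ∫ q : R3, g (consMom q p) := rfl

theorem lineDerivOp_partialIntegral {n : ℕ} (g : SchwartzN (n + 1)) (v : Fin n → R3) :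
    ∂_{v} (partialIntegral n g) = partialIntegral n (∂_{consMom 0 v} g) := by
  ext p
  rw [SchwartzMap.lineDerivOp_apply_eq_fderiv]
  have h : fderiv ℝ (partialIntegral n g) p = partialIntegralFun (tailDeriv g) p :=
    (hasFDerivAt_partialIntegralFun g p).fderiv
  rw [h, partialIntegralFun, ContinuousLinearMap.integral_apply (integrable_consMom _ p),
    partialIntegral_apply]
  refine integral_congr_ae (.of_forall fun q => ?_)
  simp only [tailDeriv_apply, ContinuousLinearMap.comp_apply, consInr_apply]
  rw [SchwartzMap.lineDerivOp_apply_eq_fderiv]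

/-! ### Exterior products with a one-particle function and contractions -/

/-- The momentum tuple `(p₁, …, pₙ)` of `(p₀, p₁, …, pₙ)`. -/
def tailMom (n : ℕ) : (Fin (n + 1) → R3) →L[ℝ] (Fin n → R3) :=
  ContinuousLinearMap.pi fun i => ContinuousLinearMap.proj i.succ

/-- The momentum `p₀` of `(p₀, p₁, …, pₙ)`. -/
def headMom (n : ℕ) : (Fin (n + 1) → R3) →L[ℝ] R3 := ContinuousLinearMap.proj 0

@[simp]
theorem tailMom_apply {n : ℕ} (p : Fin (n + 1) → R3) (i : Fin n) : tailMom n p i = p i.succ := rfl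

@[simp]
theorem headMom_apply {n : ℕ} (p : Fin (n + 1) → R3) : headMom n p = p 0 := rfl

@[simp]
theorem tailMom_consMom {n : ℕ} (q : R3) (p : Fin n → R3) : tailMom n (consMom q p) = p := rfl

@[simp]
theorem headMom_consMom {n : ℕ} (q : R3) (p : Fin n → R3) : headMom n (consMom q p) = q := rfl

theorem norm_tailMom_le (n : ℕ) : ‖tailMom n‖ ≤ 1 := by
  refine ContinuousLinearMap.opNorm_le_bound _ zero_le_one fun p => ?_
  rw [one_mul, pi_norm_le_iff_of_nonneg (norm_nonneg _)]
  exact fun i => norm_le_pi_norm p i.succ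

theorem norm_headMom_le (n : ℕ) : ‖headMom n‖ ≤ 1 := by
  refine ContinuousLinearMap.opNorm_le_bound _ zero_le_one fun p => ?_
  rw [one_mul]
  exact norm_le_pi_norm p 0

theorem norm_iteratedFDeriv_comp_clm_le {X Y Z : Type*} [NormedAddCommGroup X] [NormedSpace ℝ X]
    [NormedAddCommGroup Y] [NormedSpace ℝ Y] [NormedAddCommGroup Z] [NormedSpace ℝ Z]
    (L : X →L[ℝ] Y) (hL : ‖L‖ ≤ 1) {f : Y → Z} (hf : ContDiff ℝ ∞ f) (m : ℕ) (x : X) :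
    ‖iteratedFDeriv ℝ m (fun x => f (L x)) x‖ ≤ ‖iteratedFDeriv ℝ m f (L x)‖ := by
  have h := L.iteratedFDeriv_comp_right (hf.of_le (by exact_mod_cast le_top) : ContDiff ℝ m f) x
    le_rfl
  rw [show (fun x => f (L x)) = f ∘ L from rfl, h]
  refine (ContinuousMultilinearMap.norm_compContinuousLinearMap_le _ _).trans ?_
  rw [Finset.prod_const]
  exact mul_le_of_le_one_right (norm_nonneg _) (pow_le_one₀ (norm_nonneg _) hL)

/-- A product bound lets the polynomial weight split between the two factors in the Leibniz rule. -/
theorem norm_le_one_add_mul_one_add {n : ℕ} (p : Fin (n + 1) → R3) :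
    ‖p‖ ≤ (1 + ‖headMom n p‖) * (1 + ‖tailMom n p‖) := by
  have h0 := norm_nonneg (headMom n p)
  have h1 := norm_nonneg (tailMom n p)
  refine (pi_norm_le_iff_of_nonneg (by positivity)).2 fun i => ?_
  refine Fin.cases ?_ (fun j => ?_) i
  · have : ‖p 0‖ = ‖headMom n p‖ := rfl
    nlinarith
  · have := norm_le_pi_norm (tailMom n p) j
    rw [tailMom_apply] at this
    nlinarith

/-- The product `(p₀, p₁, …, pₙ) ↦ w(p₀) f(p₁, …, pₙ)`. -/
def extProd {n : ℕ} (w : 𝓢(R3, ℂ)) : SchwartzN n →L[ℂ] SchwartzN (n + 1) :=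
  schwartzCLM
    { toFun f p := w (headMom n p) * f (tailMom n p)
      map_add' f g := by funext p; simp [mul_add]
      map_smul' c f := by funext p; simp [mul_left_comm] }
    (fun f => ((w.smooth ⊤).comp (headMom n).contDiff).mul ((f.smooth ⊤).comp (tailMom n).contDiff))
    fun k m => by
      obtain ⟨Q, hQ, h⟩ := exists_seminorm_one_add_pow (D := Fin n → R3) (V := ℂ) k m
      obtain ⟨P, -, hP⟩ := exists_seminorm_one_add_pow (D := R3) (V := ℂ) k m
      -- The constant comes from the Leibniz rule. Since `w` is fixed, its seminorm is absorbed here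
      -- and only `Q f` varies.
      set c : ℝ := ∑ i ∈ Finset.range (m + 1), (m.choose i : ℝ) * P w with hc
      have hc0 : 0 ≤ c := Finset.sum_nonneg fun i _ => by positivity
      refine ⟨c.toNNReal • Q, hQ.const_smul _, fun f p => ?_⟩
      rw [smul_apply, NNReal.smul_def, Real.coe_toNNReal _ hc0, smul_eq_mul]
      have hw : ContDiff ℝ ∞ fun p => w (headMom n p) := (w.smooth ⊤).comp (headMom n).contDiff
      have hf : ContDiff ℝ ∞ fun p => f (tailMom n p) := (f.smooth ⊤).comp (tailMom n).contDiff
      calc ‖p‖ ^ k * ‖iteratedFDeriv ℝ m (fun p => w (headMom n p) * f (tailMom n p)) p‖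
          ≤ ((1 + ‖headMom n p‖) * (1 + ‖tailMom n p‖)) ^ k *
            ∑ i ∈ Finset.range (m + 1), (m.choose i : ℝ) *
              ‖iteratedFDeriv ℝ i w (headMom n p)‖ *
              ‖iteratedFDeriv ℝ (m - i) f (tailMom n p)‖ := by
            refine mul_le_mul (pow_le_pow_left₀ (norm_nonneg _) (norm_le_one_add_mul_one_add p) k)
              ((norm_iteratedFDeriv_mul_le hw hf p (by exact_mod_cast le_top)).trans
                (Finset.sum_le_sum fun i _ => ?_)) (norm_nonneg _) (by positivity)
            gcongr
            · exact norm_iteratedFDeriv_comp_clm_le _ (norm_headMom_le n) (w.smooth ⊤) i p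
            · exact norm_iteratedFDeriv_comp_clm_le _ (norm_tailMom_le n) (f.smooth ⊤) _ p
        _ = ∑ i ∈ Finset.range (m + 1), (m.choose i : ℝ) *
              ((1 + ‖headMom n p‖) ^ k * ‖iteratedFDeriv ℝ i w (headMom n p)‖) *
              ((1 + ‖tailMom n p‖) ^ k * ‖iteratedFDeriv ℝ (m - i) f (tailMom n p)‖) := by
            rw [Finset.mul_sum]
            refine Finset.sum_congr rfl fun i _ => ?_
            rw [mul_pow]; ring
        _ ≤ ∑ i ∈ Finset.range (m + 1), (m.choose i : ℝ) * P w * Q f := by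
            refine Finset.sum_le_sum fun i hi => ?_
            have hi' : i ≤ m := Nat.lt_succ_iff.1 (Finset.mem_range.1 hi)
            gcongr
            · exact hP w i hi' _
            · exact h f _ (Nat.sub_le m i) _
        _ = c * Q f := by rw [hc, Finset.sum_mul]

@[simp]
theorem extProd_apply {n : ℕ} (w : 𝓢(R3, ℂ)) (f : SchwartzN n) (p : Fin (n + 1) → R3) :
    extProd w f p = w (headMom n p) * f (tailMom n p) := rfl

theorem hasTemperateGrowth_comp_headMom {n : ℕ} (w : 𝓢(R3, ℂ)) :
    (fun p => w (headMom n p)).HasTemperateGrowth :=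
  w.hasTemperateGrowth.comp (headMom n).hasTemperateGrowth

/-- The contraction `g ↦ ∫ w(q) g(q, ·) d³q`. -/
def contract {n : ℕ} (w : 𝓢(R3, ℂ)) : SchwartzN (n + 1) →L[ℂ] SchwartzN n :=
  partialIntegral n ∘L SchwartzMap.smulLeftCLM ℂ fun p => w (headMom n p)

theorem contract_apply {n : ℕ} (w : 𝓢(R3, ℂ)) (g : SchwartzN (n + 1)) (p : Fin n → R3) :
    contract w g p = ∫ q : R3, w q * g (consMom q p) := by
  simp only [contract, ContinuousLinearMap.comp_apply, partialIntegral_apply]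
  refine integral_congr_ae (.of_forall fun q => ?_)
  simp only
  rw [SchwartzMap.smulLeftCLM_apply_apply (hasTemperateGrowth_comp_headMom w)]
  rfl

/-! ### The oscillator and exterior products, contractions, permutations -/

theorem lineDerivOp_eq_deriv {X : Type*} [NormedAddCommGroup X] [NormedSpace ℝ X] (f : 𝓢(X, ℂ))
    (v x : X) : ∂_{v} f x = deriv (fun t : ℝ => f (x + t • v)) 0 := by
  rw [SchwartzMap.lineDerivOp_apply]
  rfl

/-- On the line through `x` in direction `v` the multiplier is a constant, which passes through the
derivative. -/
theorem lineDerivOp_smulLeftCLM {X : Type*} [NormedAddCommGroup X] [NormedSpace ℝ X] {g : X → ℂ}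
    (hg : g.HasTemperateGrowth) {v : X} (hv : ∀ (x : X) (t : ℝ), g (x + t • v) = g x)
    (f : 𝓢(X, ℂ)) :
    ∂_{v} (SchwartzMap.smulLeftCLM ℂ g f) = SchwartzMap.smulLeftCLM ℂ g (∂_{v} f) := by
  ext x
  rw [lineDerivOp_eq_deriv, SchwartzMap.smulLeftCLM_apply_apply hg, lineDerivOp_eq_deriv]
  simp only [SchwartzMap.smulLeftCLM_apply_apply hg, hv, smul_eq_mul]
  exact deriv_const_mul_field _

/-- The operator `-Δ + |p|² + 1` on functions of one momentum. -/
def oscillatorOne : 𝓢(R3, ℂ) →L[ℂ] 𝓢(R3, ℂ) :=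
  SchwartzMap.smulLeftCLM ℂ (fun p : R3 => ((‖p‖ ^ 2 + 1 : ℝ) : ℂ)) -
    ∑ j : Fin 3, (LineDeriv.lineDerivOpCLM ℂ 𝓢(R3, ℂ) (EuclideanSpace.single j (1 : ℝ))) ^ 2

theorem hasTemperateGrowth_weightOne :
    (fun p : R3 => ((‖p‖ ^ 2 + 1 : ℝ) : ℂ)).HasTemperateGrowth :=
  Complex.ofRealCLM.hasTemperateGrowth.comp
    ((Function.hasTemperateGrowth_norm_sq (H := R3)).add (.const 1))

theorem oscillatorOne_apply (f : 𝓢(R3, ℂ)) (p : R3) :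
    oscillatorOne f p = ((‖p‖ ^ 2 + 1 : ℝ) : ℂ) * f p -
      ∑ j : Fin 3, (∂_{(EuclideanSpace.single j (1 : ℝ) : R3)}
        (∂_{(EuclideanSpace.single j (1 : ℝ) : R3)} f)) p := by
  simp only [oscillatorOne, sub_apply, sum_apply]
  rw [SchwartzMap.smulLeftCLM_apply_apply hasTemperateGrowth_weightOne]
  simp only [pow_two (LineDeriv.lineDerivOpCLM ℂ 𝓢(R3, ℂ) _)]
  rfl

theorem lineDerivOp_zero_extProd {n : ℕ} (w : 𝓢(R3, ℂ)) (f : SchwartzN n) (e : R3) :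
    ∂_{(Pi.single 0 e : Fin (n + 1) → R3)} (extProd w f) = extProd (∂_{e} w) f := by
  ext p
  rw [lineDerivOp_eq_deriv, extProd_apply, lineDerivOp_eq_deriv, ← deriv_mul_const_field]
  congr 1
  funext t
  rw [extProd_apply, (headMom n).map_add, (headMom n).map_smul, (tailMom n).map_add,
    (tailMom n).map_smul]
  have h1 : headMom n (Pi.single 0 e) = e := by simp
  have h2 : tailMom n (Pi.single 0 e) = 0 := by ext1 i; simp
  rw [h1, h2, smul_zero, add_zero]

theorem lineDerivOp_succ_extProd {n : ℕ} (w : 𝓢(R3, ℂ)) (f : SchwartzN n) (i : Fin n) (e : R3) :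
    ∂_{(Pi.single i.succ e : Fin (n + 1) → R3)} (extProd w f) =
      extProd w (∂_{(Pi.single i e : Fin n → R3)} f) := by
  ext p
  rw [lineDerivOp_eq_deriv, extProd_apply, lineDerivOp_eq_deriv, ← deriv_const_mul_field]
  congr 1
  funext t
  rw [extProd_apply, (headMom n).map_add, (headMom n).map_smul, (tailMom n).map_add,
    (tailMom n).map_smul]
  have h1 : headMom n (Pi.single i.succ e) = 0 := by simp
  have h2 : tailMom n (Pi.single i.succ e) = Pi.single i e := by
    ext1 j
    simp only [tailMom_apply, Pi.single_apply, Fin.succ_inj]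
  rw [h1, h2, smul_zero, add_zero]

theorem oscillator_zero_extProd {n : ℕ} (w : 𝓢(R3, ℂ)) (f : SchwartzN n) :
    oscillator 0 (extProd w f) = extProd (oscillatorOne w) f := by
  ext p
  simp only [oscillator_apply, lineDerivOp_zero_extProd, extProd_apply, oscillatorOne_apply,
    headMom_apply]
  rw [sub_mul, Finset.sum_mul]
  ring

theorem oscillator_succ_extProd {n : ℕ} (w : 𝓢(R3, ℂ)) (f : SchwartzN n) (i : Fin n) :
    oscillator i.succ (extProd w f) = extProd w (oscillator i f) := by
  ext p
  simp only [oscillator_apply, lineDerivOp_succ_extProd, extProd_apply, tailMom_apply]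
  rw [mul_sub, Finset.mul_sum]
  ring

theorem lineDerivOp_contract {n : ℕ} (w : 𝓢(R3, ℂ)) (g : SchwartzN (n + 1)) (i : Fin n) (e : R3) :
    ∂_{(Pi.single i e : Fin n → R3)} (contract w g) =
      contract w (∂_{(Pi.single i.succ e : Fin (n + 1) → R3)} g) := by
  have hv : consMom 0 (Pi.single i e : Fin n → R3) = Pi.single i.succ e := by
    funext j
    refine Fin.cases ?_ (fun j => ?_) j
    · simp
    · simp only [consMom, Fin.cons_succ, Pi.single_apply, Fin.succ_inj]
  simp only [contract, ContinuousLinearMap.comp_apply]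
  rw [lineDerivOp_partialIntegral, hv,
    lineDerivOp_smulLeftCLM (hasTemperateGrowth_comp_headMom w) fun x t => ?_]
  rw [(headMom n).map_add, (headMom n).map_smul]
  simp

theorem oscillator_contract {n : ℕ} (w : 𝓢(R3, ℂ)) (g : SchwartzN (n + 1)) (i : Fin n) :
    oscillator i (contract w g) = contract w (oscillator i.succ g) := by
  have h : SchwartzMap.smulLeftCLM ℂ (fun p : Fin n → R3 => ((‖p i‖ ^ 2 + 1 : ℝ) : ℂ))
      (contract w g) = contract w (SchwartzMap.smulLeftCLM ℂ
        (fun p : Fin (n + 1) → R3 => ((‖p i.succ‖ ^ 2 + 1 : ℝ) : ℂ)) g) := by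
    ext p
    rw [SchwartzMap.smulLeftCLM_apply_apply (hasTemperateGrowth_weight i), contract_apply,
      contract_apply, smul_eq_mul, ← integral_const_mul]
    refine integral_congr_ae (.of_forall fun q => ?_)
    simp only
    rw [SchwartzMap.smulLeftCLM_apply_apply (hasTemperateGrowth_weight i.succ)]
    simp only [consMom, Fin.cons_succ, smul_eq_mul]
    ring
  simp only [oscillator, sub_apply, sum_apply, map_sub, map_sum, h,
    pow_two (LineDeriv.lineDerivOpCLM ℂ (SchwartzN _) _)]
  congr 1
  refine Finset.sum_congr rfl fun j _ => ?_
  simp only [mul_apply_eq_comp, LineDeriv.lineDerivOpCLM_apply, lineDerivOp_contract]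

/-! ### Commutation of the oscillators and their tensor powers. -/

theorem commute_lineDerivOp {X : Type*} [NormedAddCommGroup X] [NormedSpace ℝ X] (v v' : X) :
    Commute (LineDeriv.lineDerivOpCLM ℂ 𝓢(X, ℂ) v) (LineDeriv.lineDerivOpCLM ℂ 𝓢(X, ℂ) v') := by
  have key : ∀ (f : 𝓢(X, ℂ)) (a b x : X), ∂_{a} (∂_{b} f) x = fderiv ℝ (fderiv ℝ f) x a b := by
    intro f a b x
    have h : HasFDerivAt (fun y => fderiv ℝ f y b)
        ((fderiv ℝ (fderiv ℝ f) x).flip b) x := by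
      have h1 : DifferentiableAt ℝ (fderiv ℝ f) x :=
        (((f.smooth 2).fderiv_right (m := 1) le_rfl).differentiable one_ne_zero) x
      simpa using h1.hasFDerivAt.clm_apply (hasFDerivAt_const b x)
    rw [SchwartzMap.lineDerivOp_apply_eq_fderiv,
      show (⇑(∂_{b} f : 𝓢(X, ℂ)) : X → ℂ) = fun y => fderiv ℝ f y b from
        funext fun y => SchwartzMap.lineDerivOp_apply_eq_fderiv b f y, h.fderiv]
    rfl
  ext f x
  change ∂_{v} (∂_{v'} f) x = ∂_{v'} (∂_{v} f) x
  rw [key, key]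
  exact ((f.smooth 2).contDiffAt.isSymmSndFDerivAt (by simp)) v v'

theorem commute_smulLeftCLM {X : Type*} [NormedAddCommGroup X] [NormedSpace ℝ X] {g g' : X → ℂ}
    (hg : g.HasTemperateGrowth) (hg' : g'.HasTemperateGrowth) :
    Commute (SchwartzMap.smulLeftCLM ℂ g : 𝓢(X, ℂ) →L[ℂ] 𝓢(X, ℂ))
      (SchwartzMap.smulLeftCLM ℂ g') := by
  ext f x
  change SchwartzMap.smulLeftCLM ℂ g (SchwartzMap.smulLeftCLM ℂ g' f) x =
    SchwartzMap.smulLeftCLM ℂ g' (SchwartzMap.smulLeftCLM ℂ g f) x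
  simp only [SchwartzMap.smulLeftCLM_apply_apply hg, SchwartzMap.smulLeftCLM_apply_apply hg',
    smul_eq_mul]
  ring

theorem commute_smulLeftCLM_lineDerivOp {n : ℕ} {i j : Fin n} (hij : i ≠ j) (e : R3) :
    Commute (SchwartzMap.smulLeftCLM ℂ (fun p : Fin n → R3 => ((‖p i‖ ^ 2 + 1 : ℝ) : ℂ)))
      (LineDeriv.lineDerivOpCLM ℂ (SchwartzN n) (Pi.single j e : Fin n → R3)) := by
  ext1 f
  refine (lineDerivOp_smulLeftCLM (hasTemperateGrowth_weight i) (fun x t => ?_) f).symm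
  simp [hij]

/-- Oscillators in distinct slots act on disjoint sets of variables; the derivative terms commute by
symmetry of second derivatives. This makes the product over the slots independent of their order. -/
theorem commute_oscillator {n : ℕ} (i j : Fin n) :
    Commute (oscillator i : SchwartzN n →L[ℂ] SchwartzN n) (oscillator j) := by
  rcases eq_or_ne i j with rfl | hij
  · exact Commute.refl _
  unfold oscillator
  refine Commute.sub_left (Commute.sub_right ?_ ?_) (Commute.sub_right ?_ ?_)
  · exact commute_smulLeftCLM (hasTemperateGrowth_weight i) (hasTemperateGrowth_weight j)
  · exact Commute.sum_right _ _ _ fun l _ => (commute_smulLeftCLM_lineDerivOp hij _).pow_right 2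
  · exact Commute.sum_left _ _ _ fun l _ =>
      ((commute_smulLeftCLM_lineDerivOp hij.symm _).pow_right 2).symm
  · exact Commute.sum_left _ _ _ fun l _ => Commute.sum_right _ _ _ fun l' _ =>
      (commute_lineDerivOp _ _).pow_pow 2 2

/-- The product of the oscillators of all momenta but the first. -/
def oscillatorTail (n : ℕ) : SchwartzN (n + 1) →L[ℂ] SchwartzN (n + 1) :=
  ((List.finRange n).map fun i : Fin n => oscillator i.succ).prod

theorem oscillatorPow_eq (n k : ℕ) :
    oscillatorPow n k = (((List.finRange n).map fun i : Fin n => oscillator i).prod) ^ k := by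
  rw [oscillatorPow, List.ofFn_eq_map]

theorem oscillatorPow_succ_particle (n k : ℕ) :
    oscillatorPow (n + 1) k = oscillator 0 ^ k * oscillatorTail n ^ k := by
  rw [oscillatorPow, List.ofFn_succ, List.prod_cons, List.ofFn_eq_map, ← Commute.mul_pow]
  · rfl
  · refine Commute.list_prod_right _ _ fun x hx => ?_
    obtain ⟨i, -, rfl⟩ := List.mem_map.1 hx
    exact commute_oscillator _ _

/-- Intertwining factor by factor passes to the product, so statements on `H^{⊗n}` reduce to single
slots. -/
theorem list_prod_intertwine {R S : Type*} [AddCommGroup R] [Module ℂ R] [TopologicalSpace R]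
    [AddCommGroup S] [Module ℂ S] [TopologicalSpace S] {ι : Type*} (C : R →L[ℂ] S)
    (a : ι → R →L[ℂ] R) (b : ι → S →L[ℂ] S) (h : ∀ i x, C (a i x) = b i (C x)) (l : List ι)
    (x : R) : C ((l.map a).prod x) = (l.map b).prod (C x) := by
  induction l with
  | nil => rfl
  | cons i l ih =>
    simp only [List.map_cons, List.prod_cons, mul_apply_eq_comp, h, ih]

theorem pow_intertwine {R S : Type*} [AddCommGroup R] [Module ℂ R] [TopologicalSpace R]
    [AddCommGroup S] [Module ℂ S] [TopologicalSpace S] (C : R →L[ℂ] S)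
    (a : R →L[ℂ] R) (b : S →L[ℂ] S) (h : ∀ x, C (a x) = b (C x)) (k : ℕ)
    (x : R) : C ((a ^ k) x) = (b ^ k) (C x) := by
  induction k with
  | zero => rfl
  | succ k ih => simp only [pow_succ', mul_apply_eq_comp, h, ih]

/-- The contraction integrates out slot 0, so the `n` oscillators of the result come from the slots
`1, …, n`, and no power of `H` falls on `w`. -/
theorem oscillatorPow_contract {n : ℕ} (k : ℕ) (w : 𝓢(R3, ℂ)) (g : SchwartzN (n + 1)) :
    oscillatorPow n k (contract w g) = contract w ((oscillatorTail n ^ k) g) := by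
  rw [oscillatorPow_eq]
  refine (pow_intertwine (contract w) _ _ (fun x => ?_) k g).symm
  exact list_prod_intertwine (contract w) _ _
    (fun i x => (oscillator_contract w x i).symm) _ x

theorem oscillatorPow_extProd {n : ℕ} (k : ℕ) (w : 𝓢(R3, ℂ)) (f : SchwartzN n) :
    oscillatorPow (n + 1) k (extProd w f) = extProd ((oscillatorOne ^ k) w)
      (oscillatorPow n k f) := by
  rw [oscillatorPow_succ_particle, mul_apply_eq_comp, oscillatorPow_eq,
    oscillatorTail, ← pow_intertwine (extProd w) _ _
      (list_prod_intertwine (extProd w) _ _ (fun i x => (oscillator_succ_extProd w x i).symm) _)]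
  -- The power already acting on `f` is frozen, so that the induction on `k` concerns only slot 0
  -- and `w`.
  generalize (List.map (fun i : Fin n => oscillator i) (List.finRange n)).prod ^ k = P
  induction k with
  | zero => rfl
  | succ k ih =>
    simp only [pow_succ', mul_apply_eq_comp, ih, oscillator_zero_extProd]

/-- The permutation `p ↦ p ∘ σ` of the momenta. -/
def permMom {n : ℕ} (σ : Equiv.Perm (Fin n)) : (Fin n → R3) ≃L[ℝ] (Fin n → R3) :=
  (LinearEquiv.funCongrLeft ℝ R3 σ).toContinuousLinearEquiv

@[simp]
theorem permMom_apply {n : ℕ} (σ : Equiv.Perm (Fin n)) (p : Fin n → R3) :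
    permMom σ p = p ∘ σ := rfl

/-- The action `f ↦ f(· ∘ σ)` of permutations on the functions of `n` momenta. -/
def permSchwartz {n : ℕ} (σ : Equiv.Perm (Fin n)) : SchwartzN n →L[ℂ] SchwartzN n :=
  SchwartzMap.compCLMOfContinuousLinearEquiv ℂ (permMom σ)

@[simp]
theorem permSchwartz_apply {n : ℕ} (σ : Equiv.Perm (Fin n)) (f : SchwartzN n) (p : Fin n → R3) :
    permSchwartz σ f p = f (p ∘ σ) := rfl

theorem oscillator_permSchwartz {n : ℕ} (σ : Equiv.Perm (Fin n)) (f : SchwartzN n) (i : Fin n) :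
    oscillator i (permSchwartz σ f) = permSchwartz σ (oscillator (σ⁻¹ i) f) := by
  have hs : ∀ e : R3, permMom σ (Pi.single i e) = Pi.single (σ⁻¹ i) e := fun e => by
    funext j
    simp only [permMom_apply, Function.comp_apply, Pi.single_apply, Equiv.Perm.eq_inv_iff_eq]
  ext p
  simp only [oscillator_apply, permSchwartz, SchwartzMap.lineDerivOp_compCLMOfContinuousLinearEquiv,
    hs]
  simp only [SchwartzMap.compCLMOfContinuousLinearEquiv_apply, Function.comp_apply, permMom_apply,
    oscillator_apply]
  simp

/-- A permutation relabels the slots of the factors; since these commute, their product is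
unchanged. -/
theorem oscillatorPow_permSchwartz {n : ℕ} (k : ℕ) (σ : Equiv.Perm (Fin n)) (f : SchwartzN n) :
    oscillatorPow n k (permSchwartz σ f) = permSchwartz σ (oscillatorPow n k f) := by
  rw [oscillatorPow_eq]
  refine (pow_intertwine (permSchwartz σ) _ _ (fun x => ?_) k f).symm
  have h := list_prod_intertwine (permSchwartz σ) _ _
    (fun i x => (oscillator_permSchwartz σ x i).symm) (List.finRange n) x
  rw [← h]
  congr 2
  rw [show (fun i : Fin n => (oscillator (σ⁻¹ i) : SchwartzN n →L[ℂ] SchwartzN n)) =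
    (fun i => oscillator i) ∘ (σ⁻¹ : Equiv.Perm (Fin n)) from rfl, ← List.map_map]
  refine (List.Perm.prod_eq' ((Equiv.Perm.map_finRange_perm σ⁻¹).map _) ?_).symm
  refine List.pairwise_of_forall_mem_list fun a ha b hb => ?_
  obtain ⟨i, -, rfl⟩ := List.mem_map.1 ha
  obtain ⟨j, -, rfl⟩ := List.mem_map.1 hb
  exact commute_oscillator i j

/-! ### Estimates in `L²` -/

section L2

variable {X : Type*} [NormedAddCommGroup X] [NormedSpace ℝ X] [FiniteDimensional ℝ X]
  [MeasureSpace X] [BorelSpace X] [(volume : Measure X).IsAddHaarMeasure]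

theorem norm_toLp_sq (f : 𝓢(X, ℂ)) :
    ‖f.toLp 2 (volume : Measure X)‖ ^ 2 = ∫ x, ‖f x‖ ^ 2 := by
  have h := SchwartzMap.inner_toL2_toL2_eq f f (volume : Measure X)
  rw [inner_self_eq_norm_sq_to_K] at h
  have h2 : ∀ x, inner ℂ (f x) (f x) = ((‖f x‖ ^ 2 : ℝ) : ℂ) := fun x => by
    rw [inner_self_eq_norm_sq_to_K]; norm_cast
  simp_rw [h2] at h
  rw [integral_complex_ofReal] at h
  refine Complex.ofReal_injective (Eq.trans ?_ h)
  push_cast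
  rfl

theorem inner_toLp_lineDerivOp (f g : 𝓢(X, ℂ)) (v : X) :
    inner ℂ (f.toLp 2 (volume : Measure X)) ((∂_{v} g).toLp 2 volume) =
      -inner ℂ ((∂_{v} f).toLp 2 (volume : Measure X)) (g.toLp 2 volume) := by
  rw [SchwartzMap.inner_toL2_toL2_eq f (∂_{v} g) volume,
    SchwartzMap.inner_toL2_toL2_eq (∂_{v} f) g volume]
  have h := SchwartzMap.integral_bilinear_lineDerivOp_right_eq_neg_left (μ := (volume : Measure X))
    f g ((ContinuousLinearMap.mul ℝ ℂ).comp (Complex.conjCLE : ℂ →L[ℝ] ℂ)) v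
  simpa [mul_comm] using h

theorem inner_toLp_smulLeftCLM {l : X → ℝ} (hl : (fun x => (l x : ℂ)).HasTemperateGrowth)
    (f g : 𝓢(X, ℂ)) :
    inner ℂ (f.toLp 2 (volume : Measure X))
        ((SchwartzMap.smulLeftCLM ℂ (fun x => (l x : ℂ)) g).toLp 2 volume) =
      inner ℂ ((SchwartzMap.smulLeftCLM ℂ (fun x => (l x : ℂ)) f).toLp 2 (volume : Measure X))
        (g.toLp 2 volume) := by
  rw [SchwartzMap.inner_toL2_toL2_eq _ _ volume, SchwartzMap.inner_toL2_toL2_eq _ _ volume]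
  refine integral_congr_ae (.of_forall fun x => ?_)
  simp only [SchwartzMap.smulLeftCLM_apply_apply hl, smul_eq_mul, RCLike.inner_apply, map_mul,
    Complex.conj_ofReal]
  ring

theorem toLp_add (f g : 𝓢(X, ℂ)) : (f + g).toLp 2 (volume : Measure X) =
    f.toLp 2 volume + g.toLp 2 volume :=
  map_add (SchwartzMap.toLpCLM ℂ ℂ 2 (volume : Measure X)) f g

theorem toLp_sub (f g : 𝓢(X, ℂ)) : (f - g).toLp 2 (volume : Measure X) =
    f.toLp 2 volume - g.toLp 2 volume :=
  map_sub (SchwartzMap.toLpCLM ℂ ℂ 2 (volume : Measure X)) f g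

theorem toLp_sum {ι : Type*} (s : Finset ι) (f : ι → 𝓢(X, ℂ)) :
    (∑ i ∈ s, f i).toLp 2 (volume : Measure X) = ∑ i ∈ s, (f i).toLp 2 volume :=
  map_sum (SchwartzMap.toLpCLM ℂ ℂ 2 (volume : Measure X)) f s

/-- The harmonic oscillator in one direction is bounded below by `1`. -/
theorem norm_sq_le_re_inner_oscillator (l : X →L[ℝ] ℝ) (v : X) (hv : l v = 1) (f : 𝓢(X, ℂ))
    (hl : (fun x => (l x : ℂ)).HasTemperateGrowth) :
    ‖f.toLp 2 (volume : Measure X)‖ ^ 2 ≤ RCLike.re (inner ℂ (f.toLp 2 (volume : Measure X))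
      ((SchwartzMap.smulLeftCLM ℂ (fun x => (l x : ℂ))
        (SchwartzMap.smulLeftCLM ℂ (fun x => (l x : ℂ)) f) - ∂_{v} (∂_{v} f)).toLp 2 volume)) := by
  set M : 𝓢(X, ℂ) →L[ℂ] 𝓢(X, ℂ) := SchwartzMap.smulLeftCLM ℂ (fun x => (l x : ℂ)) with hM
  -- The canonical commutation relation `[∂_v, M] = 1`, where `l v = 1` enters.
  have hMd : ∂_{v} (M f) = f + M (∂_{v} f) := by
    ext x
    have h1 : HasFDerivAt (fun x => (l x : ℂ)) (Complex.ofRealCLM ∘L l) x :=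
      (Complex.ofRealCLM ∘L l).hasFDerivAt
    have h2 : HasFDerivAt (fun x => (l x : ℂ) * f x) _ x := h1.mul (f.hasFDerivAt x)
    have h3 : (⇑(M f) : X → ℂ) = fun x => (l x : ℂ) * f x := funext fun x => by
      rw [hM, SchwartzMap.smulLeftCLM_apply_apply hl, smul_eq_mul]
    rw [SchwartzMap.lineDerivOp_apply_eq_fderiv, h3, h2.fderiv, add_apply, add_apply, hM,
      SchwartzMap.smulLeftCLM_apply_apply hl, SchwartzMap.lineDerivOp_apply_eq_fderiv]
    simp [hv]
    ring
  -- Integration by parts and the commutation relation; the real part reads `2 Re ⟨∂_v f, M f⟩ =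
  -- -‖f‖²`.
  have e1 : inner ℂ ((∂_{v} f).toLp 2 (volume : Measure X)) ((M f).toLp 2 volume) =
      -((‖f.toLp 2 (volume : Measure X)‖ ^ 2 : ℝ) : ℂ) -
        inner ℂ ((M f).toLp 2 (volume : Measure X)) ((∂_{v} f).toLp 2 volume) := by
    have h := inner_toLp_lineDerivOp f (M f) v
    rw [hMd, toLp_add, inner_add_right, inner_toLp_smulLeftCLM hl, inner_self_eq_norm_sq_to_K,
      ← hM] at h
    push_cast
    linear_combination h
  have e2 := inner_toLp_lineDerivOp f (∂_{v} f) v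
  have e3 : inner ℂ (f.toLp 2 (volume : Measure X)) ((M (M f)).toLp 2 volume) =
      inner ℂ ((M f).toLp 2 (volume : Measure X)) ((M f).toLp 2 volume) :=
    inner_toLp_smulLeftCLM hl f (M f)
  rw [toLp_sub, inner_sub_right, e2, e3]
  have e4 := norm_add_sq (𝕜 := ℂ) ((∂_{v} f).toLp 2 (volume : Measure X)) ((M f).toLp 2 volume)
  have e5 := congrArg RCLike.re e1
  have e6 := inner_re_symm (𝕜 := ℂ) ((∂_{v} f).toLp 2 (volume : Measure X)) ((M f).toLp 2 volume)
  simp only [map_sub, map_neg, inner_self_eq_norm_sq] at e5 ⊢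
  have e7 : (RCLike.re (((‖f.toLp 2 (volume : Measure X)‖ ^ 2 : ℝ) : ℂ)) : ℝ) =
    ‖f.toLp 2 (volume : Measure X)‖ ^ 2 := Complex.ofReal_re _
  rw [e7] at e5
  -- Completing the square: the difference of the two sides of the claim is `‖∂_v f + M f‖²`.
  have := sq_nonneg ‖(∂_{v} f).toLp 2 (volume : Measure X) + (M f).toLp 2 volume‖
  linarith

end L2

/-- The `j`-th component of the `i`-th momentum. -/
def coordMom {n : ℕ} (i : Fin n) (j : Fin 3) : (Fin n → R3) →L[ℝ] ℝ :=
  (EuclideanSpace.proj j : R3 →L[ℝ] ℝ) ∘L ContinuousLinearMap.proj i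

theorem coordMom_apply {n : ℕ} (i : Fin n) (j : Fin 3) (p : Fin n → R3) :
    coordMom i j p = p i j := rfl

theorem oscillator_eq {n : ℕ} (i : Fin n) (f : SchwartzN n) :
    oscillator i f = f + ∑ j : Fin 3, (SchwartzMap.smulLeftCLM ℂ (fun x => (coordMom i j x : ℂ))
      (SchwartzMap.smulLeftCLM ℂ (fun x => (coordMom i j x : ℂ)) f) -
        ∂_{(Pi.single i (EuclideanSpace.single j (1 : ℝ)) : Fin n → R3)}
          (∂_{(Pi.single i (EuclideanSpace.single j (1 : ℝ)) : Fin n → R3)} f)) := by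
  have hl : ∀ j, (fun x => (coordMom i j x : ℂ)).HasTemperateGrowth := fun j =>
    (Complex.ofRealCLM ∘L coordMom i j).hasTemperateGrowth
  ext p
  rw [oscillator_apply, add_apply, sum_apply]
  simp only [sub_apply, SchwartzMap.smulLeftCLM_apply_apply (hl _), smul_eq_mul]
  simp only [coordMom_apply]
  rw [Finset.sum_sub_distrib, EuclideanSpace.norm_sq_eq]
  have : ∀ j, (p i j : ℂ) * (p i j * f p) = ((‖p i j‖ ^ 2 : ℝ) : ℂ) * f p := fun j => by
    rw [Real.norm_eq_abs, sq_abs]; push_cast; ring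
  simp_rw [this]
  rw [← Finset.sum_mul]
  push_cast
  ring

/-- The constant is `1 + 3`: the summand 1 of `H` and the lower bound 1 of the one-dimensional
oscillator in each of three directions. Cauchy–Schwarz turns the bound on the quadratic form into
one on norms. -/
theorem four_mul_norm_le_norm_oscillator {n : ℕ} (i : Fin n) (f : SchwartzN n) :
    4 * ‖f.toLp 2 (volume : Measure (Fin n → R3))‖ ≤
      ‖(oscillator i f).toLp 2 (volume : Measure (Fin n → R3))‖ := by
  set a := ‖f.toLp 2 (volume : Measure (Fin n → R3))‖ with ha
  have h1 : 4 * a ^ 2 ≤ RCLike.re (inner ℂ (f.toLp 2 (volume : Measure (Fin n → R3)))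
      ((oscillator i f).toLp 2 volume)) := by
    rw [oscillator_eq, toLp_add, toLp_sum, inner_add_right, inner_sum, map_add, map_sum,
      inner_self_eq_norm_sq]
    have h2 : ∑ j : Fin 3, a ^ 2 ≤ _ := Finset.sum_le_sum fun j _ =>
      norm_sq_le_re_inner_oscillator (coordMom i j)
        (Pi.single i (EuclideanSpace.single j (1 : ℝ)) : Fin n → R3)
        (by simp [coordMom_apply]) f (Complex.ofRealCLM ∘L coordMom i j).hasTemperateGrowth
    refine le_trans ?_ (add_le_add le_rfl h2)
    simp
    linarith
  have h3 := (RCLike.re_le_norm _).trans (norm_inner_le_norm (𝕜 := ℂ)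
    (f.toLp 2 (volume : Measure (Fin n → R3))) ((oscillator i f).toLp 2 volume))
  have h4 := h1.trans h3
  rcases (norm_nonneg (f.toLp 2 (volume : Measure (Fin n → R3)))).eq_or_lt with h0 | h0
  · rw [ha, ← h0]; simp
  · rw [← ha] at h0 h4
    exact le_of_mul_le_mul_left (by linarith) h0

theorem pow_mul_norm_le_norm_list_prod {n : ℕ} (l : List (Fin n)) (f : SchwartzN n) :
    4 ^ l.length * ‖f.toLp 2 (volume : Measure (Fin n → R3))‖ ≤
      ‖((l.map fun i => (oscillator i : SchwartzN n →L[ℂ] SchwartzN n)).prod f).toLp 2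
        (volume : Measure (Fin n → R3))‖ := by
  induction l with
  | nil => simp
  | cons i l ih =>
    simp only [List.map_cons, List.prod_cons, mul_apply_eq_comp, List.length_cons]
    refine le_trans ?_ (four_mul_norm_le_norm_oscillator i _)
    rw [pow_succ']
    linarith

/-- The norm `|(H^{⊗n})^k f|` in `L²`. -/
def oscNorm {n : ℕ} (k : ℕ) (f : SchwartzN n) : ℝ :=
  ‖(oscillatorPow n k f).toLp 2 (volume : Measure (Fin n → R3))‖

theorem oscNorm_nonneg {n : ℕ} (k : ℕ) (f : SchwartzN n) : 0 ≤ oscNorm k f := norm_nonneg _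

/-- Each of the `n` factors of `H^{⊗n}` contributes 4. This geometric gain in the particle number is
what later absorbs all combinatorial factors. -/
theorem pow_mul_oscNorm_le {n : ℕ} (k : ℕ) (f : SchwartzN n) :
    4 ^ n * oscNorm k f ≤ oscNorm (k + 1) f := by
  have h := pow_mul_norm_le_norm_list_prod (List.finRange n) (oscillatorPow n k f)
  rw [List.length_finRange] at h
  rwa [oscNorm, oscNorm, oscillatorPow_eq n (k + 1), pow_succ', mul_apply_eq_comp, ← oscillatorPow_eq]

/-- Supplying the missing oscillator of slot 0 can only increase the norm, because it is bounded
below by `4 ≥ 1`. -/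
theorem norm_oscillatorTail_pow_le {n : ℕ} (k : ℕ) (g : SchwartzN (n + 1)) :
    ‖((oscillatorTail n ^ k) g).toLp 2 (volume : Measure (Fin (n + 1) → R3))‖ ≤ oscNorm k g := by
  rw [oscNorm, oscillatorPow_succ_particle, mul_apply_eq_comp]
  generalize (oscillatorTail n ^ k) g = f
  induction k with
  | zero => exact le_rfl
  | succ k ih =>
    rw [pow_succ', mul_apply_eq_comp]
    refine (ih.trans ?_).trans (four_mul_norm_le_norm_oscillator 0 _)
    linarith [norm_nonneg (((oscillator 0 ^ k) f).toLp 2 (volume : Measure (Fin (n + 1) → R3)))]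

theorem integral_eq_integral_consMom {n : ℕ} (F : (Fin (n + 1) → R3) → ℝ) :
    ∫ x, F x = ∫ z : R3 × (Fin n → R3), F (consMom z.1 z.2) := by
  have h := (volume_preserving_piFinSuccAbove (fun _ : Fin (n + 1) => R3) 0).symm
  rw [← h.integral_comp' F]
  refine integral_congr_ae (.of_forall fun z => ?_)
  simp [MeasurableEquiv.piFinSuccAbove, Fin.insertNthEquiv]

theorem integrable_consMom_iff {n : ℕ} {F : (Fin (n + 1) → R3) → ℝ} (hF : Integrable F) :
    Integrable fun z : R3 × (Fin n → R3) => F (consMom z.1 z.2) := by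
  have h := (volume_preserving_piFinSuccAbove (fun _ : Fin (n + 1) => R3) 0).symm
  refine (h.integrable_comp_of_integrable hF).congr (.of_forall fun z => ?_)
  simp [MeasurableEquiv.piFinSuccAbove, Fin.insertNthEquiv]

theorem integrable_norm_sq {X : Type*} [NormedAddCommGroup X] [NormedSpace ℝ X]
    [FiniteDimensional ℝ X] [MeasureSpace X] [BorelSpace X]
    [(volume : Measure X).IsAddHaarMeasure] (f : 𝓢(X, ℂ)) : Integrable fun x => ‖f x‖ ^ 2 :=
  (memLp_two_iff_integrable_sq_norm f.continuous.aestronglyMeasurable).1 (f.memLp 2 volume)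

theorem norm_toLp_extProd {n : ℕ} (w : 𝓢(R3, ℂ)) (f : SchwartzN n) :
    ‖(extProd w f).toLp 2 (volume : Measure (Fin (n + 1) → R3))‖ =
      ‖w.toLp 2 (volume : Measure R3)‖ * ‖f.toLp 2 (volume : Measure (Fin n → R3))‖ := by
  rw [← sq_eq_sq₀ (norm_nonneg _) (by positivity), mul_pow, norm_toLp_sq, norm_toLp_sq,
    norm_toLp_sq, integral_eq_integral_consMom]
  simp only [extProd_apply, headMom_consMom, tailMom_consMom, norm_mul, mul_pow]
  exact integral_prod_mul (fun q => ‖w q‖ ^ 2) (fun p => ‖f p‖ ^ 2)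

theorem sq_norm_integral_mul_le {X : Type*} [MeasureSpace X] {u v : X → ℂ}
    (hu : MemLp u 2) (hv : MemLp v 2) :
    ‖∫ x, u x * v x‖ ^ 2 ≤ (∫ x, ‖u x‖ ^ 2) * ∫ x, ‖v x‖ ^ 2 := by
  have h := integral_mul_norm_le_Lp_mul_Lq (μ := (volume : Measure X)) (f := u) (g := v)
    Real.HolderConjugate.two_two (by simpa using hu) (by simpa using hv)
  have h1 : ‖∫ x, u x * v x‖ ≤ ∫ x, ‖u x‖ * ‖v x‖ := by
    simpa using norm_integral_le_integral_norm (fun x => u x * v x)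
  have h2 := h1.trans h
  simp only [Real.rpow_two, ← Real.sqrt_eq_rpow] at h2
  calc ‖∫ x, u x * v x‖ ^ 2 ≤ (√(∫ x, ‖u x‖ ^ 2) * √(∫ x, ‖v x‖ ^ 2)) ^ 2 := by gcongr
    _ = _ := by
      rw [mul_pow, Real.sq_sqrt (integral_nonneg fun x => by positivity),
        Real.sq_sqrt (integral_nonneg fun x => by positivity)]

theorem memLp_consMom {n : ℕ} (g : SchwartzN (n + 1)) (p : Fin n → R3) :
    MemLp (fun q : R3 => g (consMom q p)) 2 := by
  have hc := g.continuous.comp (continuous_consMom_left p)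
  refine (memLp_two_iff_integrable_sq_norm hc.aestronglyMeasurable).2 ?_
  obtain ⟨Q, -, h⟩ := exists_seminorm_consMom (n := n) (V := ℂ) 0
  refine (integrable_inv_one_add_norm_pow.const_mul (Q g * Q g)).mono'
    (hc.norm.pow 2).aestronglyMeasurable (.of_forall fun q => ?_)
  have h1 := h g p q
  rw [pow_zero, one_mul] at h1
  have h2 : ((1 + ‖q‖) ^ 4)⁻¹ ≤ 1 := inv_le_one_of_one_le₀ (one_le_pow₀ (by simp))
  have h3 : 0 ≤ ((1 + ‖q‖) ^ 4)⁻¹ := by positivity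
  have h4 := apply_nonneg Q g
  simp only [Function.comp_apply, norm_pow, norm_norm]
  calc ‖g (consMom q p)‖ ^ 2 ≤ (Q g * ((1 + ‖q‖) ^ 4)⁻¹) ^ 2 := by gcongr
    _ = Q g * Q g * ((1 + ‖q‖) ^ 4)⁻¹ * ((1 + ‖q‖) ^ 4)⁻¹ := by ring
    _ ≤ Q g * Q g * ((1 + ‖q‖) ^ 4)⁻¹ * 1 := by gcongr
    _ = _ := mul_one _

/-- Cauchy–Schwarz in `q` for fixed `p`, followed by Fubini. -/
theorem norm_toLp_contract_le {n : ℕ} (w : 𝓢(R3, ℂ)) (g : SchwartzN (n + 1)) :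
    ‖(contract w g).toLp 2 (volume : Measure (Fin n → R3))‖ ≤
      ‖w.toLp 2 (volume : Measure R3)‖ * ‖g.toLp 2 (volume : Measure (Fin (n + 1) → R3))‖ := by
  rw [← sq_le_sq₀ (norm_nonneg _) (by positivity), mul_pow, norm_toLp_sq, norm_toLp_sq,
    norm_toLp_sq, integral_eq_integral_consMom]
  have hi := integrable_consMom_iff (integrable_norm_sq g)
  have hi2 : Integrable fun p : Fin n → R3 => ∫ q : R3, ‖g (consMom q p)‖ ^ 2 :=
    Integrable.integral_prod_right hi
  rw [show (∫ z : R3 × (Fin n → R3), ‖g (consMom z.1 z.2)‖ ^ 2) =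
    ∫ p : Fin n → R3, ∫ q : R3, ‖g (consMom q p)‖ ^ 2 from integral_prod_symm _ hi,
    ← integral_const_mul]
  refine integral_mono (integrable_norm_sq _) (hi2.const_mul _) fun p => ?_
  simp only [contract_apply]
  exact sq_norm_integral_mul_le (w.memLp 2 volume) (memLp_consMom g p)

theorem norm_toLp_permSchwartz {n : ℕ} (σ : Equiv.Perm (Fin n)) (f : SchwartzN n) :
    ‖(permSchwartz σ f).toLp 2 (volume : Measure (Fin n → R3))‖ =
      ‖f.toLp 2 (volume : Measure (Fin n → R3))‖ := by
  rw [← sq_eq_sq₀ (norm_nonneg _) (norm_nonneg _), norm_toLp_sq, norm_toLp_sq]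
  have h := volume_measurePreserving_piCongrLeft (fun _ : Fin n => R3) σ.symm
  rw [← h.integral_comp' fun p => ‖f p‖ ^ 2]
  refine integral_congr_ae (.of_forall fun p => ?_)
  simp only [permSchwartz_apply]
  congr 3
  funext i
  have := MeasurableEquiv.piCongrLeft_apply_apply (β := fun _ : Fin n => R3) (e := σ.symm) p (σ i)
  simpa using this.symm

theorem oscNorm_extProd {n : ℕ} (k : ℕ) (w : 𝓢(R3, ℂ)) (f : SchwartzN n) :
    oscNorm k (extProd w f) =
      ‖((oscillatorOne ^ k) w).toLp 2 (volume : Measure R3)‖ * oscNorm k f := by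
  rw [oscNorm, oscillatorPow_extProd, norm_toLp_extProd, oscNorm]

theorem oscNorm_contract_le {n : ℕ} (k : ℕ) (w : 𝓢(R3, ℂ)) (g : SchwartzN (n + 1)) :
    oscNorm k (contract w g) ≤ ‖w.toLp 2 (volume : Measure R3)‖ * oscNorm k g := by
  rw [oscNorm, oscillatorPow_contract]
  exact (norm_toLp_contract_le w _).trans
    (mul_le_mul_of_nonneg_left (norm_oscillatorTail_pow_le k g) (norm_nonneg _))

theorem oscNorm_permSchwartz {n : ℕ} (k : ℕ) (σ : Equiv.Perm (Fin n)) (f : SchwartzN n) :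
    oscNorm k (permSchwartz σ f) = oscNorm k f := by
  rw [oscNorm, oscillatorPow_permSchwartz, norm_toLp_permSchwartz, oscNorm]

/-! ### Annihilation and creation operators on Fock sequences -/

/-- The `s`-th component of a `ℂ⁴`-valued Schwartz function. -/
def component (s : Fin 4) : 𝓢(R3, C4) →L[ℂ] 𝓢(R3, ℂ) :=
  SchwartzMap.postcompCLM (EuclideanSpace.proj s : C4 →L[ℂ] ℂ)

@[simp]
theorem component_apply (s : Fin 4) (u : 𝓢(R3, C4)) (p : R3) : component s u p = u p s := rfl

theorem oscNorm_eq_norm {n : ℕ} (k : ℕ) (f : SchwartzN n) : oscNorm k f =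
    ‖SchwartzMap.toLpCLM ℂ ℂ 2 (volume : Measure (Fin n → R3)) (oscillatorPow n k f)‖ := rfl

theorem oscNorm_smul {n : ℕ} (k : ℕ) (c : ℂ) (f : SchwartzN n) :
    oscNorm k (c • f) = ‖c‖ * oscNorm k f := by
  rw [oscNorm_eq_norm, oscNorm_eq_norm, map_smul, map_smul, norm_smul]

theorem oscNorm_sum_le {n : ℕ} {ι : Type*} (k : ℕ) (t : Finset ι) (f : ι → SchwartzN n) :
    oscNorm k (∑ i ∈ t, f i) ≤ ∑ i ∈ t, oscNorm k (f i) := by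
  simp only [oscNorm_eq_norm, map_sum]
  exact norm_sum_le _ _

theorem pow_mul_oscNorm_le_two {n : ℕ} (k : ℕ) (f : SchwartzN n) :
    16 ^ n * oscNorm k f ≤ oscNorm (k + 2) f := by
  refine le_trans ?_ (pow_mul_oscNorm_le (k + 1) f)
  have h := mul_le_mul_of_nonneg_left (pow_mul_oscNorm_le k f) (by positivity : (0 : ℝ) ≤ 4 ^ n)
  rwa [← mul_assoc, ← mul_pow, show (4 : ℝ) * 4 = 16 by norm_num] at h

theorem contract_add_left {n : ℕ} (w w' : 𝓢(R3, ℂ)) (g : SchwartzN (n + 1)) :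
    contract (w + w') g = contract w g + contract w' g := by
  have h : (fun p : Fin (n + 1) → R3 => (w + w') (headMom n p)) =
    (fun p => w (headMom n p)) + fun p => w' (headMom n p) := rfl
  simp only [contract, ContinuousLinearMap.comp_apply]
  rw [h, SchwartzMap.smulLeftCLM_add (hasTemperateGrowth_comp_headMom w)
    (hasTemperateGrowth_comp_headMom w'), add_apply, map_add]

theorem contract_smul_left {n : ℕ} (c : ℂ) (w : 𝓢(R3, ℂ)) (g : SchwartzN (n + 1)) :
    contract (c • w) g = c • contract w g := by
  ext p
  simp only [contract_apply, smul_apply, smul_eq_mul, mul_assoc]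
  exact integral_const_mul _ _

theorem extProd_add_left {n : ℕ} (w w' : 𝓢(R3, ℂ)) (f : SchwartzN n) :
    extProd (w + w') f = extProd w f + extProd w' f := by
  ext p; simp [add_mul]

theorem extProd_smul_left {n : ℕ} (c : ℂ) (w : 𝓢(R3, ℂ)) (f : SchwartzN n) :
    extProd (c • w) f = c • extProd w f := by
  ext p; simp [mul_assoc]

/-- The index tuple `(s₀, s₁, …, sₙ)`. -/
abbrev consIdx {n : ℕ} (r : Fin 4) (s : Fin n → Fin 4) : Fin (n + 1) → Fin 4 :=
  Fin.cons (α := fun _ => Fin 4) r s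

/-- The contraction of an `(n+1)`-particle function with `u`, times `n + 1`. -/
def annihilate {n : ℕ} (u : 𝓢(R3, C4)) : NParticle (n + 1) →L[ℂ] NParticle n :=
  ContinuousLinearMap.pi fun s => ((n : ℂ) + 1) • ∑ r : Fin 4,
    contract (component r u) ∘L ContinuousLinearMap.proj (consIdx r s)

theorem annihilate_apply {n : ℕ} (u : 𝓢(R3, C4)) (f : NParticle (n + 1)) (s : Fin n → Fin 4) :
    annihilate u f s = ((n : ℂ) + 1) • ∑ r : Fin 4, contract (component r u) (f (consIdx r s)) := by
  simp [annihilate]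

/-- The permutation that moves the particle `i` to the front. -/
abbrev toFront {n : ℕ} (i : Fin (n + 1)) : Equiv.Perm (Fin (n + 1)) := i.cycleRange.symm

theorem comp_toFront {n : ℕ} {α : Type*} (i : Fin (n + 1)) (p : Fin (n + 1) → α) :
    p ∘ toFront i = Fin.cons (α := fun _ => α) (p i) (i.removeNth p) := by
  funext j
  refine Fin.cases ?_ (fun j => ?_) j
  · simp
  · simp [Fin.removeNth]

/-- The tensor product of an `n`-particle function and `v`, with `v` in the slot `i`. -/
def insertAt {n : ℕ} (v : 𝓢(R3, C4)) (i : Fin (n + 1)) : NParticle n →L[ℂ] NParticle (n + 1) :=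
  ContinuousLinearMap.pi fun s => permSchwartz (toFront i) ∘L extProd (component (s i) v) ∘L
    ContinuousLinearMap.proj (i.removeNth s)

theorem insertAt_apply {n : ℕ} (v : 𝓢(R3, C4)) (i : Fin (n + 1)) (f : NParticle n)
    (s : Fin (n + 1) → Fin 4) :
    insertAt v i f s = permSchwartz (toFront i) (extProd (component (s i) v) (f (i.removeNth s))) :=
  rfl

theorem insertAt_apply_apply {n : ℕ} (v : 𝓢(R3, C4)) (i : Fin (n + 1)) (f : NParticle n)
    (s : Fin (n + 1) → Fin 4) (p : Fin (n + 1) → R3) :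
    insertAt v i f s p = v (p i) (s i) * f (i.removeNth s) (i.removeNth p) := by
  rw [insertAt_apply, permSchwartz_apply, comp_toFront]
  rfl

/-- The (anti)symmetrized tensor product of an `n`-particle function and `v`. -/
def create (ε : Statistics) {n : ℕ} (v : 𝓢(R3, C4)) : NParticle n →L[ℂ] NParticle (n + 1) :=
  (1 / ((n : ℂ) + 1)) • ∑ i : Fin (n + 1), ε.moveSign i • insertAt v i

theorem create_apply (ε : Statistics) {n : ℕ} (v : 𝓢(R3, C4)) (f : NParticle n)
    (s : Fin (n + 1) → Fin 4) : create ε v f s =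
      (1 / ((n : ℂ) + 1)) • ∑ i : Fin (n + 1), ε.moveSign i • insertAt v i f s := by
  simp [create]

/-- The annihilation operator on Fock sequences. -/
def annihSeq : 𝓢(R3, C4) →ₗ[ℂ] FockSeq →ₗ[ℂ] FockSeq :=
  LinearMap.mk₂ ℂ (fun u Φ n => annihilate u (Φ (n + 1)))
    (fun u u' Φ => by
      funext n s
      simp only [annihilate_apply, Pi.add_apply, map_add, contract_add_left,
        Finset.sum_add_distrib, smul_add])
    (fun c u Φ => by
      funext n s
      simp only [annihilate_apply, Pi.smul_apply, map_smul, contract_smul_left,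
        ← Finset.smul_sum, smul_comm c])
    (fun u Φ Ψ => by
      funext n
      simp only [Pi.add_apply, map_add])
    (fun c u Φ => by
      funext n
      simp only [Pi.smul_apply, map_smul])

/-- The creation operator on Fock sequences. -/
def createSeq (ε : Statistics) : 𝓢(R3, C4) →ₗ[ℂ] FockSeq →ₗ[ℂ] FockSeq :=
  LinearMap.mk₂ ℂ (fun v Φ n => match n with
      | 0 => 0
      | n + 1 => create ε v (Φ n))
    (fun v v' Φ => by
      funext n
      rcases n with _ | n
      · simp
      · funext s
        simp only [create_apply, insertAt_apply, Pi.add_apply, map_add, extProd_add_left,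
          Finset.sum_add_distrib, smul_add])
    (fun c v Φ => by
      funext n
      rcases n with _ | n
      · simp
      · funext s
        simp only [create_apply, insertAt_apply, Pi.smul_apply, map_smul, extProd_smul_left,
          smul_comm _ c, ← Finset.smul_sum])
    (fun v Φ Ψ => by
      funext n
      rcases n with _ | n
      · simp
      · simp only [Pi.add_apply, map_add])
    (fun c v Φ => by
      funext n
      rcases n with _ | n
      · simp
      · simp only [Pi.smul_apply, map_smul])

theorem annihSeq_apply (u : 𝓢(R3, C4)) (Φ : FockSeq) (n : ℕ) :
    annihSeq u Φ n = annihilate u (Φ (n + 1)) := rfl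

theorem createSeq_zero (ε : Statistics) (v : 𝓢(R3, C4)) (Φ : FockSeq) :
    createSeq ε v Φ 0 = 0 := rfl

theorem createSeq_succ (ε : Statistics) (v : 𝓢(R3, C4)) (Φ : FockSeq) (n : ℕ) :
    createSeq ε v Φ (n + 1) = create ε v (Φ n) := rfl

theorem annihSeq_eq_annihilation (u : 𝓢(R3, C4)) (Φ : FockSeq) (n : ℕ) (s : Fin n → Fin 4)
    (p : Fin n → R3) : annihSeq u Φ n s p = annihilation (fun r q => u q r) Φ n s p := by
  rw [annihSeq_apply, annihilate_apply, annihilation]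
  simp only [smul_apply, sum_apply, contract_apply, component_apply, smul_eq_mul]

theorem createSeq_eq_creation (ε : Statistics) (v : 𝓢(R3, C4)) (Φ : FockSeq) (n : ℕ)
    (s : Fin n → Fin 4) (p : Fin n → R3) :
    createSeq ε v Φ n s p = creation ε (fun r q => v q r) Φ n s p := by
  rcases n with _ | n
  · rfl
  · rw [createSeq_succ, create_apply, creation]
    simp only [smul_apply, sum_apply, insertAt_apply_apply, smul_eq_mul, mul_assoc]

/-! ### Tensor powers -/

/-- A continuous linear map only has to be checked on product functions, since their span is dense
in the tensor power and the target is closed. -/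
theorem map_mem_tensorPower {E : Submodule ℂ 𝓢(R3, C4)} {a b : ℕ} (L : NParticle a →L[ℂ] NParticle b)
    (hL : ∀ (ξ : Fin a → E) (f : NParticle a),
      (∀ s p, f s p = ∏ i : Fin a, (ξ i : 𝓢(R3, C4)) (p i) (s i)) → L f ∈ tensorPower E b)
    {f : NParticle a} (hf : f ∈ tensorPower E a) : L f ∈ tensorPower E b := by
  have h : tensorPower E a ≤ (tensorPower E b).comap (L : NParticle a →ₗ[ℂ] NParticle b) := by
    refine Submodule.topologicalClosure_minimal _ (Submodule.span_le.2 ?_) ?_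
    · rintro f ⟨ξ, hξ⟩
      exact hL ξ f hξ
    · exact (Submodule.isClosed_topologicalClosure _).preimage L.continuous
  exact h hf

theorem mem_tensorPower_of_eq_prod {E : Submodule ℂ 𝓢(R3, C4)} {n : ℕ} {ξ : Fin n → E}
    {f : NParticle n} (hf : ∀ s p, f s p = ∏ i : Fin n, (ξ i : 𝓢(R3, C4)) (p i) (s i)) :
    f ∈ tensorPower E n :=
  Submodule.le_topologicalClosure _ (Submodule.subset_span ⟨ξ, hf⟩)

theorem annihilate_mem_tensorPower {E : Submodule ℂ 𝓢(R3, C4)} {n : ℕ} (u : 𝓢(R3, C4))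
    {f : NParticle (n + 1)} (hf : f ∈ tensorPower E (n + 1)) :
    annihilate u f ∈ tensorPower E n := by
  refine map_mem_tensorPower (annihilate u) (fun ξ f hξ => ?_) hf
  set c : ℂ := ((n : ℂ) + 1) * ∑ r : Fin 4, ∫ q : R3, u q r * (ξ 0 : 𝓢(R3, C4)) q r with hc
  have h : ∀ s p, annihilate u f s p =
      c * ∏ i : Fin n, (ξ i.succ : 𝓢(R3, C4)) (p i) (s i) := fun s p => by
    rw [annihilate_apply, hc, mul_assoc, Finset.sum_mul]
    simp only [smul_apply, sum_apply, contract_apply, component_apply, smul_eq_mul]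
    congr 1
    refine Finset.sum_congr rfl fun r _ => ?_
    rw [← integral_mul_const]
    refine integral_congr_ae (.of_forall fun q => ?_)
    simp only [hξ, Fin.prod_univ_succ, Fin.cons_zero, Fin.cons_succ]
    ring
  -- The contraction is `c` times a product function. The generators of the span carry no scalar, so
  -- `c` is divided out, which needs `c ≠ 0`.
  by_cases h0 : c = 0
  · have : annihilate u f = 0 := by
      funext s
      ext p
      rw [h, h0, zero_mul]
      rfl
    rw [this]
    exact zero_mem _
  · have : c⁻¹ • annihilate u f ∈ tensorPower E n := by
      refine mem_tensorPower_of_eq_prod (ξ := fun i => ξ i.succ) fun s p => ?_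
      rw [Pi.smul_apply, smul_apply, h, smul_eq_mul, inv_mul_cancel_left₀ h0]
    simpa [smul_smul, h0] using Submodule.smul_mem _ c this

theorem create_mem_tensorPower {E : Submodule ℂ 𝓢(R3, C4)} (ε : Statistics) {n : ℕ}
    {v : 𝓢(R3, C4)} (hv : v ∈ E) {f : NParticle n} (hf : f ∈ tensorPower E n) :
    create ε v f ∈ tensorPower E (n + 1) := by
  have h : ∀ i, insertAt v i f ∈ tensorPower E (n + 1) := fun i => by
    refine map_mem_tensorPower (insertAt v i) (fun ξ f hξ => ?_) hf
    refine mem_tensorPower_of_eq_prod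
      (ξ := Fin.insertNth (α := fun _ => E) i ⟨v, hv⟩ ξ) fun s p => ?_
    rw [insertAt_apply_apply, hξ, Fin.prod_univ_succAbove _ i]
    simp [Fin.removeNth]
  simp only [create, smul_apply, sum_apply]
  exact Submodule.smul_mem _ _ (Submodule.sum_mem _ fun i _ => Submodule.smul_mem _ _ (h i))

/-! ### Statistics -/

/-- The permutation of the particles `1, …, n` that fixes the particle `0`. -/
def extendPerm {n : ℕ} (σ : Equiv.Perm (Fin n)) : Equiv.Perm (Fin (n + 1)) :=
  Equiv.Perm.decomposeFin.symm (0, σ)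

theorem cons_comp_extendPerm {n : ℕ} {α : Type*} (σ : Equiv.Perm (Fin n)) (a : α) (s : Fin n → α) :
    Fin.cons (α := fun _ => α) a s ∘ extendPerm σ = Fin.cons (α := fun _ => α) a (s ∘ σ) := by
  funext j
  refine Fin.cases ?_ (fun j => ?_) j
  · simp [extendPerm]
  · simp [extendPerm]

theorem permSign_extendPerm (ε : Statistics) {n : ℕ} (σ : Equiv.Perm (Fin n)) :
    ε.permSign (extendPerm σ) = ε.permSign σ := by
  cases ε
  · rfl
  · simp [Statistics.permSign, extendPerm]

theorem permSign_mul (ε : Statistics) {n : ℕ} (σ τ : Equiv.Perm (Fin n)) :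
    ε.permSign (σ * τ) = ε.permSign σ * ε.permSign τ := by
  cases ε
  · simp [Statistics.permSign]
  · simp [Statistics.permSign]

theorem permSign_mul_self (ε : Statistics) {n : ℕ} (σ : Equiv.Perm (Fin n)) :
    ε.permSign σ * ε.permSign σ = 1 := by
  cases ε
  · simp [Statistics.permSign]
  · rcases Int.units_eq_one_or (Equiv.Perm.sign σ) with h | h <;> simp [Statistics.permSign, h]

/-- Moving particle `i` to the front is a cycle of length `i + 1`, of sign `(-1)^i`. -/
theorem moveSign_eq_permSign (ε : Statistics) {n : ℕ} (i : Fin (n + 1)) :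
    ε.moveSign i = ε.permSign (toFront i) := by
  cases ε
  · rfl
  · simp [Statistics.permSign, Statistics.moveSign, Equiv.Perm.sign_symm]

theorem norm_moveSign (ε : Statistics) (i : ℕ) : ‖ε.moveSign i‖ = 1 := by
  cases ε <;> simp [Statistics.moveSign]

theorem exists_extendPerm {n : ℕ} {ρ : Equiv.Perm (Fin (n + 1))} (h : ρ 0 = 0) :
    ∃ σ, ρ = extendPerm σ := by
  refine ⟨(Equiv.Perm.decomposeFin ρ).2, ?_⟩
  have h1 : (Equiv.Perm.decomposeFin ρ).1 = 0 := by
    have h2 := Equiv.Perm.decomposeFin_symm_apply_zero (Equiv.Perm.decomposeFin ρ).1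
      (Equiv.Perm.decomposeFin ρ).2
    rw [Prod.mk.eta, Equiv.symm_apply_apply, h] at h2
    exact h2.symm
  rw [extendPerm, ← h1, Prod.mk.eta, Equiv.symm_apply_apply]

/-- An `n`-particle function has the symmetry of the statistics `ε`. -/
def HasStatistics (ε : Statistics) {n : ℕ} (f : NParticle n) : Prop :=
  ∀ (σ : Equiv.Perm (Fin n)) (s : Fin n → Fin 4) (p : Fin n → R3),
    f (s ∘ σ) (p ∘ σ) = ε.permSign σ * f s p

theorem annihilate_hasStatistics (ε : Statistics) {n : ℕ} (u : 𝓢(R3, C4)) {f : NParticle (n + 1)}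
    (hf : HasStatistics ε f) : HasStatistics ε (annihilate u f) := by
  intro σ s p
  rw [annihilate_apply, annihilate_apply]
  simp only [smul_apply, sum_apply, contract_apply, smul_eq_mul]
  rw [mul_left_comm]
  congr 1
  rw [Finset.mul_sum]
  refine Finset.sum_congr rfl fun r _ => ?_
  rw [← integral_const_mul]
  refine integral_congr_ae (.of_forall fun q => ?_)
  simp only [consMom, consIdx]
  rw [← cons_comp_extendPerm, ← cons_comp_extendPerm, hf, permSign_extendPerm]
  ring

/-- The sum over slots is a sum over cosets of the stabilizer of particle 0, represented by `toFront
i`. A permutation `σ` moves the coset of `i` to that of `σ i`, up to an element of the stabilizer,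
and on the stabilizer the symmetry of `f` applies. -/
theorem create_hasStatistics (ε : Statistics) {n : ℕ} (v : 𝓢(R3, C4)) {f : NParticle n}
    (hf : HasStatistics ε f) : HasStatistics ε (create ε v f) := by
  let G : (Fin (n + 1) → Fin 4) → (Fin (n + 1) → R3) → ℂ := fun s p =>
    v (p 0) (s 0) * f (fun j => s j.succ) (fun j => p j.succ)
  have hG : ∀ (ρ : Equiv.Perm (Fin (n + 1))), ρ 0 = 0 → ∀ s p,
      G (s ∘ ρ) (p ∘ ρ) = ε.permSign ρ * G s p := by
    intro ρ hρ s p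
    obtain ⟨σ, rfl⟩ := exists_extendPerm hρ
    have e : ∀ {α : Type} (t : Fin (n + 1) → α), (fun j : Fin n => (t ∘ extendPerm σ) j.succ) =
        (fun j => t j.succ) ∘ σ := fun t => by funext j; simp [extendPerm]
    change v ((p ∘ extendPerm σ) 0) ((s ∘ extendPerm σ) 0) *
      f (fun j => (s ∘ extendPerm σ) j.succ) (fun j => (p ∘ extendPerm σ) j.succ) = _
    rw [e, e, hf σ, permSign_extendPerm]
    simp only [G, Function.comp_apply, hρ]
    ring
  have hc : ∀ s p, create ε v f s p = (1 / ((n : ℂ) + 1)) * ∑ i : Fin (n + 1),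
      ε.permSign (toFront i) * G (s ∘ toFront i) (p ∘ toFront i) := by
    intro s p
    rw [create_apply]
    simp only [smul_apply, sum_apply, smul_eq_mul, insertAt_apply_apply, moveSign_eq_permSign]
    simp only [comp_toFront, G, Fin.cons_zero, Fin.cons_succ]
  intro σ s p
  rw [hc, hc, mul_left_comm]
  congr 1
  rw [Finset.mul_sum]
  refine Fintype.sum_equiv σ _ _ fun i => ?_
  -- The discrepancy between `σ * toFront i` and the representative `toFront (σ i)`; it fixes 0.
  set ρ : Equiv.Perm (Fin (n + 1)) := (toFront (σ i))⁻¹ * (σ * toFront i) with hρ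
  have h0 : ρ 0 = 0 := by
    simp [hρ, Equiv.Perm.inv_def]
  have h1 : σ * toFront i = toFront (σ i) * ρ := by rw [hρ, mul_inv_cancel_left]
  have h2 : ∀ {α : Type} (t : Fin (n + 1) → α), (t ∘ σ) ∘ toFront i = (t ∘ toFront (σ i)) ∘ ρ := by
    intro α t
    have := congrArg (fun τ : Equiv.Perm (Fin (n + 1)) => t ∘ τ) h1
    simpa [Equiv.Perm.coe_mul, Function.comp_assoc] using this
  rw [h2, h2, hG ρ h0]
  have h3 : ε.permSign (toFront i) * ε.permSign ρ = ε.permSign σ * ε.permSign (toFront (σ i)) := by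
    have h4 := congrArg ε.permSign h1
    rw [permSign_mul, permSign_mul] at h4
    have h5 := permSign_mul_self ε (toFront (σ i))
    have h6 := permSign_mul_self ε (toFront i)
    linear_combination (-(ε.permSign (toFront i) * ε.permSign (toFront (σ i)))) * h4 +
      (ε.permSign σ * ε.permSign (toFront (σ i))) * h6 -
      (ε.permSign (toFront i) * ε.permSign ρ) * h5
  rw [← mul_assoc, h3, mul_assoc]

/-! ### Annihilation and creation operators on the Hida test space -/

theorem norm_fockWeight (k : ℕ) (Φ : FockSeq) (i : FockIndex) :
    ‖fockWeight k Φ i‖ = √(i.1.factorial : ℝ) * oscNorm k (Φ i.1 i.2) := by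
  change ‖((√(i.1.factorial : ℝ) : ℝ) : ℂ) • SchwartzMap.toLpCLM ℂ ℂ 2
    (volume : Measure (Fin i.1 → R3)) (oscillatorPow i.1 k (Φ i.1 i.2))‖ = _
  rw [norm_smul, Complex.norm_real, Real.norm_of_nonneg (Real.sqrt_nonneg _), oscNorm_eq_norm]

/-- There are `4^n` index tuples with `n` particles, so the sum is dominated by `∑ 4^{-n} = 4/3`. -/
theorem sum_pow_fockIndex_le (S : Finset FockIndex) : ∑ i ∈ S, ((1 / 16 : ℝ)) ^ i.1 ≤ 2 := by
  obtain ⟨N, hN⟩ : ∃ N, ∀ i ∈ S, i.1 < N := by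
    refine ⟨S.sup (fun i => i.1 + 1), fun i hi => ?_⟩
    exact Nat.lt_of_succ_le (Finset.le_sup (f := fun i : FockIndex => i.1 + 1) hi)
  have h1 : S ⊆ (Finset.range N).sigma fun n => (Finset.univ : Finset (Fin n → Fin 4)) :=
    fun i hi => Finset.mem_sigma.2 ⟨Finset.mem_range.2 (hN i hi), Finset.mem_univ _⟩
  refine (Finset.sum_le_sum_of_subset_of_nonneg h1 fun i _ _ => by positivity).trans ?_
  rw [Finset.sum_sigma]
  have h2 : ∀ n, ∑ _s : Fin n → Fin 4, (1 / 16 : ℝ) ^ n = (1 / 4) ^ n := fun n => by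
    rw [Finset.sum_const, Finset.card_univ, Fintype.card_fun, Fintype.card_fin, Fintype.card_fin,
      nsmul_eq_mul, Nat.cast_pow, ← mul_pow]
    norm_num
  simp_rw [h2]
  rw [geom_sum_eq (by norm_num)]
  have : (0 : ℝ) < (1 / 4) ^ N := by positivity
  rw [show ((1 / 4 : ℝ) ^ N - 1) / (1 / 4 - 1) = (1 - (1 / 4) ^ N) * (4 / 3) by ring]
  linarith

/-- Decay `4^{-n}` of each component becomes `16^{-n}` after squaring and beats the number of index
tuples. The same estimate yields both membership in `(E)` and the operator bounds. -/
theorem sum_norm_fockWeight_le {k : ℕ} {Ψ : FockSeq} {M : ℝ}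
    (h : ∀ n (s : Fin n → Fin 4), √(n.factorial : ℝ) * oscNorm k (Ψ n s) ≤ M * (1 / 4) ^ n)
    (S : Finset FockIndex) :
    ∑ i ∈ S, ‖fockWeight k Ψ i‖ ^ (2 : ℝ≥0∞).toReal ≤ (2 * M) ^ (2 : ℝ≥0∞).toReal := by
  simp only [ENNReal.toReal_ofNat, Real.rpow_two]
  calc ∑ i ∈ S, ‖fockWeight k Ψ i‖ ^ 2 ≤ ∑ i ∈ S, M ^ 2 * (1 / 16) ^ i.1 := by
        refine Finset.sum_le_sum fun i _ => ?_
        rw [norm_fockWeight]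
        calc _ ≤ (M * (1 / 4) ^ i.1) ^ 2 :=
              pow_le_pow_left₀ (mul_nonneg (Real.sqrt_nonneg _) (oscNorm_nonneg _ _)) (h i.1 i.2) 2
          _ = _ := by
            rw [mul_pow, ← pow_mul, mul_comm i.1, pow_mul]
            norm_num
    _ ≤ M ^ 2 * 2 := by
        rw [← Finset.mul_sum]
        exact mul_le_mul_of_nonneg_left (sum_pow_fockIndex_le S) (by positivity)
    _ ≤ (2 * M) ^ 2 := by nlinarith [sq_nonneg M]

theorem memℓp_fockWeight {k : ℕ} {Ψ : FockSeq} {M : ℝ}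
    (h : ∀ n (s : Fin n → Fin 4), √(n.factorial : ℝ) * oscNorm k (Ψ n s) ≤ M * (1 / 4) ^ n) :
    Memℓp (fockWeight k Ψ) 2 :=
  memℓp_gen' (sum_norm_fockWeight_le h)

theorem hidaSeminorm_le {ε : Statistics} {E : Submodule ℂ 𝓢(R3, C4)} {k : ℕ} {Ψ : HidaSpace ε E}
    {M : ℝ} (hM : 0 ≤ M) (h : ∀ n (s : Fin n → Fin 4),
      √(n.factorial : ℝ) * oscNorm k (Ψ.seq n s) ≤ M * (1 / 4) ^ n) :
    hidaSeminorm ε E k Ψ ≤ 2 * M :=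
  lp.norm_le_of_forall_sum_le (f := fockEmbed ε E k Ψ) (by simp) (by positivity)
    (sum_norm_fockWeight_le h)

/-- A single component is bounded by the whole norm at level `k + 2`; the two extra levels are
converted into `16^{-n}`. -/
theorem sqrt_factorial_mul_oscNorm_le {ε : Statistics} {E : Submodule ℂ 𝓢(R3, C4)} (k : ℕ)
    (Φ : HidaSpace ε E) (n : ℕ) (s : Fin n → Fin 4) :
    √(n.factorial : ℝ) * oscNorm k (Φ.seq n s) ≤ hidaSeminorm ε E (k + 2) Φ * (1 / 16) ^ n := by
  have h1 : ‖fockWeight (k + 2) Φ.seq ⟨n, s⟩‖ ≤ hidaSeminorm ε E (k + 2) Φ :=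
    lp.norm_apply_le_norm (by norm_num) (fockEmbed ε E (k + 2) Φ) ⟨n, s⟩
  rw [norm_fockWeight] at h1
  rw [one_div, inv_pow, ← div_eq_mul_inv, le_div_iff₀ (by positivity)]
  refine le_trans ?_ h1
  rw [mul_assoc, mul_comm (oscNorm _ _)]
  exact mul_le_mul_of_nonneg_left (pow_mul_oscNorm_le_two k _) (Real.sqrt_nonneg _)

theorem succ_mul_pow_le (n : ℕ) : ((n : ℝ) + 1) * (1 / 16) ^ n ≤ (1 / 4) ^ n := by
  have h : ((n : ℝ) + 1) ≤ 4 ^ n := by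
    exact_mod_cast Nat.succ_le_of_lt (Nat.lt_pow_self (by norm_num : 1 < 4))
  calc ((n : ℝ) + 1) * (1 / 16) ^ n ≤ 4 ^ n * (1 / 16) ^ n := by gcongr
    _ = (1 / 4) ^ n := by rw [← mul_pow]; norm_num

/-- The factor `n + 1` of the annihilation operator turns `16^{-n}` into at most `4^{-n}`, and the
constant 4 counts the contracted index `r`. Only the `L²`-norm of `u` enters, as no oscillator acts
on the contracted slot. -/
theorem oscNorm_annihSeq_le {ε : Statistics} {E : Submodule ℂ 𝓢(R3, C4)} (k : ℕ)
    (u : 𝓢(R3, C4)) {U : ℝ} (hU : ∀ r, ‖(component r u).toLp 2 (volume : Measure R3)‖ ≤ U)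
    (Φ : HidaSpace ε E) (n : ℕ) (s : Fin n → Fin 4) :
    √(n.factorial : ℝ) * oscNorm k (annihSeq u Φ.seq n s) ≤
      (4 * U * hidaSeminorm ε E (k + 2) Φ) * (1 / 4) ^ n := by
  have hU0 : 0 ≤ U := (norm_nonneg _).trans (hU 0)
  set N := hidaSeminorm ε E (k + 2) Φ with hN
  have hN0 : 0 ≤ N := apply_nonneg _ _
  have h1 : oscNorm k (annihSeq u Φ.seq n s) ≤
      ((n : ℝ) + 1) * ∑ r : Fin 4, U * oscNorm k (Φ.seq (n + 1) (consIdx r s)) := by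
    rw [annihSeq_apply, annihilate_apply, oscNorm_smul]
    have : ‖((n : ℂ) + 1)‖ = (n : ℝ) + 1 := by
      exact_mod_cast Complex.norm_natCast (n + 1)
    rw [this]
    refine mul_le_mul_of_nonneg_left ((oscNorm_sum_le _ _ _).trans
      (Finset.sum_le_sum fun r _ => ?_)) (by positivity)
    exact (oscNorm_contract_le k _ _).trans
      (mul_le_mul_of_nonneg_right (hU r) (oscNorm_nonneg _ _))
  have h2 : √(n.factorial : ℝ) ≤ √((n + 1).factorial : ℝ) := Real.sqrt_le_sqrt
    (by exact_mod_cast Nat.factorial_le (Nat.le_succ n))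
  calc √(n.factorial : ℝ) * oscNorm k (annihSeq u Φ.seq n s)
      ≤ √(n.factorial : ℝ) * (((n : ℝ) + 1) *
          ∑ r : Fin 4, U * oscNorm k (Φ.seq (n + 1) (consIdx r s))) := by gcongr
    _ = ((n : ℝ) + 1) * ∑ r : Fin 4, U * (√(n.factorial : ℝ) *
          oscNorm k (Φ.seq (n + 1) (consIdx r s))) := by
        rw [mul_left_comm, Finset.mul_sum]
        congr 1
        exact Finset.sum_congr rfl fun r _ => by ring
    _ ≤ ((n : ℝ) + 1) * ∑ _r : Fin 4, U * (N * (1 / 16) ^ n) := by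
        refine mul_le_mul_of_nonneg_left (Finset.sum_le_sum fun r _ =>
          mul_le_mul_of_nonneg_left ?_ hU0) (by positivity)
        refine (mul_le_mul_of_nonneg_right h2 (oscNorm_nonneg _ _)).trans
          ((sqrt_factorial_mul_oscNorm_le k Φ (n + 1) _).trans ?_)
        refine mul_le_mul_of_nonneg_left ?_ hN0
        exact pow_le_pow_of_le_one (by norm_num) (by norm_num) (Nat.le_succ n)
    _ = 4 * U * N * (((n : ℝ) + 1) * (1 / 16) ^ n) := by
        simp only [Finset.sum_const, Finset.card_univ, Fintype.card_fin, nsmul_eq_mul]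
        push_cast
        ring
    _ ≤ _ := mul_le_mul_of_nonneg_left (succ_mul_pow_le n) (by positivity)

/-- The prefactor `1/(n+1)` cancels the number of slots, and all summands have the same type of
bound because permutations preserve the norms. What remains is `√(n+1)! ≤ (n+1) √n!`, absorbed by
the decay. -/
theorem oscNorm_createSeq_le {ε : Statistics} {E : Submodule ℂ 𝓢(R3, C4)} (k : ℕ)
    (v : 𝓢(R3, C4)) {U : ℝ} (hU : ∀ r,
      ‖((oscillatorOne ^ k) (component r v)).toLp 2 (volume : Measure R3)‖ ≤ U)
    (Φ : HidaSpace ε E) (n : ℕ) (s : Fin n → Fin 4) :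
    √(n.factorial : ℝ) * oscNorm k (createSeq ε v Φ.seq n s) ≤
      (4 * U * hidaSeminorm ε E (k + 2) Φ) * (1 / 4) ^ n := by
  have hU0 : 0 ≤ U := (norm_nonneg _).trans (hU 0)
  set N := hidaSeminorm ε E (k + 2) Φ with hN
  have hN0 : 0 ≤ N := apply_nonneg _ _
  rcases n with _ | n
  · have : oscNorm k (createSeq ε v Φ.seq 0 s) = 0 := by
      rw [createSeq_zero, Pi.zero_apply, oscNorm_eq_norm, map_zero, map_zero, norm_zero]
    rw [this, mul_zero]
    positivity
  have h0 : √(((n + 1).factorial : ℕ) : ℝ) ≤ ((n : ℝ) + 1) * √(n.factorial : ℝ) := by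
    rw [Nat.factorial_succ, Nat.cast_mul, Real.sqrt_mul (by positivity)]
    refine mul_le_mul_of_nonneg_right ?_ (Real.sqrt_nonneg _)
    rw [Nat.cast_succ, Real.sqrt_le_left (by positivity)]
    nlinarith [Nat.cast_nonneg (α := ℝ) n]
  have h1 : ∀ i : Fin (n + 1), √(n.factorial : ℝ) * oscNorm k (insertAt v i (Φ.seq n) s) ≤
      U * (N * (1 / 16) ^ n) := fun i => by
    rw [insertAt_apply, oscNorm_permSchwartz, oscNorm_extProd, mul_left_comm]
    exact mul_le_mul (hU _) (sqrt_factorial_mul_oscNorm_le k Φ n _)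
      (mul_nonneg (Real.sqrt_nonneg _) (oscNorm_nonneg _ _)) hU0
  have h2 : √(n.factorial : ℝ) * oscNorm k (createSeq ε v Φ.seq (n + 1) s) ≤
      U * (N * (1 / 16) ^ n) := by
    rw [createSeq_succ, create_apply, oscNorm_smul]
    have : ‖(1 / ((n : ℂ) + 1))‖ = 1 / ((n : ℝ) + 1) := by
      rw [norm_div, norm_one]
      congr 1
      exact_mod_cast Complex.norm_natCast (n + 1)
    rw [this]
    calc √(n.factorial : ℝ) * (1 / ((n : ℝ) + 1) * oscNorm k
          (∑ i : Fin (n + 1), ε.moveSign i • insertAt v i (Φ.seq n) s))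
        ≤ √(n.factorial : ℝ) * (1 / ((n : ℝ) + 1) * ∑ i : Fin (n + 1),
            oscNorm k (insertAt v i (Φ.seq n) s)) := by
          gcongr
          refine (oscNorm_sum_le _ _ _).trans (le_of_eq (Finset.sum_congr rfl fun i _ => ?_))
          rw [oscNorm_smul, norm_moveSign, one_mul]
      _ = 1 / ((n : ℝ) + 1) * ∑ i : Fin (n + 1),
            √(n.factorial : ℝ) * oscNorm k (insertAt v i (Φ.seq n) s) := by
          rw [mul_left_comm, Finset.mul_sum]
      _ ≤ 1 / ((n : ℝ) + 1) * ∑ _i : Fin (n + 1), U * (N * (1 / 16) ^ n) := by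
          exact mul_le_mul_of_nonneg_left (Finset.sum_le_sum fun i _ => h1 i) (by positivity)
      _ = _ := by
          simp only [Finset.sum_const, Finset.card_univ, Fintype.card_fin, nsmul_eq_mul]
          push_cast
          field_simp
  calc √(((n + 1).factorial : ℕ) : ℝ) * oscNorm k (createSeq ε v Φ.seq (n + 1) s)
      ≤ ((n : ℝ) + 1) * √(n.factorial : ℝ) * oscNorm k (createSeq ε v Φ.seq (n + 1) s) :=
        mul_le_mul_of_nonneg_right h0 (oscNorm_nonneg _ _)
    _ = ((n : ℝ) + 1) * (√(n.factorial : ℝ) * oscNorm k (createSeq ε v Φ.seq (n + 1) s)) := by ring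
    _ ≤ ((n : ℝ) + 1) * (U * (N * (1 / 16) ^ n)) := by gcongr
    _ = U * N * (((n : ℝ) + 1) * (1 / 16) ^ n) := by ring
    _ ≤ U * N * (1 / 4) ^ n := mul_le_mul_of_nonneg_left (succ_mul_pow_le n) (by positivity)
    -- The result has one particle more than `Φₙ`; this shift of the exponent is the origin of the
    -- constant 4.
    _ = _ := by rw [pow_succ]; ring

/-- The annihilation operator on the Hida test space. -/
def annihHida (ε : Statistics) (E : Submodule ℂ 𝓢(R3, C4)) :
    E →ₗ[ℂ] HidaSpace ε E →ₗ[ℂ] HidaSpace ε E :=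
  LinearMap.mk₂ ℂ (fun u Φ => (⟨annihSeq (u : 𝓢(R3, C4)) Φ.seq,
      fun n => annihilate_mem_tensorPower _ (Φ.2.1 (n + 1)),
      fun n => annihilate_hasStatistics ε _ (Φ.2.2.1 (n + 1)),
      fun k => memℓp_fockWeight (M := 4 *
          ‖fun r : Fin 4 => (component r (u : 𝓢(R3, C4))).toLp 2 (volume : Measure R3)‖ *
          hidaSeminorm ε E (k + 2) Φ)
        (oscNorm_annihSeq_le k _ (norm_le_pi_norm
          (fun r : Fin 4 => (component r (u : 𝓢(R3, C4))).toLp 2 (volume : Measure R3))) Φ)⟩ :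
      hidaSubmodule ε E))
    (fun u u' Φ => Subtype.ext (annihSeq.map_add₂ (u : 𝓢(R3, C4)) u' Φ.seq))
    (fun c u Φ => Subtype.ext (annihSeq.map_smul₂ c (u : 𝓢(R3, C4)) Φ.seq))
    (fun u Φ Ψ => Subtype.ext ((annihSeq (u : 𝓢(R3, C4))).map_add Φ.seq Ψ.seq))
    (fun c u Φ => Subtype.ext ((annihSeq (u : 𝓢(R3, C4))).map_smul c Φ.seq))

theorem annihHida_seq {ε : Statistics} {E : Submodule ℂ 𝓢(R3, C4)} (u : E) (Φ : HidaSpace ε E) :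
    (annihHida ε E u Φ).seq = annihSeq (u : 𝓢(R3, C4)) Φ.seq := rfl

/-- The creation operator on the Hida test space. -/
def createHida (ε : Statistics) (E : Submodule ℂ 𝓢(R3, C4)) :
    E →ₗ[ℂ] HidaSpace ε E →ₗ[ℂ] HidaSpace ε E :=
  LinearMap.mk₂ ℂ (fun v Φ => (⟨createSeq ε (v : 𝓢(R3, C4)) Φ.seq,
      fun n => match n with
        | 0 => zero_mem _
        | n + 1 => create_mem_tensorPower ε v.2 (Φ.2.1 n),
      fun n => match n with
        | 0 => fun _ _ _ => (mul_zero _).symm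
        | n + 1 => create_hasStatistics ε _ (Φ.2.2.1 n),
      fun k => memℓp_fockWeight (M := 4 *
          ‖fun r : Fin 4 => ((oscillatorOne ^ k) (component r (v : 𝓢(R3, C4)))).toLp 2
            (volume : Measure R3)‖ * hidaSeminorm ε E (k + 2) Φ)
        (oscNorm_createSeq_le k _ (norm_le_pi_norm
          (fun r : Fin 4 => ((oscillatorOne ^ k) (component r (v : 𝓢(R3, C4)))).toLp 2
            (volume : Measure R3))) Φ)⟩ : hidaSubmodule ε E))
    (fun u u' Φ => Subtype.ext ((createSeq ε).map_add₂ (u : 𝓢(R3, C4)) u' Φ.seq))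
    (fun c u Φ => Subtype.ext ((createSeq ε).map_smul₂ c (u : 𝓢(R3, C4)) Φ.seq))
    (fun u Φ Ψ => Subtype.ext ((createSeq ε (u : 𝓢(R3, C4))).map_add Φ.seq Ψ.seq))
    (fun c u Φ => Subtype.ext ((createSeq ε (u : 𝓢(R3, C4))).map_smul c Φ.seq))

theorem createHida_seq {ε : Statistics} {E : Submodule ℂ 𝓢(R3, C4)} (v : E) (Φ : HidaSpace ε E) :
    (createHida ε E v Φ).seq = createSeq ε (v : 𝓢(R3, C4)) Φ.seq := rfl

/-- The components of `(H^k u_r)_r` in `L²`. -/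
def oscComponents (k : ℕ) : 𝓢(R3, C4) →L[ℂ] (Fin 4 → Lp ℂ 2 (volume : Measure R3)) :=
  ContinuousLinearMap.pi fun r => SchwartzMap.toLpCLM ℂ ℂ 2 (volume : Measure R3) ∘L
    (oscillatorOne ^ k) ∘L component r

theorem exists_oscComponents_seminorm (E : Submodule ℂ 𝓢(R3, C4)) (k : ℕ) :
    ∃ q : Seminorm ℂ E, Continuous q ∧ ∀ (u : E) r, ‖((oscillatorOne ^ k)
      (component r (u : 𝓢(R3, C4)))).toLp 2 (volume : Measure R3)‖ ≤ q u :=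
  ⟨_, continuous_seminorm_comp (q := normSeminorm ℂ _) continuous_norm
      (oscComponents k ∘L E.subtypeL), fun u r =>
    norm_le_pi_norm (oscComponents k (u : 𝓢(R3, C4))) r⟩

theorem exists_annihHida_clm (ε : Statistics) (E : Submodule ℂ 𝓢(R3, C4)) :
    ∃ T : E →L[ℂ] (HidaSpace ε E →L[ℂ] HidaSpace ε E), ∀ u Φ, T u Φ = annihHida ε E u Φ := by
  refine exists_clm_of_bilinear_bound (hida_withSeminorms ε E) _ fun k => ?_
  -- Level 0 suffices for every `k`. The constant 8 below is the 4 of `oscNorm_annihSeq_le` times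
  -- the 2 of `hidaSeminorm_le`.
  obtain ⟨q, hq, h⟩ := exists_oscComponents_seminorm E 0
  refine ⟨(8 : NNReal) • q, hidaSeminorm ε E (k + 2), hq.const_smul _,
    (hida_withSeminorms ε E).continuous_seminorm _, fun u Φ => ?_⟩
  have h1 := hidaSeminorm_le (Ψ := annihHida ε E u Φ)
    (mul_nonneg (by positivity) (apply_nonneg _ _)) (oscNorm_annihSeq_le k u (h u) Φ)
  refine h1.trans (le_of_eq ?_)
  rw [smul_apply, NNReal.smul_def, NNReal.coe_ofNat, smul_eq_mul]
  ring

theorem exists_createHida_clm (ε : Statistics) (E : Submodule ℂ 𝓢(R3, C4)) :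
    ∃ T : E →L[ℂ] (HidaSpace ε E →L[ℂ] HidaSpace ε E), ∀ u Φ, T u Φ = createHida ε E u Φ := by
  refine exists_clm_of_bilinear_bound (hida_withSeminorms ε E) _ fun k => ?_
  obtain ⟨q, hq, h⟩ := exists_oscComponents_seminorm E k
  refine ⟨(8 : NNReal) • q, hidaSeminorm ε E (k + 2), hq.const_smul _,
    (hida_withSeminorms ε E).continuous_seminorm _, fun u Φ => ?_⟩
  have h1 := hidaSeminorm_le (Ψ := createHida ε E u Φ)
    (mul_nonneg (by positivity) (apply_nonneg _ _)) (oscNorm_createSeq_le k u (h u) Φ)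
  refine h1.trans (le_of_eq ?_)
  rw [smul_apply, NNReal.smul_def, NNReal.coe_ofNat, smul_eq_mul]
  ring

/-! ### Fields with kernels in `L(𝓔, E)` -/

/-- The kernel `κ` is a continuous linear map `𝓔 → E`, with equality at every momentum. -/
def KernelEverywhere (κ : PlaneKernel) (E : Submodule ℂ 𝓢(R3, C4)) (𝓔 : Submodule ℂ 𝓢(R4, C4)) :
    Prop :=
  ∃ K : 𝓔 →L[ℂ] E, ∀ (φ : 𝓔) (s : Fin 4) (p : R3),
    (K φ : 𝓢(R3, C4)) p s = smear κ (φ : 𝓢(R4, C4)) s p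

theorem KernelEverywhere.kernelInL {κ : PlaneKernel} {E : Submodule ℂ 𝓢(R3, C4)}
    {𝓔 : Submodule ℂ 𝓢(R4, C4)} (h : KernelEverywhere κ E 𝓔) : KernelInL κ E 𝓔 := by
  obtain ⟨K, hK⟩ := h
  exact ⟨K, fun φ s => .of_forall (hK φ s)⟩

/-- The required extension to `E*` is the transpose of `K`, which is continuous for the strong
topologies. -/
theorem KernelEverywhere.kernelInDualL {κ : PlaneKernel} {E : Submodule ℂ 𝓢(R3, C4)}
    {𝓔 : Submodule ℂ 𝓢(R4, C4)} (h : KernelEverywhere κ E 𝓔) : KernelInDualL κ E 𝓔 := by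
  obtain ⟨K, hK⟩ := h
  refine ⟨ContinuousLinearMap.precomp ℂ K, fun ξ φ => ?_⟩
  rw [ContinuousLinearMap.precomp_apply, ContinuousLinearMap.comp_apply, toDual_apply]
  simp only [hK]

/-- The field is the sum of the two continuous operator-valued maps on `E` composed with the
kernels. Equality at every momentum allows `κ(φ)` to be replaced inside the Fock-space formulas
without discussing null sets. -/
theorem isOperatorValuedDistribution_of_kernelEverywhere {ε : Statistics} {κ01 κ10 : PlaneKernel}
    {E : Submodule ℂ 𝓢(R3, C4)} {𝓔 : Submodule ℂ 𝓢(R4, C4)} (h01 : KernelEverywhere κ01 E 𝓔)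
    (h10 : KernelEverywhere κ10 E 𝓔) : IsOperatorValuedDistribution ε κ01 κ10 E 𝓔 := by
  obtain ⟨K, hK⟩ := h01
  obtain ⟨L, hL⟩ := h10
  obtain ⟨T, hT⟩ := exists_annihHida_clm ε E
  obtain ⟨S, hS⟩ := exists_createHida_clm ε E
  refine ⟨T ∘L K + S ∘L L, fun φ Φ n s => .of_forall fun p => ?_⟩
  have hK' : smear κ01 (φ : 𝓢(R4, C4)) = fun r q => (K φ : 𝓢(R3, C4)) q r := by
    funext r q; exact (hK φ r q).symm
  have hL' : smear κ10 (φ : 𝓢(R4, C4)) = fun r q => (L φ : 𝓢(R3, C4)) q r := by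
    funext r q; exact (hL φ r q).symm
  rw [hK', hL', ← annihSeq_eq_annihilation, ← createSeq_eq_creation]
  simp only [add_apply, ContinuousLinearMap.comp_apply, hT, hS, map_add, annihHida_seq,
    createHida_seq, Pi.add_apply]

/-! ### Functions all of whose derivatives vanish at zero -/

section Flat

variable {D V W : Type*} [NormedAddCommGroup D] [NormedSpace ℝ D] [NormedAddCommGroup V]
  [NormedSpace ℝ V] [NormedAddCommGroup W] [NormedSpace ℝ W]

/-- All derivatives of `f` vanish at zero. -/
def IsFlat (f : D → V) : Prop := ∀ n : ℕ, iteratedFDeriv ℝ n f 0 = 0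

theorem IsFlat.apply_zero {f : D → V} (hf : IsFlat f) : f 0 = 0 := by
  have h := congrArg norm (hf 0)
  rwa [norm_iteratedFDeriv_zero, norm_zero, norm_eq_zero] at h

theorem IsFlat.fderiv {f : D → V} (hf : IsFlat f) : IsFlat (fderiv ℝ f) := fun n => by
  rw [← norm_eq_zero, norm_iteratedFDeriv_fderiv, hf, norm_zero]

theorem IsFlat.clm_comp {f : D → V} (hf : IsFlat f) (hs : ContDiff ℝ ∞ f) (L : V →L[ℝ] W) :
    IsFlat fun x => L (f x) := fun n => by
  have h := L.iteratedFDeriv_comp_left (x := (0 : D)) (i := n) hs.contDiffAt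
    (by exact_mod_cast le_top)
  rw [show (fun x => L (f x)) = L ∘ f from rfl, h, hf]
  ext
  simp

theorem IsFlat.bilin {X : Type*} [NormedAddCommGroup X] [NormedSpace ℝ X] {f : D → V}
    (hf : IsFlat f) (hs : ContDiff ℝ ∞ f) (B : X →L[ℝ] V →L[ℝ] W) {g : D → X}
    (hg : ContDiff ℝ ∞ g) : IsFlat fun x => B (g x) (f x) := fun n => by
  rw [← norm_le_zero_iff]
  refine (B.norm_iteratedFDeriv_le_of_bilinear hg hs 0 (by exact_mod_cast le_top)).trans ?_
  refine le_of_eq (mul_eq_zero_of_right _ (Finset.sum_eq_zero fun i _ => ?_))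
  rw [hf, norm_zero, mul_zero]

end Flat

theorem mem_S0_iff {d : ℕ} {f : 𝓢(EuclideanSpace ℝ (Fin d), C4)} : f ∈ S0 d ↔ IsFlat f := Iff.rfl

/-- Taylor's estimate without constants: the mean value inequality on the ball of radius `‖x‖`,
applied to the derivative, gains one power of `‖x‖`. The induction passes to derivatives and is
therefore uniform in `V`. -/
theorem exists_flat_bound {D : Type} [NormedAddCommGroup D] [NormedSpace ℝ D] (N : ℕ) :
    ∀ (V : Type) [NormedAddCommGroup V] [NormedSpace ℝ V] [NormedSpace ℂ V] [SMulCommClass ℝ ℂ V],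
    ∃ Q : Seminorm ℂ 𝓢(D, V), Continuous Q ∧
      ∀ f : 𝓢(D, V), IsFlat f → ∀ x, ‖f x‖ ≤ ‖x‖ ^ N * Q f := by
  induction N with
  | zero =>
    intro V _ _ _ _
    refine ⟨schwartzSeminormFamily ℂ D V 0, (schwartz_withSeminorms ℂ D V).continuous_seminorm _,
      fun f _ x => ?_⟩
    simpa using SchwartzMap.norm_le_seminorm ℂ f x
  | succ N ih =>
    intro V _ _ _ _
    obtain ⟨Q, hQ, h⟩ := ih (D →L[ℝ] V)
    refine ⟨_, continuous_seminorm_comp hQ (SchwartzMap.fderivCLM ℂ D V), fun f hf x => ?_⟩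
    have hb : ∀ y ∈ Metric.closedBall (0 : D) ‖x‖, ‖fderiv ℝ f y‖ ≤
        ‖x‖ ^ N * Q (SchwartzMap.fderivCLM ℂ D V f) := fun y hy => by
      refine (h (SchwartzMap.fderivCLM ℂ D V f) hf.fderiv y).trans ?_
      have := mem_closedBall_zero_iff.1 hy
      have := apply_nonneg Q (SchwartzMap.fderivCLM ℂ D V f)
      gcongr
    have := (convex_closedBall (0 : D) ‖x‖).norm_image_sub_le_of_norm_fderiv_le
      (fun y _ => f.differentiableAt) hb (Metric.mem_closedBall_self (norm_nonneg x))
      (mem_closedBall_zero_iff.2 le_rfl)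
    rw [hf.apply_zero, sub_zero, sub_zero] at this
    refine this.trans (le_of_eq ?_)
    rw [pow_succ]
    change _ = _ * Q (SchwartzMap.fderivCLM ℂ D V f)
    ring

/-- For `‖x‖ ≤ 1` flatness is used, for `‖x‖ ≥ 1` Schwartz decay together with `‖x‖^N ≥ 1`. -/
theorem exists_flat_bound_mul {D V : Type} [NormedAddCommGroup D] [NormedSpace ℝ D]
    [NormedAddCommGroup V] [NormedSpace ℝ V] [NormedSpace ℂ V] [SMulCommClass ℝ ℂ V] (N k : ℕ) :
    ∃ Q : Seminorm ℂ 𝓢(D, V), Continuous Q ∧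
      ∀ f : 𝓢(D, V), IsFlat f → ∀ x, (1 + ‖x‖) ^ k * ‖f x‖ ≤ ‖x‖ ^ N * Q f := by
  obtain ⟨Q, hQ, h⟩ := exists_flat_bound (D := D) N V
  obtain ⟨P, hP, h'⟩ := exists_seminorm_one_add_pow (D := D) (V := V) k 0
  refine ⟨((2 : NNReal) ^ k) • Q + P, (hQ.const_smul _).add hP, fun f hf x => ?_⟩
  have hq := apply_nonneg Q f
  have hp := apply_nonneg P f
  rw [add_apply, smul_apply, NNReal.smul_def, smul_eq_mul, NNReal.coe_pow, NNReal.coe_ofNat,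
    mul_add]
  rcases le_total ‖x‖ 1 with hx | hx
  · have h1 : (1 + ‖x‖) ^ k * ‖f x‖ ≤ 2 ^ k * (‖x‖ ^ N * Q f) := by
      gcongr
      · linarith
      · exact h f hf x
    have : 0 ≤ ‖x‖ ^ N * P f := by positivity
    linarith
  · have h1 := h' f 0 le_rfl x
    rw [norm_iteratedFDeriv_zero] at h1
    have h2 : P f ≤ ‖x‖ ^ N * P f := le_mul_of_one_le_left hp (one_le_pow₀ hx)
    have : 0 ≤ ‖x‖ ^ N * (2 ^ k * Q f) := by positivity
    linarith

/-! ### Mass shells -/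

/-- The inclusion of momentum space into energy-momentum space, with the sign of the Minkowski
product. -/
def spaceIncl : R3 →L[ℝ] R4 :=
  (EuclideanSpace.equiv (Fin 4) ℝ).symm.toContinuousLinearMap ∘L
    ContinuousLinearMap.pi (Fin.cons 0 fun j : Fin 3 => -(EuclideanSpace.proj j : R3 →L[ℝ] ℝ))

@[simp]
theorem spaceIncl_zero (p : R3) : spaceIncl p 0 = 0 := rfl

@[simp]
theorem spaceIncl_succ (p : R3) (j : Fin 3) : spaceIncl p j.succ = -p j := rfl

/-- The unit vector of the time direction. -/
def timeVec : R4 := EuclideanSpace.single 0 1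

/-- The momentum part of an energy-momentum vector, with the sign of the Minkowski product. -/
def spacePart : R4 →L[ℝ] R3 :=
  (EuclideanSpace.equiv (Fin 3) ℝ).symm.toContinuousLinearMap ∘L
    ContinuousLinearMap.pi fun j : Fin 3 => -(EuclideanSpace.proj j.succ : R4 →L[ℝ] ℝ)

@[simp]
theorem spacePart_apply (k : R4) (j : Fin 3) : spacePart k j = -k j.succ := rfl

/-- The covector `x ↦ p · x`, `p` on the mass-`m` orbit. -/
def shellVec (m : ℝ) (p : R3) : R4 := energy m p • timeVec + spaceIncl p

@[simp]
theorem shellVec_zero (m : ℝ) (p : R3) : shellVec m p 0 = energy m p := by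
  simp [shellVec, timeVec]

@[simp]
theorem shellVec_succ (m : ℝ) (p : R3) (j : Fin 3) : shellVec m p j.succ = -p j := by
  simp [shellVec, timeVec]

/-- Putting the signs of the metric into the covector `(E(p), -p)` makes plane waves Euclidean
characters. -/
theorem inner_shellVec (m : ℝ) (p : R3) (x : R4) :
    inner ℝ x (shellVec m p) = minkowskiProd m p x := by
  rw [PiLp.inner_apply, Fin.sum_univ_succ, minkowskiProd]
  simp only [shellVec_zero, shellVec_succ, RCLike.inner_apply, conj_trivial, neg_mul,
    Finset.sum_neg_distrib]
  rw [← sub_eq_add_neg]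

@[simp]
theorem spacePart_shellVec (m : ℝ) (p : R3) : spacePart (shellVec m p) = p := by
  ext j
  simp

theorem norm_spacePart_le (k : R4) : ‖spacePart k‖ ≤ ‖k‖ := by
  rw [← sq_le_sq₀ (norm_nonneg _) (norm_nonneg _), EuclideanSpace.norm_sq_eq,
    EuclideanSpace.norm_sq_eq, Fin.sum_univ_succ (n := 3)]
  simp only [spacePart_apply, norm_neg]
  have := sq_nonneg ‖k 0‖
  linarith

theorem norm_le_norm_shellVec (m : ℝ) (p : R3) : ‖p‖ ≤ ‖shellVec m p‖ := by
  simpa using norm_spacePart_le (shellVec m p)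

theorem energy_zero (p : R3) : energy 0 p = ‖p‖ := by
  simp [energy, Real.sqrt_sq (norm_nonneg p)]

theorem norm_shellVec_sq (m : ℝ) (p : R3) : ‖shellVec m p‖ ^ 2 = 2 * ‖p‖ ^ 2 + m ^ 2 := by
  rw [EuclideanSpace.norm_sq_eq, Fin.sum_univ_succ]
  simp only [shellVec_zero, shellVec_succ, norm_neg]
  rw [← EuclideanSpace.norm_sq_eq, energy, Real.norm_of_nonneg (Real.sqrt_nonneg _),
    Real.sq_sqrt (by positivity)]
  ring

theorem norm_shellVec_le (m : ℝ) (p : R3) : ‖shellVec m p‖ ≤ 2 * ‖p‖ + |m| := by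
  rw [← sq_le_sq₀ (norm_nonneg _) (by positivity), norm_shellVec_sq]
  nlinarith [sq_abs m, norm_nonneg p, abs_nonneg m, mul_nonneg (norm_nonneg p) (abs_nonneg m)]

theorem continuous_energy (m : ℝ) : Continuous (energy m) := by
  unfold energy
  fun_prop

theorem continuous_shellVec (m : ℝ) : Continuous (shellVec m) := by
  unfold shellVec
  exact ((continuous_energy m).smul continuous_const).add spaceIncl.continuous

/-! ### Restriction of flat functions to the light cone -/

section Cone

/-- The functions `p ↦ |p|^a f(c (|p|, -p))`. -/
def coneFun {V : Type} [NormedAddCommGroup V] [NormedSpace ℝ V] (c a : ℝ) (f : R4 → V) (p : R3) :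
    V :=
  ‖p‖ ^ a • f (c • shellVec 0 p)

variable {V : Type} [NormedAddCommGroup V] [NormedSpace ℝ V] [NormedSpace ℂ V]
  [SMulCommClass ℝ ℂ V]

theorem one_add_norm_le_shellVec {c : ℝ} (hc : c ≠ 0) (m : ℝ) (p : R3) :
    1 + ‖p‖ ≤ (1 + |c|⁻¹) * (1 + ‖c • shellVec m p‖) := by
  rw [norm_smul, Real.norm_eq_abs]
  have h0 := norm_le_norm_shellVec m p
  have h1 : 0 < |c| := abs_pos.2 hc
  have h2 : |c|⁻¹ * |c| = 1 := inv_mul_cancel₀ h1.ne'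
  have h3 : 0 < |c|⁻¹ := by positivity
  nlinarith [norm_nonneg p, norm_nonneg (shellVec m p), mul_nonneg h1.le
    (norm_nonneg (shellVec m p))]

/-- Flatness of high order at the tip beats the possibly singular `‖p‖^a` and leaves a spare factor
`‖p‖^2`. That factor gives continuity and differentiability at `p = 0` for every real `a`. -/
theorem exists_coneFun_bound {c : ℝ} (hc : c ≠ 0) (a : ℝ) (k : ℕ) :
    ∃ Q : Seminorm ℂ 𝓢(R4, V), Continuous Q ∧ ∀ f : 𝓢(R4, V), IsFlat f → ∀ p : R3,
      (1 + ‖p‖) ^ k * ‖coneFun c a f p‖ ≤ ‖p‖ ^ 2 * Q f := by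
  -- `N` makes the exponent `a + N - 2` nonnegative, and `K` bounds the growth of that power at
  -- infinity.
  obtain ⟨N, hN⟩ := exists_nat_ge (2 - a)
  obtain ⟨K, hK⟩ := exists_nat_ge (a + N - 2)
  obtain ⟨Q, hQ, h⟩ := exists_flat_bound_mul (D := R4) (V := V) N (k + K)
  set C : ℝ := (1 + |c|⁻¹) ^ (k + K) * (|c| * 2) ^ N with hC
  have hC0 : 0 ≤ C := by positivity
  refine ⟨C.toNNReal • Q, hQ.const_smul _, fun f hf p => ?_⟩
  rw [smul_apply, NNReal.smul_def, Real.coe_toNNReal _ hC0, smul_eq_mul]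
  have hq := apply_nonneg Q f
  rcases (norm_nonneg p).eq_or_lt with h0 | h0
  · have : p = 0 := norm_eq_zero.1 h0.symm
    have h1 : shellVec 0 (0 : R3) = 0 := by simp [shellVec, energy_zero]
    rw [this, coneFun, h1, smul_zero, hf.apply_zero, smul_zero, norm_zero, norm_zero]
    simp
  set θ := c • shellVec 0 p with hθ
  have h1 : ‖p‖ ^ a = ‖p‖ ^ 2 * ‖p‖ ^ (a + N - 2) / ‖p‖ ^ N := by
    rw [eq_div_iff (by positivity), ← Real.rpow_natCast, ← Real.rpow_natCast, ← Real.rpow_add h0,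
      ← Real.rpow_add h0]
    congr 1
    push_cast
    ring
  have h2 : ‖p‖ ^ (a + N - 2) ≤ (1 + ‖p‖) ^ K := by
    rw [← Real.rpow_natCast]
    exact (Real.rpow_le_rpow h0.le (by linarith) (by linarith)).trans
      (Real.rpow_le_rpow_of_exponent_le (by linarith) hK)
  have h3 : ‖θ‖ ≤ |c| * 2 * ‖p‖ := by
    rw [hθ, norm_smul, Real.norm_eq_abs, mul_assoc]
    have := norm_shellVec_le 0 p
    rw [abs_zero, add_zero] at this
    gcongr
  have h4 := one_add_norm_le_shellVec hc 0 p
  rw [← hθ] at h4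
  rw [coneFun, norm_smul, Real.norm_of_nonneg (by positivity), h1, ← hθ]
  calc (1 + ‖p‖) ^ k * (‖p‖ ^ 2 * ‖p‖ ^ (a + N - 2) / ‖p‖ ^ N * ‖f θ‖)
      ≤ (1 + ‖p‖) ^ k * (‖p‖ ^ 2 * (1 + ‖p‖) ^ K / ‖p‖ ^ N * ‖f θ‖) := by gcongr
    _ = ‖p‖ ^ 2 / ‖p‖ ^ N * ((1 + ‖p‖) ^ (k + K) * ‖f θ‖) := by rw [pow_add]; ring
    _ ≤ ‖p‖ ^ 2 / ‖p‖ ^ N * (((1 + |c|⁻¹) * (1 + ‖θ‖)) ^ (k + K) * ‖f θ‖) := by gcongr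
    _ = ‖p‖ ^ 2 / ‖p‖ ^ N * ((1 + |c|⁻¹) ^ (k + K) * ((1 + ‖θ‖) ^ (k + K) * ‖f θ‖)) := by
        rw [mul_pow]; ring
    _ ≤ ‖p‖ ^ 2 / ‖p‖ ^ N * ((1 + |c|⁻¹) ^ (k + K) * ((|c| * 2 * ‖p‖) ^ N * Q f)) := by
        refine mul_le_mul_of_nonneg_left (mul_le_mul_of_nonneg_left ((h f hf θ).trans ?_)
          (by positivity)) (by positivity)
        gcongr
    _ = ‖p‖ ^ 2 * (C * Q f) := by
        rw [hC, mul_pow (|c| * 2)]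
        field_simp

/-- Multiplication by the covector-valued function `k ↦ ⟨spacePart k, ·⟩`. -/
def momentumMul : 𝓢(R4, V) →L[ℂ] 𝓢(R4, R3 →L[ℝ] V) :=
  SchwartzMap.smulRightCLM ℂ V ((innerSL ℝ : R3 →L[ℝ] R3 →L[ℝ] ℝ) ∘L spacePart)

theorem momentumMul_apply (f : 𝓢(R4, V)) (k : R4) :
    momentumMul f k = (innerSL ℝ (spacePart k)).smulRight (f k) := rfl

theorem IsFlat.momentumMul {f : 𝓢(R4, V)} (hf : IsFlat f) : IsFlat (momentumMul f) :=
  hf.bilin (f.smooth ⊤) (ContinuousLinearMap.smulRightL ℝ R3 V)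
    ((innerSL ℝ : R3 →L[ℝ] R3 →L[ℝ] ℝ) ∘L spacePart).contDiff

end Cone


/-! ### Smoothness of the restriction of flat functions to the light cone -/

section Cone

theorem hasFDerivAt_norm_rpow_of_ne {D : Type*} [NormedAddCommGroup D] [InnerProductSpace ℝ D]
    (a : ℝ) {p : D} (hp : p ≠ 0) :
    HasFDerivAt (fun p : D => ‖p‖ ^ a) ((a * ‖p‖ ^ (a - 2)) • innerSL ℝ p) p := by
  have h0 : 0 < ‖p‖ := norm_pos_iff.2 hp
  have h := (hasStrictFDerivAt_norm_sq p).hasFDerivAt.rpow_const (p := a / 2)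
    (Or.inl (by positivity))
  have e : (fun q : D => (‖q‖ ^ 2) ^ (a / 2)) = fun q => ‖q‖ ^ a := by
    funext q
    rw [← Real.rpow_natCast, ← Real.rpow_mul (norm_nonneg q)]
    congr 1
    push_cast
    ring
  rw [e] at h
  convert h using 1
  rw [← Real.rpow_natCast, ← Real.rpow_mul h0.le,
    show ((2 : ℕ) : ℝ) * (a / 2 - 1) = a - 2 by push_cast; ring,
    two_nsmul, ← two_smul ℝ, smul_smul]
  congr 1
  ring

variable {V : Type} [NormedAddCommGroup V] [NormedSpace ℝ V] [NormedSpace ℂ V]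
  [SMulCommClass ℝ ℂ V]

/-- The terms of the derivative of `coneFun c a f`. -/
def coneTimeDeriv : 𝓢(R4, V) →L[ℂ] 𝓢(R4, R3 →L[ℝ] V) :=
  momentumMul ∘L LineDeriv.lineDerivOpCLM ℂ 𝓢(R4, V) timeVec

theorem coneTimeDeriv_apply (f : 𝓢(R4, V)) (k : R4) :
    coneTimeDeriv f k = (innerSL ℝ (spacePart k)).smulRight (fderiv ℝ f k timeVec) := rfl

theorem IsFlat.coneTimeDeriv {f : 𝓢(R4, V)} (hf : IsFlat f) : IsFlat (coneTimeDeriv f) := by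
  refine IsFlat.momentumMul (f := LineDeriv.lineDerivOpCLM ℂ 𝓢(R4, V) timeVec f) ?_
  exact hf.fderiv.clm_comp ((SchwartzMap.fderivCLM ℂ R4 V f).smooth ⊤)
    (ContinuousLinearMap.apply ℝ V timeVec)

/-- The derivative in the directions of momentum space. -/
def coneSpaceDeriv (c : ℝ) : 𝓢(R4, V) →L[ℂ] 𝓢(R4, R3 →L[ℝ] V) :=
  SchwartzMap.postcompCLM (compRightCLM V (c • spaceIncl)) ∘L SchwartzMap.fderivCLM ℂ R4 V

theorem coneSpaceDeriv_apply (c : ℝ) (f : 𝓢(R4, V)) (k : R4) :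
    coneSpaceDeriv c f k = (fderiv ℝ f k).comp (c • spaceIncl) := rfl

theorem IsFlat.coneSpaceDeriv (c : ℝ) {f : 𝓢(R4, V)} (hf : IsFlat f) :
    IsFlat (coneSpaceDeriv c f) :=
  hf.fderiv.clm_comp ((SchwartzMap.fderivCLM ℂ R4 V f).smooth ⊤)
    ((ContinuousLinearMap.compL ℝ R3 R4 V).flip (c • spaceIncl))

theorem coneFun_zero {V : Type} [NormedAddCommGroup V] [NormedSpace ℝ V] (c a : ℝ) {f : R4 → V} (hf : IsFlat f) : coneFun c a f 0 = 0 := by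
  have h1 : shellVec 0 (0 : R3) = 0 := by simp [shellVec, energy_zero]
  rw [coneFun, h1, smul_zero, hf.apply_zero, smul_zero]

/-- The derivative of `coneFun c a f`. -/
def coneFDeriv (c a : ℝ) (f : 𝓢(R4, V)) (p : R3) : R3 →L[ℝ] V :=
  (a / c) • coneFun c (a - 2) (momentumMul f) p + coneFun c (a - 1) (coneTimeDeriv f) p +
    coneFun c a (coneSpaceDeriv c f) p

/-- Differentiating the power, the time argument and the space argument produces cone functions of
flat Schwartz functions with exponents `a - 2`, `a - 1` and `a`, so the class is closed under
differentiation. The quotient `a / c` compensates that the space part of `c • shellVec 0 p` is `c •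
p`. -/
theorem hasFDerivAt_coneFun {c : ℝ} (hc : c ≠ 0) (a : ℝ) {f : 𝓢(R4, V)} (hf : IsFlat f) (p : R3) :
    HasFDerivAt (coneFun c a f) (coneFDeriv c a f p) p := by
  rcases eq_or_ne p 0 with rfl | hp
  -- At the tip `‖p‖` is not differentiable, but the function is `O(‖p‖^2)`, so its derivative is
  -- zero, and the formula gives zero as well.
  · rw [coneFDeriv, coneFun_zero _ _ hf.momentumMul, coneFun_zero _ _ hf.coneTimeDeriv,
      coneFun_zero _ _ (hf.coneSpaceDeriv c), smul_zero, add_zero, add_zero]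
    obtain ⟨Q, -, h⟩ := exists_coneFun_bound (V := V) hc a 0
    refine Asymptotics.IsBigO.hasFDerivAt (n := 2) ?_ one_lt_two
    refine Asymptotics.IsBigO.of_bound (Q f) (.of_forall fun p => ?_)
    have := h f hf p
    rw [pow_zero, one_mul] at this
    rw [sub_zero, norm_pow, norm_norm, mul_comm]
    exact this
  · have h0 : 0 < ‖p‖ := norm_pos_iff.2 hp
    have hn : HasFDerivAt (fun p : R3 => energy 0 p) (‖p‖⁻¹ • innerSL ℝ p) p := by
      have := hasFDerivAt_norm_rpow_of_ne 1 hp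
      simp only [Real.rpow_one, one_mul] at this
      rw [show (1 : ℝ) - 2 = -1 by norm_num, Real.rpow_neg_one] at this
      simpa only [energy_zero] using this
    have hs : HasFDerivAt (fun p => c • shellVec 0 p)
        (c • ((‖p‖⁻¹ • innerSL ℝ p).smulRight timeVec + spaceIncl)) p :=
      ((hn.smul_const timeVec).add spaceIncl.hasFDerivAt).const_smul c
    have h := (hasFDerivAt_norm_rpow_of_ne a hp).smul
      ((f.hasFDerivAt (c • shellVec 0 p)).comp p hs)
    refine h.congr_fderiv ?_
    ext v
    have h1 : ‖p‖ ^ (a - 1) = ‖p‖ ^ a * ‖p‖⁻¹ := by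
      rw [Real.rpow_sub h0, Real.rpow_one, div_eq_mul_inv]
    simp only [coneFDeriv, coneFun, momentumMul_apply, coneTimeDeriv_apply, coneSpaceDeriv_apply,
      map_smul, spacePart_shellVec, h1, add_apply, smul_apply, ContinuousLinearMap.comp_apply,
      ContinuousLinearMap.smulRight_apply, map_add, smul_add, smul_smul, Function.comp_apply,
      smul_eq_mul]
    rw [show a / c * ‖p‖ ^ (a - 2) * (c * (innerSL ℝ p) v) = a * ‖p‖ ^ (a - 2) * (innerSL ℝ p) v by
        field_simp,
      show ‖p‖ ^ a * (c * (‖p‖⁻¹ * (innerSL ℝ p) v)) = ‖p‖ ^ a * ‖p‖⁻¹ * (c * (innerSL ℝ p) v) by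
        ring]
    abel

/-- The derivative has other exponents and other values, so the induction on `n` is uniform in both
`a` and `V`. -/
theorem exists_coneFun_iteratedFDeriv_bound {c : ℝ} (hc : c ≠ 0) (n : ℕ) :
    ∀ (V : Type) [NormedAddCommGroup V] [NormedSpace ℝ V] [NormedSpace ℂ V] [SMulCommClass ℝ ℂ V]
      (a : ℝ) (k : ℕ), ∃ Q : Seminorm ℂ 𝓢(R4, V), Continuous Q ∧ ∀ f : 𝓢(R4, V), IsFlat f →
      ContDiff ℝ n (coneFun c a f) ∧ iteratedFDeriv ℝ n (coneFun c a f) 0 = 0 ∧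
      ∀ p, (1 + ‖p‖) ^ k * ‖iteratedFDeriv ℝ n (coneFun c a f) p‖ ≤ Q f := by
  induction n with
  | zero =>
    intro V _ _ _ _ a k
    -- Two extra weights absorb the factor `‖p‖^2` of the bound at infinity.
    obtain ⟨Q, hQ, h⟩ := exists_coneFun_bound (V := V) hc a (k + 2)
    refine ⟨Q, hQ, fun f hf => ⟨?_, ?_, fun p => ?_⟩⟩
    · simp only [Nat.cast_zero, contDiff_zero]
      exact continuous_iff_continuousAt.2 fun p => (hasFDerivAt_coneFun hc a hf p).continuousAt
    · rw [← norm_eq_zero, norm_iteratedFDeriv_zero, coneFun_zero c a hf, norm_zero]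
    · rw [norm_iteratedFDeriv_zero]
      have h1 := h f hf p
      have h2 : ‖p‖ ^ 2 ≤ (1 + ‖p‖) ^ 2 := by gcongr; linarith
      have h3 := h1.trans (mul_le_mul_of_nonneg_right h2 (apply_nonneg Q f))
      rw [pow_add, mul_assoc, mul_left_comm] at h3
      exact le_of_mul_le_mul_left h3 (by positivity)
  | succ n ih =>
    intro V _ _ _ _ a k
    obtain ⟨Q1, hQ1, h1⟩ := ih (R3 →L[ℝ] V) (a - 2) k
    obtain ⟨Q2, hQ2, h2⟩ := ih (R3 →L[ℝ] V) (a - 1) k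
    obtain ⟨Q3, hQ3, h3⟩ := ih (R3 →L[ℝ] V) a k
    refine ⟨‖a / c‖.toNNReal • Q1.comp momentumMul.toLinearMap + Q2.comp coneTimeDeriv.toLinearMap
      + Q3.comp (coneSpaceDeriv c).toLinearMap,
      (((continuous_seminorm_comp hQ1 momentumMul).const_smul _).add
        (continuous_seminorm_comp hQ2 coneTimeDeriv)).add
        (continuous_seminorm_comp hQ3 (coneSpaceDeriv c)), fun f hf => ?_⟩
    obtain ⟨d1, z1, b1⟩ := h1 _ hf.momentumMul
    obtain ⟨d2, z2, b2⟩ := h2 _ hf.coneTimeDeriv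
    obtain ⟨d3, z3, b3⟩ := h3 _ (hf.coneSpaceDeriv c)
    have d1' : ContDiff ℝ n ((a / c) • coneFun c (a - 2) (momentumMul f)) := d1.const_smul (a / c)
    have d12 : ContDiff ℝ n ((a / c) • coneFun c (a - 2) (momentumMul f) +
        coneFun c (a - 1) (coneTimeDeriv f)) := d1'.add d2
    have hd : fderiv ℝ (coneFun c a f) = (a / c) • coneFun c (a - 2) (momentumMul f) +
        coneFun c (a - 1) (coneTimeDeriv f) + coneFun c a (coneSpaceDeriv c f) :=
      funext fun p => (hasFDerivAt_coneFun hc a hf p).fderiv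
    have hi : ∀ p, iteratedFDeriv ℝ n (fderiv ℝ (coneFun c a f)) p =
        (a / c) • iteratedFDeriv ℝ n (coneFun c (a - 2) (momentumMul f)) p +
        iteratedFDeriv ℝ n (coneFun c (a - 1) (coneTimeDeriv f)) p +
        iteratedFDeriv ℝ n (coneFun c a (coneSpaceDeriv c f)) p := fun p => by
      rw [hd, iteratedFDeriv_add_apply d12.contDiffAt d3.contDiffAt,
        iteratedFDeriv_add_apply d1'.contDiffAt d2.contDiffAt,
        iteratedFDeriv_const_smul_apply d1.contDiffAt]
    refine ⟨?_, ?_, fun p => ?_⟩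
    · rw [Nat.cast_add, Nat.cast_one, contDiff_succ_iff_fderiv, hd]
      exact ⟨fun p => (hasFDerivAt_coneFun hc a hf p).differentiableAt, by simp,
        d12.add d3⟩
    · rw [← norm_eq_zero, ← norm_iteratedFDeriv_fderiv, hi, z1, z2, z3]
      simp
    · rw [← norm_iteratedFDeriv_fderiv, hi]
      have t := (norm_add₃_le (a := (a / c) •
        iteratedFDeriv ℝ n (coneFun c (a - 2) (momentumMul f)) p)
        (b := iteratedFDeriv ℝ n (coneFun c (a - 1) (coneTimeDeriv f)) p)
        (c := iteratedFDeriv ℝ n (coneFun c a (coneSpaceDeriv c f)) p))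
      rw [norm_smul] at t
      have e : (‖a / c‖.toNNReal • Q1.comp momentumMul.toLinearMap +
          Q2.comp coneTimeDeriv.toLinearMap + Q3.comp (coneSpaceDeriv c).toLinearMap) f =
          ‖a / c‖ * Q1 (momentumMul f) + Q2 (coneTimeDeriv f) + Q3 (coneSpaceDeriv c f) := by
        rw [add_apply, add_apply, smul_apply, NNReal.smul_def, Real.coe_toNNReal _ (norm_nonneg _)]
        rfl
      rw [e]
      refine (mul_le_mul_of_nonneg_left t (by positivity)).trans ?_
      rw [mul_add, mul_add, mul_left_comm]
      exact add_le_add (add_le_add (mul_le_mul_of_nonneg_left (b1 p) (norm_nonneg _)) (b2 p)) (b3 p)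

theorem isFlat_coneFun {c : ℝ} (hc : c ≠ 0) (a : ℝ) {f : 𝓢(R4, V)} (hf : IsFlat f) :
    IsFlat (coneFun c a f) := fun n => by
  obtain ⟨Q, -, h⟩ := exists_coneFun_iteratedFDeriv_bound hc n V a 0
  exact (h f hf).2.1

/-- The restriction of flat Schwartz functions to the light cone, multiplied by `|p|^a`. -/
def coneCLM {c : ℝ} (hc : c ≠ 0) (a : ℝ) : S0 4 →L[ℂ] 𝓢(R3, C4) :=
  schwartzCLM
    { toFun f := coneFun c a (f : 𝓢(R4, C4))
      map_add' f g := funext fun p => smul_add _ _ _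
      map_smul' z f := funext fun p => smul_comm _ z _ }
    (fun f => contDiff_infty.2 fun n => by
      obtain ⟨Q, -, h⟩ := exists_coneFun_iteratedFDeriv_bound hc n C4 a 0
      exact (h f f.2).1)
    fun k n => by
      obtain ⟨Q, hQ, h⟩ := exists_coneFun_iteratedFDeriv_bound hc n C4 a k
      refine ⟨_, continuous_seminorm_comp hQ (S0 4).subtypeL, fun f p => ?_⟩
      refine le_trans ?_ ((h f f.2).2.2 p)
      refine mul_le_mul_of_nonneg_right (pow_le_pow_left₀ (norm_nonneg p) ?_ k) (norm_nonneg _)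
      linarith

theorem coneCLM_apply {c : ℝ} (hc : c ≠ 0) (a : ℝ) (f : S0 4) (p : R3) :
    coneCLM hc a f p = ‖p‖ ^ a • (f : 𝓢(R4, C4)) (c • shellVec 0 p) := rfl

theorem coneCLM_mem_S0 {c : ℝ} (hc : c ≠ 0) (a : ℝ) (f : S0 4) : coneCLM hc a f ∈ S0 3 :=
  isFlat_coneFun hc a f.2

end Cone

/-! ### Plane-wave kernels -/

/-- The kernels `A(p)_{sa} exp(-i σ p·x)`, `p` on the mass-`m` orbit. -/
def planeKernel (A : R3 → Fin 4 → Fin 4 → ℂ) (σ m : ℝ) : PlaneKernel := fun s p a x =>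
  A p s a * Complex.exp (-(Complex.I * ((σ * minkowskiProd m p x : ℝ) : ℂ)))

/-- The coefficients of the electromagnetic potential. -/
def potentialCoeff (p : R3) (ν μ : Fin 4) : ℂ :=
  ((metric ν μ / (normConst * √(2 * energy 0 p)) : ℝ) : ℂ)

/-- The coefficients of `κ_{0,1}` of the Dirac field. -/
def diracCoeff01 (m : ℝ) (p : R3) (s a : Fin 4) : ℂ :=
  (![uSpinor m 0 p a, uSpinor m 1 p a, 0, 0] s) / (normConst : ℂ)

/-- The coefficients of `κ_{1,0}` of the Dirac field. -/
def diracCoeff10 (m : ℝ) (p : R3) (s a : Fin 4) : ℂ :=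
  (![0, 0, vSpinor m 0 p a, vSpinor m 1 p a] s) / (normConst : ℂ)

theorem potential01_eq : potential01 = planeKernel potentialCoeff 1 0 := by
  funext s p a x
  simp [potential01, planeKernel, potentialCoeff]

theorem potential10_eq : potential10 = planeKernel potentialCoeff (-1) 0 := by
  funext s p a x
  simp [potential10, planeKernel, potentialCoeff]

theorem dirac01_eq (m : ℝ) : dirac01 m = planeKernel (diracCoeff01 m) 1 m := by
  funext s p a x
  simp [dirac01, planeKernel, diracCoeff01]

theorem dirac10_eq (m : ℝ) : dirac10 m = planeKernel (diracCoeff10 m) (-1) m := by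
  funext s p a x
  simp [dirac10, planeKernel, diracCoeff10]

theorem exp_minkowskiProd (σ m : ℝ) (p : R3) (x : R4) :
    Complex.exp (-(Complex.I * ((σ * minkowskiProd m p x : ℝ) : ℂ))) =
      Complex.exp ((-2 * Real.pi * inner ℝ x ((σ / (2 * Real.pi)) • shellVec m p) : ℝ) *
        Complex.I) := by
  congr 1
  have : -2 * Real.pi * inner ℝ x ((σ / (2 * Real.pi)) • shellVec m p) =
      -(σ * minkowskiProd m p x) := by
    rw [inner_smul_right, inner_shellVec]
    field_simp
  rw [this]
  push_cast
  ring

/-- The Fourier character is `exp(-2πi⟨x, w⟩)`, whence the factor `1/(2π)` in the point of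
evaluation. -/
theorem integral_planeWave (σ m : ℝ) (φ : 𝓢(R4, C4)) (p : R3) (a : Fin 4) :
    ∫ x : R4, Complex.exp (-(Complex.I * ((σ * minkowskiProd m p x : ℝ) : ℂ))) * φ x a =
      (𝓕 φ) ((σ / (2 * Real.pi)) • shellVec m p) a := by
  set w := (σ / (2 * Real.pi)) • shellVec m p with hw
  have h1 : (𝓕 φ) w = ∫ x : R4, Complex.exp (-(Complex.I * ((σ * minkowskiProd m p x : ℝ) : ℂ))) •
      φ x := by
    rw [SchwartzMap.fourier_coe, Real.fourier_eq']
    simp_rw [exp_minkowskiProd, hw]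
  have hi : Integrable fun x : R4 =>
      Complex.exp (-(Complex.I * ((σ * minkowskiProd m p x : ℝ) : ℂ))) • φ x := by
    simp_rw [exp_minkowskiProd]
    have hc : Continuous fun x : R4 => Complex.exp
        ((-2 * Real.pi * inner ℝ x ((σ / (2 * Real.pi)) • shellVec m p) : ℝ) * Complex.I) := by
      fun_prop
    refine φ.integrable.bdd_smul 1 hc.aestronglyMeasurable (.of_forall fun x => ?_)
    rw [Complex.norm_exp_ofReal_mul_I]
  rw [h1]
  have := (EuclideanSpace.proj a : C4 →L[ℂ] ℂ).integral_comp_comm hi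
  simp only [PiLp.proj_apply] at this
  rw [← this]
  simp

theorem smear_planeKernel (A : R3 → Fin 4 → Fin 4 → ℂ) (σ m : ℝ) (φ : 𝓢(R4, C4)) (s : Fin 4)
    (p : R3) : smear (planeKernel A σ m) φ s p =
      ∑ a : Fin 4, A p s a * (𝓕 φ) ((σ / (2 * Real.pi)) • shellVec m p) a := by
  simp only [smear, planeKernel, mul_assoc]
  refine Finset.sum_congr rfl fun a _ => ?_
  rw [integral_const_mul, integral_planeWave]

/-! ### The electromagnetic potential on `S⁰⁰` -/

/-- The Fourier transform from `S⁰⁰` to `S⁰`. -/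
def fourierS00 (d : ℕ) : S00 d →L[ℂ] S0 d :=
  ((SchwartzMap.fourierTransformCLM ℂ) ∘L (S00 d).subtypeL).codRestrict (S0 d) fun φ => φ.2

theorem fourierS00_apply {d : ℕ} (φ : S00 d) :
    (fourierS00 d φ : 𝓢(EuclideanSpace ℝ (Fin d), C4)) = 𝓕 (φ : 𝓢(EuclideanSpace ℝ (Fin d), C4)) :=
  rfl

theorem normConst_pos : 0 < normConst := by
  unfold normConst
  positivity

/-- Separates the singularity at the tip of the cone from a constant matrix, so that `κ(φ)` is a
cone function with exponent `-1/2`. -/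
theorem potentialCoeff_eq (p : R3) (ν μ : Fin 4) :
    potentialCoeff p ν μ = ((metric ν μ / (normConst * √2) : ℝ) : ℂ) *
      ((‖p‖ ^ (-(1 / 2) : ℝ) : ℝ) : ℂ) := by
  rw [potentialCoeff, ← Complex.ofReal_mul, energy_zero, Real.rpow_neg (norm_nonneg p),
    ← Real.sqrt_eq_rpow, Real.sqrt_mul zero_le_two, ← mul_assoc, div_mul_eq_div_div,
    ← div_eq_mul_inv]

/-- The constant matrix of the coefficients of the electromagnetic potential. -/
def potentialMatrix : C4 →L[ℂ] C4 :=
  Matrix.toEuclideanCLM (𝕜 := ℂ) (Matrix.of fun ν μ => ((metric ν μ / (normConst * √2) : ℝ) : ℂ))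

theorem potentialMatrix_apply (v : C4) (ν : Fin 4) :
    potentialMatrix v ν = ∑ μ : Fin 4, ((metric ν μ / (normConst * √2) : ℝ) : ℂ) * v μ := by
  rw [potentialMatrix, Matrix.ofLp_toEuclideanCLM]
  rfl

theorem div_two_pi_ne_zero {σ : ℝ} (hσ : σ ≠ 0) : σ / (2 * Real.pi) ≠ 0 :=
  div_ne_zero hσ (by positivity)

/-- The map `φ ↦ κ(φ)` for the electromagnetic potential, on `S⁰⁰`. -/
def potentialCLM {σ : ℝ} (hσ : σ ≠ 0) : S00 4 →L[ℂ] 𝓢(R3, C4) :=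
  SchwartzMap.postcompCLM potentialMatrix ∘L coneCLM (div_two_pi_ne_zero hσ) (-(1 / 2)) ∘L
    fourierS00 4

theorem potentialCLM_apply {σ : ℝ} (hσ : σ ≠ 0) (φ : S00 4) (p : R3) (s : Fin 4) :
    potentialCLM hσ φ p s =
      smear (planeKernel potentialCoeff σ 0) (φ : 𝓢(R4, C4)) s p := by
  rw [smear_planeKernel]
  change potentialMatrix (coneCLM (div_two_pi_ne_zero hσ) _ (fourierS00 4 φ) p) s = _
  rw [potentialMatrix_apply, coneCLM_apply, fourierS00_apply]
  refine Finset.sum_congr rfl fun a _ => ?_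
  rw [potentialCoeff_eq, PiLp.smul_apply, Complex.real_smul, mul_assoc]

theorem potentialCLM_mem_S0 {σ : ℝ} (hσ : σ ≠ 0) (φ : S00 4) : potentialCLM hσ φ ∈ S0 3 := by
  have h := coneCLM_mem_S0 (div_two_pi_ne_zero hσ) (-(1 / 2)) (fourierS00 4 φ)
  exact IsFlat.clm_comp h ((coneCLM _ _ (fourierS00 4 φ)).smooth ⊤)
    (potentialMatrix.restrictScalars ℝ)

theorem kernelEverywhere_potential_S0 {σ : ℝ} (hσ : σ ≠ 0) :
    KernelEverywhere (planeKernel potentialCoeff σ 0) (S0 3) (S00 4) :=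
  ⟨(potentialCLM hσ).codRestrict (S0 3) (potentialCLM_mem_S0 hσ),
    fun φ s p => potentialCLM_apply hσ φ p s⟩

theorem kernelEverywhere_potential_top {σ : ℝ} (hσ : σ ≠ 0) :
    KernelEverywhere (planeKernel potentialCoeff σ 0) ⊤ (S00 4) :=
  ⟨(potentialCLM hσ).codRestrict ⊤ fun _ => Submodule.mem_top,
    fun φ s p => potentialCLM_apply hσ φ p s⟩

/-! ### Massive fields -/

/-- On a compact interval all derivatives of `g` are bounded. The square roots and inverses in the
spinors are smooth functions of `m / E(p)`, which stays in the interval, and so inherit temperate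
growth. -/
theorem hasTemperateGrowth_comp_unitInterval {D : Type*} [NormedAddCommGroup D] [NormedSpace ℝ D]
    {g : ℝ → ℝ} (hg : ContDiffOn ℝ ∞ g (Set.Icc 0 1)) {X : D → ℝ} (hX : X.HasTemperateGrowth)
    (h01 : ∀ x, X x ∈ Set.Icc (0 : ℝ) 1) : (fun x => g (X x)).HasTemperateGrowth := by
  have hu : UniqueDiffOn ℝ (Set.Icc (0 : ℝ) 1) := uniqueDiffOn_Icc_zero_one
  refine Function.HasTemperateGrowth.comp' (g := g) (t := Set.Icc 0 1) (Set.range_subset_iff.2 h01)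
    hu hg (fun N => ?_) hX
  have : ∀ n : ℕ, ∃ C, ∀ x ∈ Set.Icc (0 : ℝ) 1,
      ‖iteratedFDerivWithin ℝ n g (Set.Icc 0 1) x‖ ≤ C := fun n =>
    isCompact_Icc.exists_bound_of_continuousOn
      (hg.continuousOn_iteratedFDerivWithin (by exact_mod_cast le_top) hu)
  choose C hC using this
  refine ⟨0, ∑ n ∈ Finset.range (N + 1), |C n|, Finset.sum_nonneg fun _ _ => abs_nonneg _,
    fun n hn x hx => ?_⟩
  rw [pow_zero, mul_one]
  exact ((hC n x hx).trans (le_abs_self _)).trans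
    (Finset.single_le_sum (f := fun n => |C n|) (fun _ _ => abs_nonneg _)
      (Finset.mem_range.2 (by omega)))

section Massive

variable {m : ℝ}

theorem energy_eq_rpow (hm : 0 < m) (p : R3) :
    energy m p = m * (1 + ‖m⁻¹ • p‖ ^ 2) ^ (1 / 2 : ℝ) := by
  rw [← Real.sqrt_eq_rpow, energy, norm_smul, norm_inv, Real.norm_of_nonneg hm.le]
  have : ‖p‖ ^ 2 + m ^ 2 = m ^ 2 * (1 + (m⁻¹ * ‖p‖) ^ 2) := by
    field_simp
    ring
  rw [this, Real.sqrt_mul (by positivity), Real.sqrt_sq hm.le]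

theorem hasTemperateGrowth_scaled_rpow (m r : ℝ) :
    (fun p : R3 => (1 + ‖m⁻¹ • p‖ ^ 2) ^ r).HasTemperateGrowth :=
  (Function.hasTemperateGrowth_one_add_norm_sq_rpow (H := R3) r).comp
    (m⁻¹ • ContinuousLinearMap.id ℝ R3).hasTemperateGrowth

theorem hasTemperateGrowth_energy (hm : 0 < m) : (energy m).HasTemperateGrowth := by
  rw [show energy m = _ from funext (energy_eq_rpow hm)]
  exact (Function.HasTemperateGrowth.const m).mul (hasTemperateGrowth_scaled_rpow m _)

theorem hasTemperateGrowth_shellVec (hm : 0 < m) (c : ℝ) :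
    (fun p => c • shellVec m p).HasTemperateGrowth := by
  refine (Function.HasTemperateGrowth.const c).smul (Function.HasTemperateGrowth.add ?_ ?_)
  · exact (hasTemperateGrowth_energy hm).smul (.const timeVec)
  · exact spaceIncl.hasTemperateGrowth

/-- The restriction of Schwartz functions to a mass shell. -/
def shellCLM (hm : 0 < m) {c : ℝ} (hc : c ≠ 0) : 𝓢(R4, C4) →L[ℂ] 𝓢(R3, C4) :=
  SchwartzMap.compCLM ℂ (hasTemperateGrowth_shellVec hm c) ⟨1, 1 + |c|⁻¹, fun p => by
    rw [pow_one]
    have := one_add_norm_le_shellVec hc m p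
    linarith⟩

/-- The ratio `m / E(p)`. -/
def massRatio (m : ℝ) (p : R3) : ℝ := m / energy m p

theorem energy_pos (hm : 0 < m) (p : R3) : 0 < energy m p := by
  unfold energy
  positivity

theorem mass_le_energy (m : ℝ) (p : R3) : m ≤ energy m p :=
  Real.le_sqrt_of_sq_le (by nlinarith [sq_nonneg ‖p‖])

theorem massRatio_mem (hm : 0 < m) (p : R3) : massRatio m p ∈ Set.Icc (0 : ℝ) 1 :=
  ⟨(div_pos hm (energy_pos hm p)).le, (div_le_one (energy_pos hm p)).2 (mass_le_energy m p)⟩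

theorem hasTemperateGrowth_massRatio (hm : 0 < m) : (massRatio m).HasTemperateGrowth := by
  have : massRatio m = fun p => (1 + ‖m⁻¹ • p‖ ^ 2) ^ (-(1 / 2) : ℝ) := by
    funext p
    rw [massRatio, energy_eq_rpow hm, Real.rpow_neg (by positivity)]
    field_simp
  rw [this]
  exact hasTemperateGrowth_scaled_rpow m _

theorem hasTemperateGrowth_spinorNorm (hm : 0 < m) : (spinorNorm m).HasTemperateGrowth := by
  have : spinorNorm m = fun p => (fun x : ℝ => 1 / √2 * √((1 + x) / 2)) (massRatio m p) := by
    funext p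
    have := (energy_pos hm p).ne'
    simp only [spinorNorm, massRatio]
    congr 2
    field_simp
  rw [this]
  refine hasTemperateGrowth_comp_unitInterval (g := fun x : ℝ => 1 / √2 * √((1 + x) / 2))
    (contDiffOn_const.mul (ContDiffOn.sqrt ?_ ?_)) (hasTemperateGrowth_massRatio hm) (massRatio_mem hm)
  · exact ContDiff.contDiffOn (by fun_prop)
  · rintro x ⟨h0, -⟩
    positivity

theorem hasTemperateGrowth_energy_add_inv (hm : 0 < m) :
    (fun p => (energy m p + m)⁻¹).HasTemperateGrowth := by
  have : (fun p => (energy m p + m)⁻¹) =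
      fun p => (fun x : ℝ => m⁻¹ * (x * (1 + x)⁻¹)) (massRatio m p) := by
    funext p
    have := energy_pos hm p
    simp only [massRatio]
    field_simp
  rw [this]
  refine hasTemperateGrowth_comp_unitInterval (contDiffOn_const.mul (contDiffOn_id.mul
    (ContDiffOn.inv ?_ ?_))) (hasTemperateGrowth_massRatio hm) (massRatio_mem hm)
  · exact ContDiff.contDiffOn (by fun_prop)
  · rintro x ⟨h0, -⟩
    positivity

/-! ### Temperate growth of the spinor coefficients and the massive kernels. -/

theorem boostSpinor_apply (m : ℝ) (s : Fin 2) (p : R3) (i : Fin 2) :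
    boostSpinor m s p i = (((energy m p + m)⁻¹ : ℝ) : ℂ) * ∑ j : Fin 3, (p j : ℂ) * pauli j i s := by
  rw [boostSpinor, Pi.smul_apply, smul_eq_mul, Matrix.mulVec_single_one, Matrix.col_apply,
    Matrix.sum_apply]
  rfl

theorem hasTemperateGrowth_ofReal_comp {D : Type*} [NormedAddCommGroup D] [NormedSpace ℝ D]
    {f : D → ℝ} (hf : f.HasTemperateGrowth) : (fun x => (f x : ℂ)).HasTemperateGrowth :=
  Complex.ofRealCLM.hasTemperateGrowth.comp hf

theorem hasTemperateGrowth_boostSpinor (hm : 0 < m) (s i : Fin 2) :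
    (fun p => boostSpinor m s p i).HasTemperateGrowth := by
  simp only [boostSpinor_apply]
  refine (hasTemperateGrowth_ofReal_comp (hasTemperateGrowth_energy_add_inv hm)).mul
    (Function.HasTemperateGrowth.sum fun j _ => ?_)
  exact (hasTemperateGrowth_ofReal_comp
    (EuclideanSpace.proj j : R3 →L[ℝ] ℝ).hasTemperateGrowth).mul (.const _)

theorem hasTemperateGrowth_uSpinor (hm : 0 < m) (s : Fin 2) (a : Fin 4) :
    (fun p => uSpinor m s p a).HasTemperateGrowth := by
  have hn := hasTemperateGrowth_ofReal_comp (hasTemperateGrowth_spinorNorm hm)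
  have hb := hasTemperateGrowth_boostSpinor hm s
  have hc : ∀ z : ℂ, (fun _ : R3 => z).HasTemperateGrowth := .const
  fin_cases a
  · exact hn.mul ((hc _).add (hb 0))
  · exact hn.mul ((hc _).add (hb 1))
  · exact hn.mul ((hc _).sub (hb 0))
  · exact hn.mul ((hc _).sub (hb 1))

theorem hasTemperateGrowth_vSpinor (hm : 0 < m) (s : Fin 2) (a : Fin 4) :
    (fun p => vSpinor m s p a).HasTemperateGrowth := by
  have hn := hasTemperateGrowth_ofReal_comp (hasTemperateGrowth_spinorNorm hm)
  have hb := hasTemperateGrowth_boostSpinor hm s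
  have hc : ∀ z : ℂ, (fun _ : R3 => z).HasTemperateGrowth := .const
  fin_cases a
  · exact hn.mul ((hc _).add (hb 0))
  · exact hn.mul ((hc _).add (hb 1))
  · exact hn.mul ((hc _).sub (hb 0)).neg
  · exact hn.mul ((hc _).sub (hb 1)).neg

theorem hasTemperateGrowth_diracCoeff01 (hm : 0 < m) (s a : Fin 4) :
    (fun p => diracCoeff01 m p s a).HasTemperateGrowth := by
  have hc : ∀ z : ℂ, (fun _ : R3 => z).HasTemperateGrowth := .const
  simp only [diracCoeff01, div_eq_mul_inv]
  refine Function.HasTemperateGrowth.mul ?_ (hc _)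
  fin_cases s
  · exact hasTemperateGrowth_uSpinor hm 0 a
  · exact hasTemperateGrowth_uSpinor hm 1 a
  · exact hc 0
  · exact hc 0

theorem hasTemperateGrowth_diracCoeff10 (hm : 0 < m) (s a : Fin 4) :
    (fun p => diracCoeff10 m p s a).HasTemperateGrowth := by
  have hc : ∀ z : ℂ, (fun _ : R3 => z).HasTemperateGrowth := .const
  simp only [diracCoeff10, div_eq_mul_inv]
  refine Function.HasTemperateGrowth.mul ?_ (hc _)
  fin_cases s
  · exact hc 0
  · exact hc 0
  · exact hasTemperateGrowth_vSpinor hm 0 a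
  · exact hasTemperateGrowth_vSpinor hm 1 a

/-- The map `φ ↦ κ(φ)` for a massive field with coefficients of temperate growth. -/
def massiveCLM (A : R3 → Fin 4 → Fin 4 → ℂ) (hm : 0 < m) {σ : ℝ} (hσ : σ ≠ 0) :
    𝓢(R4, C4) →L[ℂ] 𝓢(R3, C4) :=
  ∑ s : Fin 4, ∑ a : Fin 4, SchwartzMap.smulLeftCLM C4 (fun p => A p s a) ∘L
    SchwartzMap.postcompCLM
      ((ContinuousLinearMap.toSpanSingleton ℂ (EuclideanSpace.single s (1 : ℂ))) ∘L
        (EuclideanSpace.proj a : C4 →L[ℂ] ℂ)) ∘L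
    shellCLM hm (div_two_pi_ne_zero hσ) ∘L SchwartzMap.fourierTransformCLM ℂ

theorem massiveCLM_apply {A : R3 → Fin 4 → Fin 4 → ℂ}
    (hA : ∀ s a, (fun p => A p s a).HasTemperateGrowth) (hm : 0 < m) {σ : ℝ} (hσ : σ ≠ 0)
    (φ : 𝓢(R4, C4)) (p : R3) (s : Fin 4) :
    massiveCLM A hm hσ φ p s = smear (planeKernel A σ m) φ s p := by
  have h : massiveCLM A hm hσ φ p = ∑ s : Fin 4, ∑ a : Fin 4,
      A p s a • ((𝓕 φ) ((σ / (2 * Real.pi)) • shellVec m p) a •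
        (EuclideanSpace.single s (1 : ℂ) : C4)) := by
    simp only [massiveCLM, sum_apply, ContinuousLinearMap.comp_apply,
      SchwartzMap.smulLeftCLM_apply_apply (hA _ _)]
    rfl
  rw [smear_planeKernel, h, WithLp.ofLp_sum, Finset.sum_apply, Finset.sum_eq_single s]
  · rw [WithLp.ofLp_sum, Finset.sum_apply]
    simp
  · intro r _ hr
    rw [WithLp.ofLp_sum, Finset.sum_apply]
    simp [hr.symm]
  · simp

theorem kernelEverywhere_massive {A : R3 → Fin 4 → Fin 4 → ℂ}
    (hA : ∀ s a, (fun p => A p s a).HasTemperateGrowth) (hm : 0 < m) {σ : ℝ} (hσ : σ ≠ 0)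
    (𝓔 : Submodule ℂ 𝓢(R4, C4)) : KernelEverywhere (planeKernel A σ m) ⊤ 𝓔 :=
  ⟨(massiveCLM A hm hσ ∘L 𝓔.subtypeL).codRestrict ⊤ fun _ => Submodule.mem_top,
    fun φ s p => massiveCLM_apply hA hm hσ φ p s⟩

end Massive

/-! ### Bounds on the smeared kernels that follow from the three conditions -/

/-- The functions `κ(φ)` are bounded by multiples of `|p|^N`. -/
def SmearBounded (κ : PlaneKernel) (𝓔 : Submodule ℂ 𝓢(R4, C4)) (N : ℕ) : Prop :=
  ∀ (φ : 𝓔) (s : Fin 4), ∃ C : ℝ, ∀ p : R3, p ≠ 0 →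
    ‖smear κ (φ : 𝓢(R4, C4)) s p‖ ≤ C * ‖p‖ ^ N

/-- The functions `κ(φ)` are continuous away from zero. -/
def SmearContinuous (κ : PlaneKernel) : Prop :=
  ∀ (φ : 𝓢(R4, C4)) (s : Fin 4) (p : R3), p ≠ 0 → ContinuousAt (smear κ φ s) p

/-- A set of full measure is dense, so it meets the neighbourhood where the inequality would fail.
-/
theorem le_of_ae_le_of_continuousAt {f g : R3 → ℝ} (h : ∀ᵐ p, f p ≤ g p) {p : R3}
    (hf : ContinuousAt f p) (hg : ContinuousAt g p) : f p ≤ g p := by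
  by_contra! hlt
  have h1 : ∀ᶠ q in nhds p, g q < f q := hg.eventually_lt hf hlt
  obtain ⟨U, hU, hUo, hpU⟩ := mem_nhds_iff.1 h1
  obtain ⟨q, hq, hq'⟩ := (Measure.dense_of_ae h).inter_open_nonempty U hUo ⟨p, hpU⟩
  exact not_le.2 (show g q < f q from hU hq) hq'

theorem bound_of_ae_bound {κ : PlaneKernel} (hκ : SmearContinuous κ) (φ : 𝓢(R4, C4)) (s : Fin 4)
    {C : ℝ} {N : ℕ} (h : ∀ᵐ p, ‖smear κ φ s p‖ ≤ C * ‖p‖ ^ N) (p : R3) (hp : p ≠ 0) :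
    ‖smear κ φ s p‖ ≤ C * ‖p‖ ^ N :=
  le_of_ae_le_of_continuousAt h (hκ φ s p hp).norm (by fun_prop)

/-- The two properties of `E` used as obstructions: boundedness (`N = 0`) and, for `S⁰`, vanishing
at zero at least linearly (`N = 1`). -/
theorem exists_seminorm_pow_bound {E : Submodule ℂ 𝓢(R3, C4)} {N : ℕ}
    (hE : N = 0 ∨ N = 1 ∧ E = S0 3) : ∃ q : Seminorm ℂ E, Continuous q ∧
      ∀ (η : E) (p : R3) (s : Fin 4), ‖(η : 𝓢(R3, C4)) p s‖ ≤ q η * ‖p‖ ^ N := by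
  rcases hE with rfl | ⟨rfl, rfl⟩
  · refine ⟨_, continuous_seminorm_comp
      ((schwartz_withSeminorms ℂ R3 C4).continuous_seminorm 0) E.subtypeL, fun η p s => ?_⟩
    rw [pow_zero, mul_one]
    exact (PiLp.norm_apply_le _ s).trans (SchwartzMap.norm_le_seminorm ℂ (η : 𝓢(R3, C4)) p)
  · obtain ⟨Q, hQ, h⟩ := exists_flat_bound (D := R3) 1 C4
    refine ⟨_, continuous_seminorm_comp hQ (S0 3).subtypeL, fun η p s => ?_⟩
    rw [mul_comm]
    exact (PiLp.norm_apply_le _ s).trans (h η η.2 p)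

theorem KernelInL.smearBounded {κ : PlaneKernel} (hκ : SmearContinuous κ)
    {E : Submodule ℂ 𝓢(R3, C4)} {𝓔 : Submodule ℂ 𝓢(R4, C4)} {N : ℕ}
    (hE : N = 0 ∨ N = 1 ∧ E = S0 3) (h : KernelInL κ E 𝓔) : SmearBounded κ 𝓔 N := by
  obtain ⟨K, hK⟩ := h
  obtain ⟨q, -, hq⟩ := exists_seminorm_pow_bound hE
  refine fun φ s => ⟨q (K φ), bound_of_ae_bound hκ φ s ?_⟩
  filter_upwards [hK φ s] with p hp
  rw [← hp]
  exact hq (K φ) p s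

theorem integrable_pow_mul_component (f : 𝓢(R3, C4)) (N : ℕ) (s : Fin 4) :
    Integrable fun p : R3 => ‖p‖ ^ N * ‖f p s‖ :=
  (component s f).integrable_pow_mul volume N

/-- A continuous functional on the dual of `E` is bounded on `E` by weighted `L¹`-norms. -/
theorem exists_integral_bound {E : Submodule ℂ 𝓢(R3, C4)} {N : ℕ}
    (hE : N = 0 ∨ N = 1 ∧ E = S0 3) (l : (E →L[ℂ] ℂ) →L[ℂ] ℂ) : ∃ C : ℝ, 0 ≤ C ∧ ∀ ξ : E,
      ‖l (toDual E ξ)‖ ≤ C * ∑ s : Fin 4, ∫ p : R3, ‖p‖ ^ N * ‖(ξ : 𝓢(R3, C4)) p s‖ := by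
  obtain ⟨q, hqc, hq⟩ := exists_seminorm_pow_bound hE
  -- Continuity for the strong dual topology provides a bounded set `S` such that smallness on `S`
  -- controls `l`; on `S` all test functions share the bound `M ‖p‖^N`.
  have hl : l ⁻¹' Metric.ball 0 1 ∈ nhds (0 : E →L[ℂ] ℂ) :=
    l.continuous.continuousAt.preimage_mem_nhds (by rw [map_zero]; exact Metric.ball_mem_nhds 0 one_pos)
  obtain ⟨⟨S, ε⟩, ⟨hS, hε⟩, hsub⟩ := (ContinuousLinearMap.hasBasis_nhds_zero_of_basis
    (Metric.nhds_basis_ball (x := (0 : ℂ)))).mem_iff.1 hl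
  dsimp only at hS hε hsub
  obtain ⟨M, hM, hMS⟩ := exists_bound_of_isVonNBounded hqc hS
  refine ⟨2 / ε * M, by positivity, fun ξ => ?_⟩
  set B := ∑ s : Fin 4, ∫ p : R3, ‖p‖ ^ N * ‖(ξ : 𝓢(R3, C4)) p s‖ with hB
  have hB0 : 0 ≤ B := Finset.sum_nonneg fun s _ => integral_nonneg fun p => by positivity
  have hb : ∀ η ∈ S, ‖toDual E ξ η‖ ≤ M * B := fun η hη => by
    rw [toDual_apply, hB, Finset.mul_sum]
    refine (norm_sum_le _ _).trans (Finset.sum_le_sum fun s _ => ?_)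
    rw [← integral_const_mul]
    refine norm_integral_le_of_norm_le ((integrable_pow_mul_component _ N s).const_mul M)
      (.of_forall fun p => ?_)
    have h1 : ‖(η : 𝓢(R3, C4)) p s‖ ≤ M * ‖p‖ ^ N :=
      (hq η p s).trans (mul_le_mul_of_nonneg_right (hMS η hη) (by positivity))
    calc ‖(ξ : 𝓢(R3, C4)) p s * (η : 𝓢(R3, C4)) p s‖
        ≤ ‖(ξ : 𝓢(R3, C4)) p s‖ * (M * ‖p‖ ^ N) := by
          rw [norm_mul]
          exact mul_le_mul_of_nonneg_left h1 (norm_nonneg _)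
      _ = M * (‖p‖ ^ N * ‖(ξ : 𝓢(R3, C4)) p s‖) := by ring
  refine le_of_forall_pos_le_add fun r hr => ?_
  -- `M * B` may vanish, so a positive slack is added before dividing; it contributes exactly `r` to
  -- the final bound.
  set d := M * B + r * (ε / 2) with hd
  have hd0 : 0 < d := by positivity
  have hmem : ((ε / 2 / d : ℝ) : ℂ) • toDual E ξ ∈ l ⁻¹' Metric.ball 0 1 := by
    refine hsub fun η hη => ?_
    rw [mem_ball_zero_iff, smul_apply, norm_smul, Complex.norm_real,
      Real.norm_of_nonneg (by positivity)]
    have h2 : ‖toDual E ξ η‖ ≤ d := (hb η hη).trans (by rw [hd]; linarith [mul_pos hr hε])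
    calc ε / 2 / d * ‖toDual E ξ η‖ ≤ ε / 2 / d * d := by gcongr
      _ = ε / 2 := by field_simp
      _ < ε := half_lt_self hε
  rw [Set.mem_preimage, mem_ball_zero_iff, map_smul, norm_smul, Complex.norm_real,
    Real.norm_of_nonneg (by positivity), div_mul_eq_mul_div, div_lt_one hd0] at hmem
  have : ‖l (toDual E ξ)‖ ≤ 2 / ε * d := by
    rw [div_mul_eq_mul_div, le_div_iff₀ hε]
    linarith
  refine this.trans (le_of_eq ?_)
  rw [hd]
  field_simp

/-- A smooth bump function times a vector, as a Schwartz function. -/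
def bumpSchwartz {D V : Type*} [NormedAddCommGroup D] [InnerProductSpace ℝ D]
    [FiniteDimensional ℝ D] [NormedAddCommGroup V] [NormedSpace ℝ V] {x : D} (b : ContDiffBump x)
    (v : V) : 𝓢(D, V) :=
  HasCompactSupport.toSchwartzMap (f := fun y => b y • v) b.hasCompactSupport.smul_right
    (b.contDiff.smul contDiff_const)

@[simp]
theorem bumpSchwartz_apply {D V : Type*} [NormedAddCommGroup D] [InnerProductSpace ℝ D]
    [FiniteDimensional ℝ D] [NormedAddCommGroup V] [NormedSpace ℝ V] {x : D} (b : ContDiffBump x)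
    (v : V) (y : D) : bumpSchwartz b v y = b y • v := rfl

theorem isFlat_of_eventuallyEq_zero {D V : Type*} [NormedAddCommGroup D] [NormedSpace ℝ D]
    [NormedAddCommGroup V] [NormedSpace ℝ V] {f : D → V} (hf : f =ᶠ[nhds 0] fun _ => 0) :
    IsFlat f := fun n => by
  rw [(hf.iteratedFDeriv ℝ n).eq_of_nhds, iteratedFDeriv_fun_zero]
  rfl

theorem isFlat_bumpSchwartz {D V : Type*} [NormedAddCommGroup D] [InnerProductSpace ℝ D]
    [FiniteDimensional ℝ D] [NormedAddCommGroup V] [NormedSpace ℝ V] {x : D} (b : ContDiffBump x)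
    (hb : b.rOut < ‖x‖) (v : V) : IsFlat (bumpSchwartz b v) := by
  refine isFlat_of_eventuallyEq_zero ?_
  have h : ∀ᶠ y in nhds (0 : D), b.rOut < dist y x :=
    (continuous_id.dist continuous_const).continuousAt.eventually_const_lt (by simpa using hb)
  filter_upwards [h] with y hy
  rw [bumpSchwartz_apply, b.zero_of_le_dist hy.le, zero_smul]

/-- A functional bounded by a weighted `L¹`-norm has a density bounded by the weight. If the bound
failed at `p₀`, a bump function near `p₀` with suitable phase would contradict it. -/
theorem KernelInDualL.smearBounded {κ : PlaneKernel} (hκ : SmearContinuous κ)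
    {E : Submodule ℂ 𝓢(R3, C4)} (hE0 : S0 3 ≤ E) {𝓔 : Submodule ℂ 𝓢(R4, C4)} {N : ℕ}
    (hE : N = 0 ∨ N = 1 ∧ E = S0 3) (h : KernelInDualL κ E 𝓔) : SmearBounded κ 𝓔 N := by
  obtain ⟨K, hK⟩ := h
  intro φ s
  -- The functional is `ξ ↦ K ξ φ`, written as a composition of continuous maps.
  obtain ⟨C, hC, hl⟩ := exists_integral_bound hE ((ContinuousLinearMap.apply ℂ ℂ (1 : ℂ)) ∘L
    (ContinuousLinearMap.precomp ℂ (ContinuousLinearMap.toSpanSingleton ℂ φ)) ∘L K)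
  refine ⟨C, fun p₀ hp₀ => ?_⟩
  by_contra! hlt
  set f := smear κ (φ : 𝓢(R4, C4)) s with hf
  have hf0 : f p₀ ≠ 0 := norm_pos_iff.1 (lt_of_le_of_lt (by positivity) hlt)
  set z : ℂ := (starRingEnd ℂ) (f p₀) / (‖f p₀‖ : ℂ) with hz
  have hz1 : ‖z‖ = 1 := by
    rw [hz, norm_div, RCLike.norm_conj, Complex.norm_real, norm_norm,
      div_self (norm_ne_zero_iff.2 hf0)]
  have hz2 : z * f p₀ = (‖f p₀‖ : ℂ) := by
    rw [hz, div_mul_eq_mul_div, mul_comm, Complex.mul_conj, Complex.normSq_eq_norm_sq]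
    push_cast
    field_simp
  have hcont : ∀ p ≠ 0, ContinuousAt f p := hκ φ s
  have hev : ∀ᶠ p in nhds p₀, p ≠ 0 ∧ C * ‖p‖ ^ N < (z * f p).re := by
    refine (eventually_ne_nhds hp₀).and (ContinuousAt.eventually_lt (by fun_prop) ?_ ?_)
    · exact Complex.continuous_re.continuousAt.comp ((hcont p₀ hp₀).const_mul z)
    · rw [hz2, Complex.ofReal_re]
      exact hlt
  obtain ⟨r, hr, hball⟩ := Metric.eventually_nhds_iff_ball.1 hev
  let b : ContDiffBump p₀ := ⟨r / 4, r / 2, by positivity, by linarith⟩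
  have hsupp : ∀ p ∈ tsupport b, p ∈ Metric.ball p₀ r := fun p hp => by
    rw [b.tsupport_eq] at hp
    exact Metric.closedBall_subset_ball (half_lt_self hr) hp
  -- The ball avoids the origin, so the bump is flat there and belongs to `S⁰ ⊆ E`.
  have hb0 : b.rOut < ‖p₀‖ := by
    by_contra! hle
    have : (0 : R3) ∈ Metric.ball p₀ r := by
      rw [Metric.mem_ball, dist_zero_left]
      exact hle.trans_lt (half_lt_self hr)
    exact (hball 0 this).1 rfl
  let ξ : E := ⟨bumpSchwartz b (z • (EuclideanSpace.single s 1 : C4)),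
    hE0 (isFlat_bumpSchwartz b hb0 _)⟩
  have hξ : ∀ p t, (ξ : 𝓢(R3, C4)) p t = if t = s then (b p : ℂ) * z else 0 := fun p t => by
    change (b p • (z • (EuclideanSpace.single s 1 : C4))) t = _
    simp
  have h1 : K (toDual E ξ) φ = ∫ p : R3, (b p : ℂ) * (z * f p) := by
    rw [hK, Finset.sum_eq_single s]
    · refine integral_congr_ae (.of_forall fun p => ?_)
      simp only [hξ, if_true]
      ring
    · intro t _ ht
      simp [hξ, ht]
    · simp
  have h2 : ∑ t : Fin 4, ∫ p : R3, ‖p‖ ^ N * ‖(ξ : 𝓢(R3, C4)) p t‖ =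
      ∫ p : R3, ‖p‖ ^ N * b p := by
    rw [Finset.sum_eq_single s]
    · refine integral_congr_ae (.of_forall fun p => ?_)
      simp only [hξ, if_true, norm_mul, hz1, mul_one, Complex.norm_real,
        Real.norm_of_nonneg b.nonneg]
    · intro t _ ht
      simp [hξ, ht]
    · simp
  -- Continuity of `f` is known only away from zero, which is enough on the support of the bump.
  have hc1 : Continuous fun p : R3 => (b p : ℂ) * (z * f p) := by
    refine continuous_of_tsupport fun p hp => ?_
    have hp' : p ∈ tsupport b := by
      refine closure_mono (fun q hq => ?_) hp
      simp only [Function.mem_support] at hq ⊢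
      intro h0
      simp [h0] at hq
    exact (Complex.continuous_ofReal.comp b.continuous).continuousAt.mul
      ((hcont p (hball p (hsupp p hp')).1).const_mul z)
  have hs1 : HasCompactSupport fun p : R3 => (b p : ℂ) * (z * f p) :=
    (b.hasCompactSupport.comp_left (g := Complex.ofReal) Complex.ofReal_zero).mul_right
  have hc2 : Continuous fun p : R3 => C * (‖p‖ ^ N * b p) :=
    continuous_const.mul ((continuous_norm.pow N).mul b.continuous)
  have hs2 : HasCompactSupport fun p : R3 => C * (‖p‖ ^ N * b p) :=
    (b.hasCompactSupport.mul_left).mul_left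
  have hc3 : Continuous fun p : R3 => ((b p : ℂ) * (z * f p)).re := Complex.continuous_re.comp hc1
  have hs3 : HasCompactSupport fun p : R3 => ((b p : ℂ) * (z * f p)).re :=
    hs1.comp_left (g := Complex.re) Complex.zero_re
  have h3 : 0 < ∫ p : R3, (((b p : ℂ) * (z * f p)).re - C * (‖p‖ ^ N * b p)) := by
    have hre : ∀ p, ((b p : ℂ) * (z * f p)).re = b p * (z * f p).re := fun p =>
      Complex.re_ofReal_mul _ _
    refine (hc3.sub hc2).integral_pos_of_hasCompactSupport_nonneg_nonzero (x := p₀)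
      (hs3.sub hs2) (fun p => ?_) ?_
    · change 0 ≤ _ - _
      rw [hre]
      rcases eq_or_ne (b p) 0 with h0 | h0
      · simp [h0]
      · have := (hball p (hsupp p (subset_tsupport _ h0))).2
        nlinarith [b.nonneg (x := p), mul_nonneg (b.nonneg (x := p)) (sub_nonneg.2 this.le)]
    · have hbp : b p₀ = 1 := b.one_of_mem_closedBall (Metric.mem_closedBall_self b.rIn_pos.le)
      rw [hre, hbp, hz2, Complex.ofReal_re, one_mul, mul_one]
      exact (sub_pos.2 hlt).ne'
  rw [integral_sub (hc3.integrable_of_hasCompactSupport hs3)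
    (hc2.integrable_of_hasCompactSupport hs2), integral_const_mul] at h3
  have h4 := hl ξ
  rw [h2] at h4
  simp only [ContinuousLinearMap.comp_apply, ContinuousLinearMap.precomp_apply,
    ContinuousLinearMap.apply_apply, ContinuousLinearMap.toSpanSingleton_apply, one_smul] at h4
  have h5 : (∫ p : R3, ((b p : ℂ) * (z * f p)).re) = (K (toDual E ξ) φ).re := by
    rw [h1]
    exact integral_re (hc1.integrable_of_hasCompactSupport hs1)
  rw [h5] at h3
  have h6 : (K (toDual E ξ) φ).re ≤ ‖K (toDual E ξ) φ‖ := Complex.re_le_norm _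
  have h7 : ‖K (toDual E ξ) φ‖ ≤ C * ∫ p : R3, ‖p‖ ^ N * b p := h4
  linarith

/-! ### The one-particle component of the field applied to the vacuum -/

/-- The vacuum sequence `(1, 0, 0, …)`. -/
def vacuumSeq : FockSeq
  | 0, _ => HasCompactSupport.toSchwartzMap (f := fun _ => 1) (.of_compactSpace _) contDiff_const
  | _ + 1, _ => 0

theorem vacuumSeq_zero (s : Fin 0 → Fin 4) (p : Fin 0 → R3) : vacuumSeq 0 s p = 1 := rfl

theorem vacuumSeq_succ (n : ℕ) : vacuumSeq (n + 1) = 0 := rfl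

theorem vacuumSeq_mem (ε : Statistics) (E : Submodule ℂ 𝓢(R3, C4)) :
    vacuumSeq ∈ hidaSubmodule ε E := by
  refine ⟨fun n => ?_, fun n σ s p => ?_, fun k => ?_⟩
  · cases n with
    | zero =>
      refine mem_tensorPower_of_eq_prod (ξ := Fin.elim0) fun s p => ?_
      rw [vacuumSeq_zero, Finset.univ_eq_empty, Finset.prod_empty]
    | succ n => exact zero_mem _
  · cases n with
    | zero =>
      rw [vacuumSeq_zero, vacuumSeq_zero, Subsingleton.elim σ 1]
      cases ε <;> simp [Statistics.permSign]
    | succ n => simp [vacuumSeq_succ]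
  · refine memℓp_fockWeight (M := oscNorm k (vacuumSeq 0 Fin.elim0)) fun n s => ?_
    cases n with
    | zero => simp [Subsingleton.elim s Fin.elim0]
    | succ n =>
      have : oscNorm k (vacuumSeq (n + 1) s) = 0 := by
        simpa [vacuumSeq_succ] using oscNorm_smul k 0 (0 : SchwartzN (n + 1))
      rw [this, mul_zero]
      exact mul_nonneg (oscNorm_nonneg _ _) (by positivity)

/-- Evaluation at zero is continuous, so its kernel is closed and contains the closure of the span
of the generators. -/
theorem apply_zero_of_mem_tensorPower_S0 {f : NParticle 1} (hf : f ∈ tensorPower (S0 3) 1)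
    (s : Fin 1 → Fin 4) : f s 0 = 0 := by
  let ev : NParticle 1 →L[ℂ] ℂ := (BoundedContinuousFunction.evalCLM ℂ (0 : Fin 1 → R3)) ∘L
    (SchwartzMap.toBoundedContinuousFunctionCLM ℂ (Fin 1 → R3) ℂ) ∘L
    (ContinuousLinearMap.proj (R := ℂ) (φ := fun _ : Fin 1 → Fin 4 => SchwartzN 1) s)
  have h : tensorPower (S0 3) 1 ≤ LinearMap.ker ev.toLinearMap := by
    refine Submodule.topologicalClosure_minimal _ (Submodule.span_le.2 ?_) ev.isClosed_ker
    rintro g ⟨ξ, hξ⟩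
    change g s 0 = 0
    rw [hξ, Fin.prod_univ_one]
    change (ξ 0 : 𝓢(R3, C4)) 0 (s 0) = 0
    rw [IsFlat.apply_zero (ξ 0).2]
    rfl
  exact h hf

theorem exists_bound_of_mem_tensorPower {E : Submodule ℂ 𝓢(R3, C4)} {N : ℕ}
    (hE : N = 0 ∨ N = 1 ∧ E = S0 3) {f : NParticle 1} (hf : f ∈ tensorPower E 1)
    (s : Fin 1 → Fin 4) : ∃ C : ℝ, ∀ p, ‖f s p‖ ≤ C * ‖p‖ ^ N := by
  rcases hE with rfl | ⟨rfl, rfl⟩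
  · refine ⟨SchwartzMap.seminorm ℂ 0 0 (f s), fun p => ?_⟩
    rw [pow_zero, mul_one]
    exact SchwartzMap.norm_le_seminorm ℂ (f s) p
  · refine ⟨SchwartzMap.seminorm ℂ 0 0 (SchwartzMap.fderivCLM ℂ _ _ (f s)), fun p => ?_⟩
    have := convex_univ.norm_image_sub_le_of_norm_fderiv_le (𝕜 := ℝ) (x := 0) (y := p)
      (fun x _ => (f s).differentiableAt)
      (fun x _ => SchwartzMap.norm_le_seminorm ℂ (SchwartzMap.fderivCLM ℂ _ _ (f s)) x)
      (Set.mem_univ _) (Set.mem_univ _)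
    rwa [apply_zero_of_mem_tensorPower_S0 hf, sub_zero, sub_zero, ← pow_one ‖p‖] at this

theorem creation_vacuumSeq (ε : Statistics) (w : Fin 4 → R3 → ℂ) (s : Fin 1 → Fin 4)
    (p : Fin 1 → R3) : creation ε w vacuumSeq 1 s p = w (s 0) (p 0) := by
  simp only [creation, vacuumSeq_zero]
  cases ε <;> simp [Statistics.moveSign]

theorem annihilation_vacuumSeq (w : Fin 4 → R3 → ℂ) (n : ℕ) (s : Fin n → Fin 4)
    (p : Fin n → R3) : annihilation w vacuumSeq n s p = 0 := by
  simp [annihilation, vacuumSeq_succ]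

/-- On the vacuum the annihilation part vanishes and the one-particle component of the creation part
is `κ_{1,0}(φ)` itself. It therefore agrees almost everywhere with an element of `E^{⊗1}`. -/
theorem IsOperatorValuedDistribution.smearBounded {ε : Statistics} {κ01 κ10 : PlaneKernel}
    (hκ : SmearContinuous κ10) {E : Submodule ℂ 𝓢(R3, C4)} {𝓔 : Submodule ℂ 𝓢(R4, C4)} {N : ℕ}
    (hE : N = 0 ∨ N = 1 ∧ E = S0 3) (h : IsOperatorValuedDistribution ε κ01 κ10 E 𝓔) :
    SmearBounded κ10 𝓔 N := by
  obtain ⟨T, hT⟩ := h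
  intro φ s
  let Ω : HidaSpace ε E := ⟨vacuumSeq, vacuumSeq_mem ε E⟩
  have hΩ : HidaSpace.seq Ω = vacuumSeq := rfl
  have hmem : (T φ Ω).seq 1 ∈ tensorPower E 1 := (T φ Ω).2.1 1
  obtain ⟨C, hC⟩ := exists_bound_of_mem_tensorPower hE hmem fun _ => s
  refine ⟨C, bound_of_ae_bound hκ φ s ?_⟩
  have h1 := ((volume_preserving_funUnique (Fin 1) R3).symm _).quasiMeasurePreserving.ae
    (hT φ Ω 1 fun _ => s)
  filter_upwards [h1] with p hp
  rw [hΩ, annihilation_vacuumSeq, creation_vacuumSeq, zero_add] at hp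
  have h2 := hC ((MeasurableEquiv.funUnique (Fin 1) R3).symm p)
  rw [hp] at h2
  have h3 : ‖(MeasurableEquiv.funUnique (Fin 1) R3).symm p‖ = ‖p‖ := by
    change ‖fun _ : Fin 1 => p‖ = ‖p‖
    exact pi_norm_const p
  rw [h3] at h2
  exact h2

/-! ### Unbounded smeared kernels -/

theorem continuous_smul_shellVec (c m : ℝ) : Continuous fun p => c • shellVec m p := by
  have := continuous_shellVec m
  fun_prop

theorem smearContinuous_planeKernel {A : R3 → Fin 4 → Fin 4 → ℂ}
    (hA : ∀ s a (p : R3), p ≠ 0 → ContinuousAt (fun p => A p s a) p) (σ m : ℝ) :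
    SmearContinuous (planeKernel A σ m) := fun φ s p hp => by
  rw [show smear (planeKernel A σ m) φ s = _ from funext (smear_planeKernel A σ m φ s)]
  refine tendsto_finsetSum _ fun a _ => (hA s a p hp).mul (Continuous.continuousAt ?_)
  exact (EuclideanSpace.proj a : C4 →L[ℂ] ℂ).continuous.comp
    ((𝓕 φ).continuous.comp (continuous_smul_shellVec _ m))

theorem smearContinuous_potential (σ : ℝ) : SmearContinuous (planeKernel potentialCoeff σ 0) := by
  refine smearContinuous_planeKernel (fun s a p hp => ?_) σ 0
  simp only [potentialCoeff_eq]
  refine ContinuousAt.mul continuousAt_const (Complex.continuous_ofReal.continuousAt.comp ?_)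
  exact continuous_norm.continuousAt.rpow_const (Or.inl (norm_ne_zero_iff.2 hp))

theorem smearContinuous_dirac10 {m : ℝ} (hm : 0 < m) (σ : ℝ) :
    SmearContinuous (planeKernel (diracCoeff10 m) σ m) :=
  smearContinuous_planeKernel
    (fun s a _ _ => (hasTemperateGrowth_diracCoeff10 hm s a).1.continuous.continuousAt) σ m

theorem fourier_fourierInv_schwartz (ψ : 𝓢(R4, C4)) : 𝓕 (𝓕⁻ ψ) = ψ :=
  FourierTransform.fourier_fourierInv_eq ψ

theorem smear_fourierInv_single {A : R3 → Fin 4 → Fin 4 → ℂ} {σ m : ℝ} {k : R4}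
    (b : ContDiffBump k) (s : Fin 4) (p : R3) :
    smear (planeKernel A σ m) (𝓕⁻ (bumpSchwartz b (EuclideanSpace.single 0 1 : C4)) : 𝓢(R4, C4)) s p =
      A p s 0 * b ((σ / (2 * Real.pi)) • shellVec m p) := by
  rw [smear_planeKernel, fourier_fourierInv_schwartz, Finset.sum_eq_single 0]
  · simp
  · intro a _ ha
    simp [ha]
  · simp

/-- With `𝓕 φ` equal to a unit vector near the origin, `κ(φ)` equals a multiple of `‖p‖^(-1/2)`
there. A bound by `C` would give `1/c ≤ C ‖p‖^(1/2)` with a right side tending to zero. -/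
theorem not_smearBounded_potential (σ : ℝ) :
    ¬ SmearBounded (planeKernel potentialCoeff σ 0) ⊤ 0 := fun h => by
  let b : ContDiffBump (0 : R4) := ⟨1, 2, one_pos, one_lt_two⟩
  obtain ⟨C, hC⟩ := h ⟨𝓕⁻ (bumpSchwartz b (EuclideanSpace.single 0 1 : C4)), Submodule.mem_top⟩ 0
  simp only [smear_fourierInv_single, pow_zero, mul_one] at hC
  set c := normConst * √2 with hc
  have hc0 : 0 < c := by have := normConst_pos; positivity
  have h0 : (σ / (2 * Real.pi)) • shellVec 0 (0 : R3) = 0 := by simp [shellVec, energy_zero]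
  have hcont := continuous_smul_shellVec (σ / (2 * Real.pi)) 0
  have hev : ∀ᶠ p in nhds (0 : R3), b ((σ / (2 * Real.pi)) • shellVec 0 p) = 1 := by
    have ht := hcont.tendsto 0
    rw [h0] at ht
    exact ht.eventually b.eventuallyEq_one
  have hle : ∀ᶠ p in nhdsWithin (0 : R3) {0}ᶜ, 1 / c ≤ C * ‖p‖ ^ (1 / 2 : ℝ) := by
    filter_upwards [hev.filter_mono nhdsWithin_le_nhds, self_mem_nhdsWithin] with p hp hp0
    have hn : 0 < ‖p‖ := norm_pos_iff.2 hp0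
    have h2 := hC p hp0
    rw [hp, potentialCoeff_eq, ← Complex.ofReal_mul, Complex.ofReal_one, mul_one,
      Complex.norm_real, show metric 0 0 = 1 by simp [metric], ← hc,
      Real.norm_of_nonneg (by positivity), Real.rpow_neg hn.le, ← div_eq_mul_inv,
      div_le_iff₀ (by positivity)] at h2
    exact h2
  have hlim : Filter.Tendsto (fun p : R3 => C * ‖p‖ ^ (1 / 2 : ℝ)) (nhdsWithin 0 {0}ᶜ)
      (nhds (C * ‖(0 : R3)‖ ^ (1 / 2 : ℝ))) :=
    (Continuous.tendsto (continuous_const.mul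
      (continuous_norm.rpow_const fun _ => Or.inr (by norm_num))) 0).mono_left nhdsWithin_le_nhds
  have := ge_of_tendsto hlim hle
  rw [norm_zero, Real.zero_rpow (by norm_num), mul_zero] at this
  exact absurd this (not_le.2 (by positivity))

/-- At rest the boost vanishes and the spinor reduces to its normalization. The index 2 is the spin
index `s = 3`, the first nonzero one for `κ_{1,0}`. -/
theorem diracCoeff10_zero_ne {m : ℝ} (hm : 0 < m) : diracCoeff10 m 0 2 0 ≠ 0 := by
  have h1 : vSpinor m 0 0 0 = (spinorNorm m 0 : ℂ) := by
    simp [vSpinor, boostSpinor_apply]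
  have h2 : spinorNorm m 0 ≠ 0 := by
    have := energy_pos hm 0
    unfold spinorNorm
    positivity
  simp only [diracCoeff10]
  change vSpinor m 0 0 0 / _ ≠ 0
  rw [h1]
  exact div_ne_zero (by exact_mod_cast h2) (by exact_mod_cast normConst_pos.ne')

/-- The shell point `k` over `p = 0` has energy `m > 0`, hence is not the origin. A bump for `𝓕 φ`
at `k` is flat at the origin, while `κ(φ)` at zero momentum is a nonzero coefficient, against a
bound by `C ‖p‖`. -/
theorem not_smearBounded_dirac10 {m : ℝ} (hm : 0 < m) {σ : ℝ} (hσ : σ ≠ 0)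
    {𝓔 : Submodule ℂ 𝓢(R4, C4)} (h𝓔 : S00 4 ≤ 𝓔) :
    ¬ SmearBounded (planeKernel (diracCoeff10 m) σ m) 𝓔 1 := fun h => by
  set k : R4 := (σ / (2 * Real.pi)) • shellVec m 0 with hk
  have hk0 : 0 < ‖k‖ := by
    rw [norm_pos_iff, hk]
    refine smul_ne_zero (div_two_pi_ne_zero hσ) fun h0 => ?_
    have := congrArg (fun v : R4 => v 0) h0
    simp only [shellVec_zero] at this
    exact (energy_pos hm 0).ne' this
  let b : ContDiffBump k := ⟨‖k‖ / 4, ‖k‖ / 2, by positivity, by linarith⟩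
  have hpos : b.rOut < ‖k‖ := half_lt_self hk0
  clear_value b
  have hmem : (𝓕⁻ (bumpSchwartz b (EuclideanSpace.single 0 1 : C4)) : 𝓢(R4, C4)) ∈ 𝓔 := by
    refine h𝓔 ?_
    change IsFlat (𝓕 (𝓕⁻ (bumpSchwartz b (EuclideanSpace.single 0 1 : C4)) : 𝓢(R4, C4)) : 𝓢(R4, C4))
    rw [fourier_fourierInv_schwartz]
    exact isFlat_bumpSchwartz b hpos _
  obtain ⟨C, hC⟩ := h ⟨_, hmem⟩ 2
  simp only [smear_fourierInv_single, pow_one] at hC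
  have hcont : Continuous fun p : R3 => ‖diracCoeff10 m p 2 0 *
      b ((σ / (2 * Real.pi)) • shellVec m p)‖ :=
    ((hasTemperateGrowth_diracCoeff10 hm 2 0).1.continuous.mul (Complex.continuous_ofReal.comp
      (b.continuous.comp (continuous_smul_shellVec _ m)))).norm
  have hcont' : Continuous fun p : R3 => C * ‖p‖ := by fun_prop
  have hlim := le_of_tendsto_of_tendsto
    ((hcont.tendsto 0).mono_left (nhdsWithin_le_nhds (s := {0}ᶜ)))
    ((hcont'.tendsto 0).mono_left nhdsWithin_le_nhds)
    (Filter.eventually_of_mem self_mem_nhdsWithin hC)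
  rw [norm_zero, mul_zero, ← hk, b.one_of_mem_closedBall (Metric.mem_closedBall_self b.rIn_pos.le),
    Complex.ofReal_one, mul_one, norm_le_zero_iff] at hlim
  exact diracCoeff10_zero_ne hm hlim

/-! ### Smearing in momentum space -/

/-- The coefficients are measurable and times functions in `E` they decrease rapidly, with bounds
by continuous seminorms of `E`. -/
structure RapidCoeff (A : R3 → Fin 4 → Fin 4 → ℂ) (E : Submodule ℂ 𝓢(R3, C4)) : Prop where
  measurable : ∀ s a, Measurable fun p => A p s a
  bound : ∀ N : ℕ, ∃ q : Seminorm ℂ E, Continuous q ∧ ∀ (ξ : E) (p : R3) (s a : Fin 4),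
    (1 + ‖p‖) ^ N * ‖A p s a * (ξ : 𝓢(R3, C4)) p s‖ ≤ q ξ

/-- One order of vanishing of `ξ` beats the singularity: `‖p‖^(-1/2) ‖p‖ = ‖p‖^(1/2) ≤ 1 + ‖p‖`. The
excess is paid with one additional weight, hence `N + 1`. -/
theorem rapidCoeff_potential : RapidCoeff potentialCoeff (S0 3) where
  measurable s a := by
    unfold potentialCoeff
    have := (continuous_energy 0).measurable
    fun_prop
  bound N := by
    obtain ⟨Q, hQ, h⟩ := exists_flat_bound_mul (D := R3) (V := C4) 1 (N + 1)
    set c : ℝ := (normConst * √2)⁻¹ with hc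
    have hc0 : 0 ≤ c := by have := normConst_pos; positivity
    refine ⟨c.toNNReal • Q.comp (S0 3).subtypeL.toLinearMap,
      (continuous_seminorm_comp hQ (S0 3).subtypeL).const_smul _, fun ξ p s a => ?_⟩
    have e : (c.toNNReal • Q.comp (S0 3).subtypeL.toLinearMap) ξ = c * Q ξ := by
      rw [smul_apply, NNReal.smul_def, Real.coe_toNNReal _ hc0]
      rfl
    rw [e]
    have hq : 0 ≤ Q ξ := apply_nonneg Q _
    rcases eq_or_ne p 0 with rfl | hp
    · rw [IsFlat.apply_zero ξ.2]
      simp only [PiLp.zero_apply, mul_zero, norm_zero]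
      positivity
    have hn : 0 < ‖p‖ := norm_pos_iff.2 hp
    have hm : |metric s a| ≤ 1 := by
      fin_cases s <;> fin_cases a <;> simp [metric, Matrix.diagonal]
    have hA : ‖potentialCoeff p s a‖ ≤ c * (√‖p‖)⁻¹ := by
      have hp0 : 0 < normConst * √2 := by have := normConst_pos; positivity
      have e1 : ‖metric s a / (normConst * √2)‖ ≤ c := by
        rw [Real.norm_eq_abs, abs_div, abs_of_pos hp0, div_eq_mul_inv]
        exact mul_le_of_le_one_left hc0 hm
      rw [potentialCoeff_eq, norm_mul, Complex.norm_real, Complex.norm_real, Real.rpow_neg hn.le,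
        ← Real.sqrt_eq_rpow]
      exact mul_le_mul e1 (le_of_eq (Real.norm_of_nonneg (by positivity))) (norm_nonneg _) hc0
    have h1 := h ξ ξ.2 p
    rw [pow_one] at h1
    have hs : (√‖p‖)⁻¹ * ‖p‖ ≤ 1 + ‖p‖ := by
      have : (√‖p‖)⁻¹ * ‖p‖ = √‖p‖ := by
        rw [inv_mul_eq_div]
        exact Real.div_sqrt
      rw [this]
      nlinarith [Real.sq_sqrt hn.le, sq_nonneg (√‖p‖ - 1), Real.sqrt_nonneg ‖p‖]
    have h2 : (1 + ‖p‖) * ((1 + ‖p‖) ^ N * ‖potentialCoeff p s a * (ξ : 𝓢(R3, C4)) p s‖) ≤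
        (1 + ‖p‖) * (c * Q ξ) := by
      calc (1 + ‖p‖) * ((1 + ‖p‖) ^ N * ‖potentialCoeff p s a * (ξ : 𝓢(R3, C4)) p s‖)
          = ‖potentialCoeff p s a‖ * ((1 + ‖p‖) ^ (N + 1) * ‖(ξ : 𝓢(R3, C4)) p s‖) := by
            rw [norm_mul]; ring
        _ ≤ (c * (√‖p‖)⁻¹) * ((1 + ‖p‖) ^ (N + 1) * ‖(ξ : 𝓢(R3, C4)) p‖) := by
            refine mul_le_mul hA (mul_le_mul_of_nonneg_left (PiLp.norm_apply_le _ s)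
              (by positivity)) (by positivity) (by positivity)
        _ ≤ (c * (√‖p‖)⁻¹) * (‖p‖ * Q ξ) := mul_le_mul_of_nonneg_left h1 (by positivity)
        _ = c * (((√‖p‖)⁻¹ * ‖p‖) * Q ξ) := by ring
        _ ≤ c * ((1 + ‖p‖) * Q ξ) := by gcongr
        _ = _ := by ring
    exact le_of_mul_le_mul_left h2 (by positivity)

theorem rapidCoeff_of_hasTemperateGrowth {A : R3 → Fin 4 → Fin 4 → ℂ}
    (hA : ∀ s a, (fun p => A p s a).HasTemperateGrowth) (E : Submodule ℂ 𝓢(R3, C4)) :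
    RapidCoeff A E where
  measurable s a := (hA s a).1.continuous.measurable
  bound N := by
    have h : ∀ i : Fin 4 × Fin 4, ∃ q : Seminorm ℂ E, Continuous q ∧ ∀ (ξ : E) (p : R3),
        (1 + ‖p‖) ^ N * ‖A p i.1 i.2 * (ξ : 𝓢(R3, C4)) p i.1‖ ≤ q ξ := fun i => by
      obtain ⟨k, C, hC⟩ := (hA i.1 i.2).2 0
      obtain ⟨q, hq, h⟩ := exists_seminorm_one_add_pow (D := R3) (V := C4) (N + k) 0
      refine ⟨|C|.toNNReal • q.comp E.subtypeL.toLinearMap,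
        (continuous_seminorm_comp hq E.subtypeL).const_smul _, fun ξ p => ?_⟩
      have e : (|C|.toNNReal • q.comp E.subtypeL.toLinearMap) ξ = |C| * q ξ := by
        rw [smul_apply, NNReal.smul_def, Real.coe_toNNReal _ (abs_nonneg C)]
        rfl
      rw [e, norm_mul]
      have h1 := hC p
      have h2 := h ξ 0 le_rfl p
      rw [norm_iteratedFDeriv_zero] at h1 h2
      have h3 : ‖A p i.1 i.2‖ ≤ |C| * (1 + ‖p‖) ^ k :=
        h1.trans (mul_le_mul_of_nonneg_right (le_abs_self C) (by positivity))
      calc (1 + ‖p‖) ^ N * (‖A p i.1 i.2‖ * ‖(ξ : 𝓢(R3, C4)) p i.1‖)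
          ≤ (1 + ‖p‖) ^ N * ((|C| * (1 + ‖p‖) ^ k) * ‖(ξ : 𝓢(R3, C4)) p‖) := by
            gcongr
            exact PiLp.norm_apply_le _ _
        _ = |C| * ((1 + ‖p‖) ^ (N + k) * ‖(ξ : 𝓢(R3, C4)) p‖) := by rw [pow_add]; ring
        _ ≤ |C| * q ξ := mul_le_mul_of_nonneg_left h2 (abs_nonneg C)
    choose q hq h using h
    refine ⟨∑ i, q i, ?_, fun ξ p s a => ?_⟩
    · have : ⇑(∑ i, q i) = fun ξ => ∑ i, q i ξ := funext fun ξ => by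
        exact sum_apply _ _ _
      rw [this]
      exact continuous_finsetSum _ fun i _ => hq i
    · rw [sum_apply]
      exact (h (s, a) ξ p).trans (Finset.single_le_sum (f := fun i => q i ξ)
        (fun i _ => apply_nonneg _ _) (Finset.mem_univ _))

/-- The vector-valued amplitude `p ↦ (∑ₛ A(p)_{sa} ξˢ(p))_a`. -/
def amplitude (A : R3 → Fin 4 → Fin 4 → ℂ) (ξ : 𝓢(R3, C4)) (p : R3) : C4 :=
  ∑ a : Fin 4, ∑ s : Fin 4, (A p s a * ξ p s) • EuclideanSpace.single a (1 : ℂ)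

section Smear

variable {A : R3 → Fin 4 → Fin 4 → ℂ} {E : Submodule ℂ 𝓢(R3, C4)}

theorem amplitude_apply (ξ : 𝓢(R3, C4)) (p : R3) (a : Fin 4) :
    amplitude A ξ p a = ∑ s : Fin 4, A p s a * ξ p s := by
  simp only [amplitude, WithLp.ofLp_sum, Finset.sum_apply, PiLp.smul_apply]
  rw [Finset.sum_eq_single a]
  · simp
  · intro b _ hb
    simp [hb.symm]
  · simp

theorem RapidCoeff.measurable_amplitude (hA : RapidCoeff A E) (ξ : 𝓢(R3, C4)) :
    Measurable (amplitude A ξ) := by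
  refine Finset.measurable_fun_sum _ fun a _ => Finset.measurable_fun_sum _ fun s _ => ?_
  exact ((hA.measurable s a).mul (component s ξ).continuous.measurable).smul_const _

theorem RapidCoeff.exists_amplitude_bound (hA : RapidCoeff A E) (N : ℕ) :
    ∃ q : Seminorm ℂ E, Continuous q ∧ ∀ (ξ : E) (p : R3),
      (1 + ‖p‖) ^ N * ‖amplitude A (ξ : 𝓢(R3, C4)) p‖ ≤ q ξ * ((1 + ‖p‖) ^ 4)⁻¹ := by
  obtain ⟨q, hq, h⟩ := hA.bound (N + 4)
  refine ⟨(16 : NNReal) • q, hq.const_smul _, fun ξ p => ?_⟩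
  rw [smul_apply, NNReal.smul_def, NNReal.coe_ofNat, smul_eq_mul, ← div_eq_mul_inv,
    le_div_iff₀ (by positivity)]
  have h1 : ‖amplitude A (ξ : 𝓢(R3, C4)) p‖ ≤
      ∑ a : Fin 4, ∑ s : Fin 4, ‖A p s a * (ξ : 𝓢(R3, C4)) p s‖ := by
    refine (norm_sum_le _ _).trans (Finset.sum_le_sum fun a _ => (norm_sum_le _ _).trans
      (Finset.sum_le_sum fun s _ => ?_))
    rw [norm_smul, PiLp.norm_single, norm_one, mul_one]
  calc (1 + ‖p‖) ^ N * ‖amplitude A (ξ : 𝓢(R3, C4)) p‖ * (1 + ‖p‖) ^ 4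
      = (1 + ‖p‖) ^ (N + 4) * ‖amplitude A (ξ : 𝓢(R3, C4)) p‖ := by rw [pow_add]; ring
    _ ≤ (1 + ‖p‖) ^ (N + 4) * ∑ a : Fin 4, ∑ s : Fin 4, ‖A p s a * (ξ : 𝓢(R3, C4)) p s‖ := by
        gcongr
    _ = ∑ a : Fin 4, ∑ s : Fin 4,
          (1 + ‖p‖) ^ (N + 4) * ‖A p s a * (ξ : 𝓢(R3, C4)) p s‖ := by
        simp only [Finset.mul_sum]
    _ ≤ ∑ a : Fin 4, ∑ s : Fin 4, q ξ :=
        Finset.sum_le_sum fun a _ => Finset.sum_le_sum fun s _ => h ξ p s a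
    _ = 16 * q ξ := by
        simp only [Finset.sum_const, Finset.card_univ, Fintype.card_fin, nsmul_eq_mul]
        push_cast
        ring

theorem RapidCoeff.integrable_amplitude (hA : RapidCoeff A E) (ξ : E) (N : ℕ) :
    Integrable fun p : R3 => (1 + ‖p‖) ^ N * ‖amplitude A (ξ : 𝓢(R3, C4)) p‖ := by
  obtain ⟨q, -, h⟩ := hA.exists_amplitude_bound N
  refine (integrable_inv_one_add_norm_pow.const_mul (q ξ)).mono' ?_ (.of_forall fun p => ?_)
  · exact (Continuous.aestronglyMeasurable (by fun_prop)).mul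
      (hA.measurable_amplitude _).aestronglyMeasurable.norm
  · rw [Real.norm_of_nonneg (by positivity)]
    exact h ξ p

/-- The image of Lebesgue measure on the mass-`m` orbit. -/
def shellMeasure (m : ℝ) : Measure R4 := (volume : Measure R3).map (shellVec m)

theorem RapidCoeff.integrable_shell (hA : RapidCoeff A E) (m : ℝ) (ξ : E) (n : ℕ) :
    Integrable (fun k : R4 => ‖k‖ ^ n * ‖amplitude A (ξ : 𝓢(R3, C4)) (spacePart k)‖)
      (shellMeasure m) ∧
    ∫ k : R4, ‖k‖ ^ n * ‖amplitude A (ξ : 𝓢(R3, C4)) (spacePart k)‖ ∂shellMeasure m ≤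
      (2 + |m|) ^ n * ∫ p : R3, (1 + ‖p‖) ^ n * ‖amplitude A (ξ : 𝓢(R3, C4)) p‖ := by
  have hm := (continuous_shellVec m).aemeasurable (μ := (volume : Measure R3))
  have hms : AEStronglyMeasurable
      (fun k : R4 => ‖k‖ ^ n * ‖amplitude A (ξ : 𝓢(R3, C4)) (spacePart k)‖) (shellMeasure m) :=
    (Continuous.aestronglyMeasurable (by fun_prop)).mul
      ((hA.measurable_amplitude _).comp spacePart.continuous.measurable).aestronglyMeasurable.norm
  have hle : ∀ p : R3, ‖shellVec m p‖ ^ n * ‖amplitude A (ξ : 𝓢(R3, C4)) p‖ ≤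
      (2 + |m|) ^ n * ((1 + ‖p‖) ^ n * ‖amplitude A (ξ : 𝓢(R3, C4)) p‖) := fun p => by
    rw [← mul_assoc, ← mul_pow]
    gcongr
    refine (norm_shellVec_le m p).trans ?_
    nlinarith [norm_nonneg p, abs_nonneg m, mul_nonneg (norm_nonneg p) (abs_nonneg m)]
  have hi : Integrable fun p : R3 => ‖shellVec m p‖ ^ n * ‖amplitude A (ξ : 𝓢(R3, C4)) p‖ := by
    refine ((hA.integrable_amplitude ξ n).const_mul ((2 + |m|) ^ n)).mono' ?_
      (.of_forall fun p => ?_)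
    · exact (((continuous_shellVec m).norm.pow n).aestronglyMeasurable).mul
        (hA.measurable_amplitude _).aestronglyMeasurable.norm
    · rw [Real.norm_of_nonneg (by positivity)]
      exact hle p
  constructor
  · rw [shellMeasure, integrable_map_measure hms hm]
    simpa only [Function.comp_def, spacePart_shellVec] using hi
  · rw [shellMeasure, integral_map hm hms, ← integral_const_mul]
    simp only [spacePart_shellVec]
    exact integral_mono hi ((hA.integrable_amplitude ξ n).const_mul _) hle

/-- The pairing `(k, x) ↦ σ ⟨k, x⟩ / 2π`. -/
def phasePairing (σ : ℝ) : R4 →L[ℝ] R4 →L[ℝ] ℝ := (σ / (2 * Real.pi)) • innerSL ℝ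

theorem fourierChar_phasePairing (σ m : ℝ) (p : R3) (x : R4) :
    (Real.fourierChar (-(phasePairing σ (shellVec m p) x)) : ℂ) =
      Complex.exp (-(Complex.I * ((σ * minkowskiProd m p x : ℝ) : ℂ))) := by
  have h : 2 * Real.pi * -(phasePairing σ (shellVec m p) x) =
      -2 * Real.pi * inner ℝ x ((σ / (2 * Real.pi)) • shellVec m p) := by
    rw [inner_smul_right, real_inner_comm]
    change 2 * Real.pi * -((σ / (2 * Real.pi)) * inner ℝ (shellVec m p) x) = _
    ring
  rw [exp_minkowskiProd, Real.fourierChar_apply, h]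

theorem continuous_planeWave (σ m : ℝ) (x : R4) : Continuous fun p : R3 =>
    Complex.exp (-(Complex.I * ((σ * minkowskiProd m p x : ℝ) : ℂ))) := by
  simp only [← inner_shellVec]
  have := continuous_shellVec m
  fun_prop

theorem norm_planeWave_le (σ m : ℝ) (x : R4) (p : R3) :
    ‖Complex.exp (-(Complex.I * ((σ * minkowskiProd m p x : ℝ) : ℂ)))‖ ≤ 1 := by
  rw [exp_minkowskiProd, Complex.norm_exp_ofReal_mul_I]

theorem RapidCoeff.integrable_planeKernel (hA : RapidCoeff A E) (σ m : ℝ) (ξ : E) (x : R4)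
    (s a : Fin 4) :
    Integrable fun p : R3 => planeKernel A σ m s p a x * (ξ : 𝓢(R3, C4)) p s := by
  obtain ⟨q, -, hq⟩ := hA.bound 4
  refine (integrable_inv_one_add_norm_pow.const_mul (q ξ)).mono' ?_ (.of_forall fun p => ?_)
  · exact ((hA.measurable s a).mul (continuous_planeWave σ m x).measurable).aestronglyMeasurable.mul
      (component s (ξ : 𝓢(R3, C4))).continuous.aestronglyMeasurable
  · rw [← div_eq_mul_inv, le_div_iff₀ (by positivity), planeKernel, mul_right_comm, norm_mul]
    have h1 := mul_le_of_le_one_right (norm_nonneg (A p s a * (ξ : 𝓢(R3, C4)) p s))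
      (norm_planeWave_le σ m x p)
    calc _ ≤ ‖A p s a * (ξ : 𝓢(R3, C4)) p s‖ * (1 + ‖p‖) ^ 4 := by gcongr
      _ ≤ q ξ := by rw [mul_comm]; exact hq ξ p s a

/-- Since `spacePart` inverts `shellVec`, the amplitude becomes a function on `ℝ⁴` and the momentum
integral a Fourier integral over the shell measure. Smoothness then follows from finite moments. -/
theorem RapidCoeff.smearMomentum_eq (hA : RapidCoeff A E) (σ m : ℝ) (ξ : E) :
    smearMomentum (planeKernel A σ m) (ξ : 𝓢(R3, C4)) =
      VectorFourier.fourierIntegral Real.fourierChar (shellMeasure m)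
        (phasePairing σ).toLinearMap₁₂
        fun k => amplitude A (ξ : 𝓢(R3, C4)) (spacePart k) := by
  funext x
  have hm := (continuous_shellVec m).aemeasurable (μ := (volume : Measure R3))
  rw [VectorFourier.fourierIntegral, shellMeasure, integral_map hm]
  swap
  · refine Measurable.aestronglyMeasurable ?_
    refine Measurable.smul (Continuous.measurable ?_)
      ((hA.measurable_amplitude _).comp spacePart.continuous.measurable)
    exact continuous_subtype_val.comp
      (Real.continuous_fourierChar.comp ((phasePairing σ).flip x).continuous.neg)
  simp only [spacePart_shellVec, Circle.smul_def]
  have hch : ∀ p : R3, (Real.fourierChar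
      (-(((phasePairing σ).toLinearMap₁₂ (shellVec m p)) x)) : ℂ) =
      Complex.exp (-(Complex.I * ((σ * minkowskiProd m p x : ℝ) : ℂ))) :=
    fun p => fourierChar_phasePairing σ m p x
  simp only [hch]
  have hint : Integrable fun p : R3 =>
      Complex.exp (-(Complex.I * ((σ * minkowskiProd m p x : ℝ) : ℂ))) •
        amplitude A (ξ : 𝓢(R3, C4)) p := by
    have h0 : Integrable (amplitude A (ξ : 𝓢(R3, C4))) := by
      have := hA.integrable_amplitude ξ 0
      simp only [pow_zero, one_mul] at this
      exact (integrable_norm_iff (hA.measurable_amplitude _).aestronglyMeasurable).1 this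
    exact h0.bdd_smul 1 (continuous_planeWave σ m x).aestronglyMeasurable
      (.of_forall (norm_planeWave_le σ m x))
  ext a
  have h1 := (EuclideanSpace.proj a : C4 →L[ℂ] ℂ).integral_comp_comm hint
  simp only [PiLp.proj_apply] at h1
  rw [← h1]
  simp only [smearMomentum, PiLp.smul_apply, amplitude_apply, smul_eq_mul, Finset.mul_sum]
  rw [integral_finsetSum]
  · refine Finset.sum_congr rfl fun s _ => integral_congr_ae (.of_forall fun p => ?_)
    simp only [planeKernel]
    ring
  · intro s _
    refine (hA.integrable_planeKernel σ m ξ x s a).congr (.of_forall fun p => ?_)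
    simp only [planeKernel]
    ring

theorem RapidCoeff.contDiff_smearMomentum (hA : RapidCoeff A E) (σ m : ℝ) (ξ : E) :
    ContDiff ℝ ∞ (smearMomentum (planeKernel A σ m) (ξ : 𝓢(R3, C4))) := by
  rw [hA.smearMomentum_eq]
  exact VectorFourier.contDiff_fourierIntegral (N := ⊤) (phasePairing σ)
    fun n _ => (hA.integrable_shell m ξ n).1

/-- Each derivative brings down one factor of `k`, so the `n`-th one is bounded, uniformly in `x`,
by the `n`-th moment of the amplitude. -/
theorem RapidCoeff.exists_smearMomentum_bound (hA : RapidCoeff A E) (σ m : ℝ) (n : ℕ) :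
    ∃ q : Seminorm ℂ E, Continuous q ∧ ∀ (ξ : E) (x : R4),
      ‖iteratedFDeriv ℝ n (smearMomentum (planeKernel A σ m) (ξ : 𝓢(R3, C4))) x‖ ≤ q ξ := by
  obtain ⟨q, hq, h⟩ := hA.exists_amplitude_bound n
  set I : ℝ := ∫ p : R3, ((1 + ‖p‖) ^ 4)⁻¹ with hI
  have hI0 : 0 ≤ I := integral_nonneg fun p => by positivity
  set C : ℝ := (2 * Real.pi * ‖phasePairing σ‖) ^ n * ((2 + |m|) ^ n * I) with hC
  have hC0 : 0 ≤ C := by have := Real.pi_pos; positivity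
  refine ⟨C.toNNReal • q, hq.const_smul _, fun ξ x => ?_⟩
  have hms : AEStronglyMeasurable (fun k : R4 => amplitude A (ξ : 𝓢(R3, C4)) (spacePart k))
      (shellMeasure m) :=
    ((hA.measurable_amplitude _).comp spacePart.continuous.measurable).aestronglyMeasurable
  obtain ⟨hi, hb⟩ := hA.integrable_shell m ξ n
  rw [smul_apply, NNReal.smul_def, Real.coe_toNNReal _ hC0, smul_eq_mul, hA.smearMomentum_eq,
    VectorFourier.iteratedFDeriv_fourierIntegral (N := ⊤) (phasePairing σ)
      (fun n _ => (hA.integrable_shell m ξ n).1) hms (by exact_mod_cast le_top)]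
  refine (VectorFourier.norm_fourierIntegral_le_integral_norm _ _ _ _ _).trans ?_
  calc ∫ k : R4, ‖VectorFourier.fourierPowSMulRight (phasePairing σ)
        (fun k => amplitude A (ξ : 𝓢(R3, C4)) (spacePart k)) k n‖ ∂shellMeasure m
      ≤ ∫ k : R4, (2 * Real.pi * ‖phasePairing σ‖) ^ n *
          (‖k‖ ^ n * ‖amplitude A (ξ : 𝓢(R3, C4)) (spacePart k)‖) ∂shellMeasure m := by
        refine integral_mono
          (VectorFourier.integrable_fourierPowSMulRight (phasePairing σ) hi hms).norm
          (hi.const_mul _) fun k => ?_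
        rw [← mul_assoc]
        exact VectorFourier.norm_fourierPowSMulRight_le (phasePairing σ) _ k n
    _ ≤ (2 * Real.pi * ‖phasePairing σ‖) ^ n * ((2 + |m|) ^ n *
          ∫ p : R3, (1 + ‖p‖) ^ n * ‖amplitude A (ξ : 𝓢(R3, C4)) p‖) := by
        rw [integral_const_mul]
        have := Real.pi_pos
        gcongr
    _ ≤ (2 * Real.pi * ‖phasePairing σ‖) ^ n * ((2 + |m|) ^ n * (q ξ * I)) := by
        have := Real.pi_pos
        refine mul_le_mul_of_nonneg_left (mul_le_mul_of_nonneg_left ?_ (by positivity))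
          (by positivity)
        rw [hI, ← integral_const_mul]
        exact integral_mono (hA.integrable_amplitude ξ n)
          (integrable_inv_one_add_norm_pow.const_mul _) (h ξ)
    _ = C * q ξ := by rw [hC]; ring

theorem RapidCoeff.isSmoothWithBoundedDerivs (hA : RapidCoeff A E) (σ m : ℝ) (ξ : E) :
    IsSmoothWithBoundedDerivs (smearMomentum (planeKernel A σ m) (ξ : 𝓢(R3, C4))) :=
  ⟨hA.contDiff_smearMomentum σ m ξ, fun n => by
    obtain ⟨q, -, h⟩ := hA.exists_smearMomentum_bound σ m n
    exact ⟨q ξ, h ξ⟩⟩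

theorem IsSmoothWithBoundedDerivs.hasTemperateGrowth {f : R4 → C4}
    (hf : IsSmoothWithBoundedDerivs f) : f.HasTemperateGrowth :=
  ⟨hf.1, fun n => by
    obtain ⟨C, hC⟩ := hf.2 n
    exact ⟨0, C, fun x => by simpa using hC x⟩⟩

/-- Uniform bounds on the derivatives are stronger than the topology of `O_M`: its seminorms only
add the factor `sup |φ|`. -/
theorem RapidCoeff.kernelInLOM (hA : RapidCoeff A E) (σ m : ℝ) :
    KernelInLOM (planeKernel A σ m) E := by
  let L : E →ₗ[ℂ] OM :=
    { toFun ξ := ⟨smearMomentum (planeKernel A σ m) (ξ : 𝓢(R3, C4)),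
        (hA.isSmoothWithBoundedDerivs σ m ξ).hasTemperateGrowth⟩
      map_add' ξ η := by
        refine Subtype.ext (funext fun x => ?_)
        ext a
        change ∑ s : Fin 4, ∫ p : R3, planeKernel A σ m s p a x *
            ((ξ : 𝓢(R3, C4)) p s + (η : 𝓢(R3, C4)) p s) =
          (∑ s : Fin 4, ∫ p : R3, planeKernel A σ m s p a x * (ξ : 𝓢(R3, C4)) p s) +
            ∑ s : Fin 4, ∫ p : R3, planeKernel A σ m s p a x * (η : 𝓢(R3, C4)) p s
        rw [← Finset.sum_add_distrib]
        refine Finset.sum_congr rfl fun s _ => ?_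
        simp only [mul_add]
        exact integral_add (hA.integrable_planeKernel σ m ξ x s a)
          (hA.integrable_planeKernel σ m η x s a)
      map_smul' c ξ := by
        refine Subtype.ext (funext fun x => ?_)
        ext a
        change ∑ s : Fin 4, ∫ p : R3, planeKernel A σ m s p a x *
            (c * (ξ : 𝓢(R3, C4)) p s) =
          c * ∑ s : Fin 4, ∫ p : R3, planeKernel A σ m s p a x * (ξ : 𝓢(R3, C4)) p s
        rw [Finset.mul_sum]
        refine Finset.sum_congr rfl fun s _ => ?_
        simp only [mul_left_comm _ c]
        exact integral_const_mul _ _ }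
  refine ⟨⟨L, continuous_of_seminorm_le om_withSeminorms L fun ⟨φ, n⟩ => ?_⟩, fun ξ => rfl⟩
  obtain ⟨q, hq, h⟩ := hA.exists_smearMomentum_bound σ m n
  set M := SchwartzMap.seminorm ℂ 0 0 φ with hM
  have hM0 : 0 ≤ M := apply_nonneg _ _
  refine ⟨M.toNNReal • q, hq.const_smul _, fun ξ => ?_⟩
  rw [smul_apply, NNReal.smul_def, Real.coe_toNNReal _ hM0, smul_eq_mul]
  refine ciSup_le fun x => ?_
  exact mul_le_mul (SchwartzMap.norm_le_seminorm ℂ φ x) (h ξ x) (norm_nonneg _) hM0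

end Smear

/-! ### The three conditions -/

theorem conditions_of_kernelEverywhere (ε : Statistics) {κ01 κ10 : PlaneKernel}
    {E : Submodule ℂ 𝓢(R3, C4)} {𝓔 : Submodule ℂ 𝓢(R4, C4)} (h01 : KernelEverywhere κ01 E 𝓔)
    (h10 : KernelEverywhere κ10 E 𝓔) : IsOperatorValuedDistribution ε κ01 κ10 E 𝓔 ∧
      (KernelInL κ01 E 𝓔 ∧ KernelInL κ10 E 𝓔) ∧ (KernelInDualL κ01 E 𝓔 ∧ KernelInDualL κ10 E 𝓔) :=
  ⟨isOperatorValuedDistribution_of_kernelEverywhere h01 h10, ⟨h01.kernelInL, h10.kernelInL⟩,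
    h01.kernelInDualL, h10.kernelInDualL⟩

theorem not_conditions_of_not_smearBounded (ε : Statistics) (κ01 : PlaneKernel)
    {κ10 : PlaneKernel} (hκ : SmearContinuous κ10) {E : Submodule ℂ 𝓢(R3, C4)} (hE0 : S0 3 ≤ E)
    {𝓔 : Submodule ℂ 𝓢(R4, C4)} {N : ℕ} (hE : N = 0 ∨ N = 1 ∧ E = S0 3)
    (h : ¬ SmearBounded κ10 𝓔 N) : ¬ IsOperatorValuedDistribution ε κ01 κ10 E 𝓔 ∧
      ¬ (KernelInL κ01 E 𝓔 ∧ KernelInL κ10 E 𝓔) ∧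
      ¬ (KernelInDualL κ01 E 𝓔 ∧ KernelInDualL κ10 E 𝓔) :=
  ⟨fun h1 => h (h1.smearBounded hκ hE), fun h2 => h (h2.2.smearBounded hκ hE),
    fun h3 => h (h3.2.smearBounded hκ hE0 hE)⟩

theorem conditions_potential {E : Submodule ℂ 𝓢(R3, C4)} (hE : E = ⊤ ∨ E = S0 3) :
    IsOperatorValuedDistribution .bose potential01 potential10 E (S00 4) ∧
      (KernelInL potential01 E (S00 4) ∧ KernelInL potential10 E (S00 4)) ∧
      (KernelInDualL potential01 E (S00 4) ∧ KernelInDualL potential10 E (S00 4)) := by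
  rw [potential01_eq, potential10_eq]
  rcases hE with rfl | rfl
  · exact conditions_of_kernelEverywhere _ (kernelEverywhere_potential_top one_ne_zero)
      (kernelEverywhere_potential_top (neg_ne_zero.2 one_ne_zero))
  · exact conditions_of_kernelEverywhere _ (kernelEverywhere_potential_S0 one_ne_zero)
      (kernelEverywhere_potential_S0 (neg_ne_zero.2 one_ne_zero))

theorem conditions_dirac {m : ℝ} (hm : 0 < m) (𝓔 : Submodule ℂ 𝓢(R4, C4)) :
    IsOperatorValuedDistribution .fermi (dirac01 m) (dirac10 m) ⊤ 𝓔 ∧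
      (KernelInL (dirac01 m) ⊤ 𝓔 ∧ KernelInL (dirac10 m) ⊤ 𝓔) ∧
      (KernelInDualL (dirac01 m) ⊤ 𝓔 ∧ KernelInDualL (dirac10 m) ⊤ 𝓔) := by
  rw [dirac01_eq, dirac10_eq]
  exact conditions_of_kernelEverywhere _
    (kernelEverywhere_massive (hasTemperateGrowth_diracCoeff01 hm) hm one_ne_zero 𝓔)
    (kernelEverywhere_massive (hasTemperateGrowth_diracCoeff10 hm) hm
      (neg_ne_zero.2 one_ne_zero) 𝓔)

theorem not_conditions_potential {E : Submodule ℂ 𝓢(R3, C4)} (hE : S0 3 ≤ E) :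
    ¬ IsOperatorValuedDistribution .bose potential01 potential10 E ⊤ ∧
      ¬ (KernelInL potential01 E ⊤ ∧ KernelInL potential10 E ⊤) ∧
      ¬ (KernelInDualL potential01 E ⊤ ∧ KernelInDualL potential10 E ⊤) := by
  rw [potential10_eq]
  exact not_conditions_of_not_smearBounded _ _ (smearContinuous_potential _) hE (Or.inl rfl)
    (not_smearBounded_potential _)

theorem not_conditions_dirac {m : ℝ} (hm : 0 < m) {𝓔 : Submodule ℂ 𝓢(R4, C4)} (h𝓔 : S00 4 ≤ 𝓔) :
    ¬ IsOperatorValuedDistribution .fermi (dirac01 m) (dirac10 m) (S0 3) 𝓔 ∧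
      ¬ (KernelInL (dirac01 m) (S0 3) 𝓔 ∧ KernelInL (dirac10 m) (S0 3) 𝓔) ∧
      ¬ (KernelInDualL (dirac01 m) (S0 3) 𝓔 ∧ KernelInDualL (dirac10 m) (S0 3) 𝓔) := by
  rw [dirac10_eq]
  exact not_conditions_of_not_smearBounded _ _ (smearContinuous_dirac10 hm _) le_rfl
    (Or.inr ⟨rfl, rfl⟩) (not_smearBounded_dirac10 hm (neg_ne_zero.2 one_ne_zero) h𝓔)

theorem S0_ne_top : S0 3 ≠ ⊤ := fun h => by
  let b : ContDiffBump (0 : R3) := ⟨1, 2, one_pos, one_lt_two⟩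
  have hmem : bumpSchwartz b (EuclideanSpace.single 0 1 : C4) ∈ S0 3 := h ▸ Submodule.mem_top
  have h0 := IsFlat.apply_zero (mem_S0_iff.1 hmem)
  rw [bumpSchwartz_apply, b.one_of_mem_closedBall (Metric.mem_closedBall_self b.rIn_pos.le),
    one_smul] at h0
  have := congrArg (fun v : C4 => v 0) h0
  simp at this

end FreeField

end

theorem mainTheorem7 (m : ℝ) (hm : 0 < m) :
    -- the electromagnetic potential: matching test spaces `(S, S)` or `(S⁰, S⁰⁰)`
    (∀ (E : Submodule ℂ 𝓢(R3, C4)) (𝓔 : Submodule ℂ 𝓢(R4, C4)),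
      ((E = ⊤ ∧ 𝓔 = ⊤) ∨ (E = S0 3 ∧ 𝓔 = S00 4)) →
      List.TFAE [
        IsOperatorValuedDistribution .bose potential01 potential10 E 𝓔,
        KernelInL potential01 E 𝓔 ∧ KernelInL potential10 E 𝓔,
        KernelInDualL potential01 E 𝓔 ∧ KernelInDualL potential10 E 𝓔,
        E = S0 3 ∧ 𝓔 = S00 4]) ∧
    -- the Dirac field: matching test spaces `(S, S)` or `(S⁰, S⁰⁰)`
    (∀ (E : Submodule ℂ 𝓢(R3, C4)) (𝓔 : Submodule ℂ 𝓢(R4, C4)),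
      ((E = ⊤ ∧ 𝓔 = ⊤) ∨ (E = S0 3 ∧ 𝓔 = S00 4)) →
      List.TFAE [
        IsOperatorValuedDistribution .fermi (dirac01 m) (dirac10 m) E 𝓔,
        KernelInL (dirac01 m) E 𝓔 ∧ KernelInL (dirac10 m) E 𝓔,
        KernelInDualL (dirac01 m) E 𝓔 ∧ KernelInDualL (dirac10 m) E 𝓔,
        E = ⊤ ∧ 𝓔 = ⊤]) ∧
    -- the mixed pairs `(S, S⁰⁰)` and `(S⁰, S)`
    (∀ (E : Submodule ℂ 𝓢(R3, C4)) (𝓔 : Submodule ℂ 𝓢(R4, C4)),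
      ((E = ⊤ ∧ 𝓔 = S00 4) ∨ (E = S0 3 ∧ 𝓔 = ⊤)) →
      List.TFAE [
        IsOperatorValuedDistribution .bose potential01 potential10 E 𝓔,
        KernelInL potential01 E 𝓔 ∧ KernelInL potential10 E 𝓔,
        KernelInDualL potential01 E 𝓔 ∧ KernelInDualL potential10 E 𝓔,
        IsOperatorValuedDistribution .fermi (dirac01 m) (dirac10 m) E 𝓔,
        KernelInL (dirac01 m) E 𝓔 ∧ KernelInL (dirac10 m) E 𝓔,
        KernelInDualL (dirac01 m) E 𝓔 ∧ KernelInDualL (dirac10 m) E 𝓔,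
        E = ⊤ ∧ 𝓔 = S00 4]) ∧
    -- in the distinguished cases the kernels map `E` continuously into `O_M`
    (KernelInLOM potential01 (S0 3) ∧ KernelInLOM potential10 (S0 3) ∧
      KernelInLOM (dirac01 m) ⊤ ∧ KernelInLOM (dirac10 m) ⊤) ∧
    -- and `κ(ξ)` is smooth with all derivatives bounded
    (∀ ξ ∈ S0 3, IsSmoothWithBoundedDerivs (smearMomentum potential01 ξ) ∧
      IsSmoothWithBoundedDerivs (smearMomentum potential10 ξ)) ∧
    (∀ ξ : 𝓢(R3, C4), IsSmoothWithBoundedDerivs (smearMomentum (dirac01 m) ξ) ∧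
      IsSmoothWithBoundedDerivs (smearMomentum (dirac10 m) ξ)) := by
  -- For each given pair of test spaces the listed conditions are either all true or all false, so
  -- no implications between them have to be proved.
  have tfae_true : ∀ {l : List Prop}, (∀ a ∈ l, a) → l.TFAE := fun h =>
    List.tfae_of_forall True _ fun a ha => iff_true_intro (h a ha)
  have tfae_false : ∀ {l : List Prop}, (∀ a ∈ l, ¬ a) → l.TFAE := fun h =>
    List.tfae_of_forall False _ fun a ha => iff_false_intro (h a ha)
  refine ⟨?_, ?_, ?_, ?_, ?_, ?_⟩
  · rintro E 𝓔 (⟨rfl, rfl⟩ | ⟨rfl, rfl⟩)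
    · obtain ⟨h1, h2, h3⟩ := not_conditions_potential (E := ⊤) le_top
      exact tfae_false (by simp only [List.forall_mem_cons]; exact
        ⟨h1, h2, h3, fun h => S0_ne_top h.1.symm, by simp⟩)
    · obtain ⟨h1, h2, h3⟩ := conditions_potential (Or.inr rfl)
      exact tfae_true (by simp only [List.forall_mem_cons]; exact
        ⟨h1, h2, h3, ⟨trivial, trivial⟩, by simp⟩)
  · rintro E 𝓔 (⟨rfl, rfl⟩ | ⟨rfl, rfl⟩)
    · obtain ⟨h1, h2, h3⟩ := conditions_dirac hm ⊤
      exact tfae_true (by simp only [List.forall_mem_cons]; exact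
        ⟨h1, h2, h3, ⟨trivial, trivial⟩, by simp⟩)
    · obtain ⟨h1, h2, h3⟩ := not_conditions_dirac hm le_rfl
      exact tfae_false (by simp only [List.forall_mem_cons]; exact
        ⟨h1, h2, h3, fun h => S0_ne_top h.1, by simp⟩)
  · rintro E 𝓔 (⟨rfl, rfl⟩ | ⟨rfl, rfl⟩)
    · obtain ⟨h1, h2, h3⟩ := conditions_potential (Or.inl rfl)
      obtain ⟨k1, k2, k3⟩ := conditions_dirac hm (S00 4)
      exact tfae_true (by simp only [List.forall_mem_cons]; exact
        ⟨h1, h2, h3, k1, k2, k3, ⟨trivial, trivial⟩, by simp⟩)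
    · obtain ⟨h1, h2, h3⟩ := not_conditions_potential (le_refl (S0 3))
      obtain ⟨k1, k2, k3⟩ := not_conditions_dirac hm (le_top (a := S00 4))
      exact tfae_false (by simp only [List.forall_mem_cons]; exact
        ⟨h1, h2, h3, k1, k2, k3, fun h => S0_ne_top h.1, by simp⟩)
  · rw [potential01_eq, potential10_eq, dirac01_eq, dirac10_eq]
    exact ⟨rapidCoeff_potential.kernelInLOM _ _, rapidCoeff_potential.kernelInLOM _ _,
      (rapidCoeff_of_hasTemperateGrowth (hasTemperateGrowth_diracCoeff01 hm) ⊤).kernelInLOM _ _,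
      (rapidCoeff_of_hasTemperateGrowth (hasTemperateGrowth_diracCoeff10 hm) ⊤).kernelInLOM _ _⟩
  · intro ξ hξ
    rw [potential01_eq, potential10_eq]
    exact ⟨rapidCoeff_potential.isSmoothWithBoundedDerivs _ _ ⟨ξ, hξ⟩,
      rapidCoeff_potential.isSmoothWithBoundedDerivs _ _ ⟨ξ, hξ⟩⟩
  · intro ξ
    rw [dirac01_eq, dirac10_eq]
    exact ⟨(rapidCoeff_of_hasTemperateGrowth (hasTemperateGrowth_diracCoeff01 hm)
        ⊤).isSmoothWithBoundedDerivs _ _ ⟨ξ, Submodule.mem_top⟩,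
      (rapidCoeff_of_hasTemperateGrowth (hasTemperateGrowth_diracCoeff10 hm)
        ⊤).isSmoothWithBoundedDerivs _ _ ⟨ξ, Submodule.mem_top⟩⟩
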